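/- Let $k$ be an algebraically closed field, $A$ a finite-dimensional (basic) $k$-algebra with a complete set $e_1,\dots,e_n$ of primitive orthogonal idempotents, $A=\bigoplus_i Ae_i$ with the $P_i=Ae_i$ pairwise non-isomorphic, and let $S=\bigoplus_i P_i/\operatorname{rad}P_i$ be the direct sum of the simple $A$-modules. Let $f:A\otimes_k A\to A$ be a Hochschild $2$-cocycle and $A_f=A\oplus At$ the infinitesimal deformation with product $(a_0+a_1t)(b_0+b_1t)=a_0b_0+(a_0b_1+a_1b_0+f(a_0\otimes b_0))t$; an $A$-module $M$ is regarded as an $A_f$-module through $A_f\to A$, $t\mapsto 0$. For matrices over $A$ put $\tilde f(B\otimes B')_{ij}=\sum_l f(b_{il}\otimes b'_{lj})$. Let $\cdots\to Q_1\xrightarrow{\delta_1}Q_0\xrightarrow{\delta_0}S\to0$ be a minimal projective resolution over $A$ with $Q_i=\bigoplus_{r=1}^{n_i}Ae_{i_r}$, let $E_i$ be the diagonal matrix with entries $e_{i_r}$, write $[x]$ for the row of components of $x\in Q_i$, and let $B_i=E_iB_iE_{i-1}$ be the matrix of $\delta_i$, i.e. $[\delta_i(x)]=[x]B_i$. Assume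 condition $(\ast)$: $\delta_0\beta\delta_2=0$, where $\beta:Q_1\to Q_0$ is $[\beta(x)]=\tilde f([x]\otimes B_1)E_0$. Let $C_i=E_iC_iE_{i-1}$ $(i\ge1)$ be matrices with $E_i\tilde f(B_i\otimes B_{i-1})E_{i-2}=C_iB_{i-1}+B_iC_{i-1}$ for $i\ge2$, and let $\alpha_i:Q_i\to Q_{i-1}$ be the $k$-linear maps $[\alpha_i(x)]=(-1)^{i+1}\bigl(\tilde f([x]\otimes B_i)E_{i-1}-[x]C_i\bigr)$. Suppose that $\operatorname{Im}\alpha_i\subset\operatorname{rad}Q_{i-1}$ for all $i>0$. For $Q=\bigoplus_r Ae_{j_r}$ let $\hat Q=Q\oplus Q$ be the $A_f$-module with $(a_0+a_1t)(x,y)=(a_0x,\;a_0y+f_Q(a_0\otimes x)+a_1x)$, where $f_Q(a\otimes x)_r=f(a\otimes x_r)e_{j_r}$. Then the modules $\bigoplus_{i=0}^m\hat Q_i$, with the differentials $\hat\delta_m:\bigoplus_{i=0}^{m}\hat Q_i\to\bigoplus_{i=0}^{m-1}\hat Q_i$ whose $i$-th component is $$(x_j,y_j)_j\mapsto\bigl(\delta_{i+1}x_{i+1},\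 (-1)^i(x_i+\alpha_{i+1}x_{i+1})+\delta_{i+1}y_{i+1}\bigr)$$ and the augmentation $(x_0,y_0)\mapsto\delta_0x_0$, form a projective resolution of $S$ over $A_f$, and there is an isomorphism of graded $k$-algebras $$\operatorname{Ext}^*_A(S,S)\otimes_k k[x]\;\cong\;\operatorname{Ext}^*_{A_f}(S,S),\qquad |x|=1,$$ where the left-hand side is the graded tensor product (with Koszul signs), the $\operatorname{Ext}$ algebras carry the Yoneda products $\star$ (over $A$) and $\circ$ (over $A_f$) defined by liftings, $h\circ g=[h\gamma_m]$ for $\deg h=m$ and $\gamma$ a lifting of $g$ commuting with the differentials without signs. It sends $[g]\,x^a$, for $g\in\operatorname{Hom}_A(Q_i,S)$, to the class of the map $\bigoplus_{j=0}^{i+a}\hat Q_j\to S$, $(x_j,y_j)_j\mapsto g(x_i)$. Under this isomorphism every $\hat g\in\operatorname{Ext}^n_{A_f}(S,S)$ is uniquely of the form $\sum_{i=0}^ng_ix^{n-i}$ with $g_i\in\operatorname{Ext}^i_A(S,S)$, and for $\hat h=\sum_{i=0}^mh_ix^{m-i}\in\operatorname{Ext}^m_{A_f}(S,S)$ $$\hat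 h\circ\hat g=\sum_{i=0}^m\sum_{s=0}^n(-1)^{s(m-i)}\,h_i\star g_s\;x^{m+n-i-s}.$$ -/

import Mathlib

universe w u v

namespace InfDef

open CategoryTheory CategoryTheory.Abelian

/-! ### The Yoneda algebra of an object -/

section Yoneda

variable (k : Type u) [CommRing k] {C : Type v} [Category.{u} C] [Abelian C] [HasExt.{w} C]

/-- The Yoneda product `h ∘ g` of `h ∈ Ext^m(Y, Z)` and `g ∈ Ext^n(X, Y)`, normalised so that
`h ∘ g` is the class of `h γ_m` for any lifting `γ` of the cocycle `g` to a map
`γ_j : P_{n+j} ⟶ P'_j` of projective resolutions that commutes (without signs) with the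
differentials.  The composition `Ext.comp` of Mathlib is taken in the derived category, where the
shift by `n` multiplies the differentials by `(-1)^n`; it differs from the product defined by
liftings by the sign `(-1)^(m n)`. -/
noncomputable def yoneda {X Y Z : C} {m n : ℕ} (h : Ext Y Z m) (g : Ext X Y n) {p : ℕ}
    (hp : m + n = p) : Ext X Z p :=
  (-1 : ℤ) ^ (m * n) • g.comp h (by omega)

/-- The degree `n` part `Ext^n(X, X)` of the Yoneda algebra of `X`. -/
def ExtPiece (X : C) (n : ℕ) : Type w := Ext X X n

noncomputable instance (X : C) (n : ℕ) : AddCommGroup (ExtPiece X n) :=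
  inferInstanceAs (AddCommGroup (Ext X X n))

noncomputable instance [Linear k C] (X : C) (n : ℕ) : Module k (ExtPiece X n) :=
  inferInstanceAs (Module k (Ext X X n))

lemma comp_zsmul' {X Y Z : C} {a b c : ℕ} (α : Ext X Y a) (r : ℤ) (β : Ext Y Z b)
    (h : a + b = c) : α.comp (r • β) h = r • α.comp β h :=
  map_zsmul (Ext.bilinearComp X Y Z a b c h α) r β

lemma zsmul_comp' {X Y Z : C} {a b c : ℕ} (α : Ext X Y a) (r : ℤ) (β : Ext Y Z b)
    (h : a + b = c) : (r • α).comp β h = r • α.comp β h :=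
  map_zsmul ((Ext.bilinearComp X Y Z a b c h).flip β) r α

lemma yoneda_assoc {X Y Z T : C} {a b c ab bc p : ℕ} (x : Ext Z T a) (y : Ext Y Z b)
    (z : Ext X Y c) (h₁ : a + b = ab) (h₂ : ab + c = p) (h₃ : b + c = bc) (h₄ : a + bc = p) :
    yoneda (yoneda x y h₁) z h₂ = yoneda x (yoneda y z h₃) h₄ := by
  subst h₁ h₃
  simp only [yoneda, comp_zsmul', zsmul_comp', smul_smul]
  have := Ext.comp_assoc z y x (add_comm c b) (add_comm b a) (a := p) (by omega)
  rw [this]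
  congr 1
  ring

section

variable {X Y Z : C} {m n p : ℕ}

lemma yoneda_zero (h : Ext Y Z m) (hp : m + n = p) : yoneda h (0 : Ext X Y n) hp = 0 := by
  simp [yoneda]

lemma zero_yoneda (g : Ext X Y n) (hp : m + n = p) : yoneda (0 : Ext Y Z m) g hp = 0 := by
  simp [yoneda]

lemma yoneda_add (h : Ext Y Z m) (g g' : Ext X Y n) (hp : m + n = p) :
    yoneda h (g + g') hp = yoneda h g hp + yoneda h g' hp := by
  simp [yoneda]

lemma add_yoneda (h h' : Ext Y Z m) (g : Ext X Y n) (hp : m + n = p) :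
    yoneda (h + h') g hp = yoneda h g hp + yoneda h' g hp := by
  simp [yoneda]

lemma one_yoneda (g : Ext X Y n) : yoneda (Ext.mk₀ (𝟙 Y)) g (zero_add n) = g := by
  simp [yoneda]

lemma yoneda_one (h : Ext X Y n) : yoneda h (Ext.mk₀ (𝟙 X)) (add_zero n) = h := by
  simp [yoneda]

variable {k} [Linear k C]

lemma smul_one_yoneda (r : k) (g : Ext X Y n) :
    yoneda (r • Ext.mk₀ (𝟙 Y)) g (zero_add n) = r • g := by
  simp [yoneda]

lemma yoneda_smul_one (r : k) (h : Ext X Y n) :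
    yoneda h (r • Ext.mk₀ (𝟙 X)) (add_zero n) = r • h := by
  simp [yoneda]

end

lemma extPiece_mk_eq {X : C} {p q : ℕ} (h : p = q) (F : ∀ r, p = r → Ext X X r) (y : Ext X X q)
    (hy : F q h = y) : (⟨p, F p rfl⟩ : GradedMonoid (ExtPiece X)) = ⟨q, y⟩ := by
  subst h hy; rfl

noncomputable instance (X : C) : GradedMonoid.GMul (ExtPiece X) where
  mul h g := yoneda (C := C) h g rfl

noncomputable instance (X : C) : GradedMonoid.GOne (ExtPiece X) where
  one := Ext.mk₀ (𝟙 X)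

noncomputable instance (X : C) : DirectSum.GSemiring (ExtPiece X) where
  mul_zero a := yoneda_zero (C := C) a rfl
  zero_mul b := zero_yoneda (C := C) b rfl
  mul_add a b c := yoneda_add (C := C) a b c rfl
  add_mul a b c := add_yoneda (C := C) a b c rfl
  one_mul := fun ⟨n, a⟩ =>
    extPiece_mk_eq (zero_add n) (fun _ hr => yoneda (Ext.mk₀ (𝟙 X)) a hr) a (one_yoneda (C := C) a)
  mul_one := fun ⟨n, a⟩ =>
    extPiece_mk_eq (add_zero n) (fun _ hr => yoneda a (Ext.mk₀ (𝟙 X)) hr) a (yoneda_one (C := C) a)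
  mul_assoc := fun ⟨a, x⟩ ⟨b, y⟩ ⟨c, z⟩ =>
    extPiece_mk_eq (add_assoc a b c) (fun _ hr => yoneda (yoneda (C := C) x y rfl) z hr)
      (yoneda x (yoneda (C := C) y z rfl) rfl) (yoneda_assoc (C := C) x y z rfl _ rfl rfl)
  natCast n := n • (Ext.mk₀ (𝟙 X) : Ext X X 0)
  natCast_zero := zero_smul ℕ (Ext.mk₀ (𝟙 X) : Ext X X 0)
  natCast_succ n := succ_nsmul (Ext.mk₀ (𝟙 X) : Ext X X 0) n

noncomputable instance (X : C) : DirectSum.GRing (ExtPiece X) where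
  intCast n := n • (Ext.mk₀ (𝟙 X) : Ext X X 0)
  intCast_ofNat n := by
    exact natCast_zsmul (Ext.mk₀ (𝟙 X) : Ext X X 0) n
  intCast_negSucc_ofNat n := by
    exact negSucc_zsmul (Ext.mk₀ (𝟙 X) : Ext X X 0) n

/-- The map `r ↦ r • 1` to the degree zero part of the Yoneda algebra. -/
noncomputable def extScalar [Linear k C] (X : C) : k →+ ExtPiece X 0 where
  toFun := fun r => r • (Ext.mk₀ (𝟙 X) : Ext X X 0)
  map_zero' := zero_smul k (Ext.mk₀ (𝟙 X) : Ext X X 0)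
  map_add' := fun r s => add_smul r s (Ext.mk₀ (𝟙 X) : Ext X X 0)

lemma extScalar_apply [Linear k C] (X : C) (r : k) :
    extScalar k X r = r • (Ext.mk₀ (𝟙 X) : Ext X X 0) := rfl

noncomputable instance [Linear k C] (X : C) : DirectSum.GAlgebra k (ExtPiece X) where
  toFun := extScalar k X
  map_one := one_smul k (Ext.mk₀ (𝟙 X) : Ext X X 0)
  map_mul r s := by
    exact (extPiece_mk_eq (add_zero 0)
      (fun _ hq => yoneda (r • Ext.mk₀ (𝟙 X)) (s • Ext.mk₀ (𝟙 X)) hq) _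
      ((smul_one_yoneda r (s • Ext.mk₀ (𝟙 X))).trans (mul_smul r s _).symm)).symm
  commutes r := fun ⟨n, a⟩ => by
    exact (extPiece_mk_eq (zero_add n) (fun _ hq => yoneda (r • Ext.mk₀ (𝟙 X)) a hq) _
      (smul_one_yoneda (C := C) r a)).trans
      (extPiece_mk_eq (add_zero n) (fun _ hq => yoneda a (r • Ext.mk₀ (𝟙 X)) hq) _
        (yoneda_smul_one (C := C) r a)).symm
  smul_def r := fun ⟨n, a⟩ => by
    exact (extPiece_mk_eq (zero_add n) (fun _ hq => yoneda (r • Ext.mk₀ (𝟙 X)) a hq) _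
      (smul_one_yoneda (C := C) r a)).symm

/-- The Yoneda algebra `Ext^*(X, X)`, with the product `h * g = h ∘ g`. -/
abbrev ExtAlgebra (X : C) : Type w := DirectSum ℕ (ExtPiece X)

/-- The homogeneous components of the Yoneda algebra. -/
noncomputable def extGrading [Linear k C] (X : C) (n : ℕ) : Submodule k (ExtAlgebra X) :=
  LinearMap.range (DirectSum.lof k ℕ (ExtPiece X) n)

/-- The inclusion of `Ext^n(X, X)` as the homogeneous component of degree `n`. -/
noncomputable def extPieceIncl [Linear k C] (X : C) (n : ℕ) : ExtPiece X n →ₗ[k] extGrading k X n :=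
  (DirectSum.lof k ℕ (ExtPiece X) n).rangeRestrict

noncomputable instance [Linear k C] (X : C) : GradedAlgebra (extGrading k X) where
  one_mem := ⟨(GradedMonoid.GOne.one : ExtPiece X 0), rfl⟩
  mul_mem := by
    rintro i j _ _ ⟨a, rfl⟩ ⟨b, rfl⟩
    refine ⟨GradedMonoid.GMul.mul a b, ?_⟩
    simp only [DirectSum.lof_eq_of]
    exact (DirectSum.of_mul_of a b).symm
  decompose' := DirectSum.toModule k ℕ _ fun i =>
    (DirectSum.lof k ℕ (fun n => extGrading k X n) i).comp (extPieceIncl k X i)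
  left_inv x := by
    induction x using DirectSum.induction_on with
    | zero => simp
    | add x y hx hy => simp only [map_add, hx, hy]
    | of i x =>
      rw [← DirectSum.lof_eq_of k, DirectSum.toModule_lof, LinearMap.comp_apply,
        DirectSum.lof_eq_of k ℕ (fun n => extGrading k X n), DirectSum.coeAddMonoidHom_of]
      rfl
  right_inv x := by
    induction x using DirectSum.induction_on with
    | zero => simp
    | add x y hx hy => simp only [map_add, hx, hy]
    | of i x =>
      obtain ⟨_, ⟨y, rfl⟩⟩ := x
      rw [DirectSum.coeAddMonoidHom_of, DirectSum.toModule_lof]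
      rfl

end Yoneda

section PolynomialGrading

variable (k : Type u) [CommRing k]

/-- The grading of `k[x]` with `x` in degree one. -/
noncomputable def polyGrading (n : ℕ) : Submodule k (Polynomial k) :=
  LinearMap.range (Polynomial.monomial n : k →ₗ[k] Polynomial k)

/-- The map `c ↦ c x ^ n` onto the homogeneous component of degree `n`. -/
noncomputable def polyPiece (n : ℕ) : k →ₗ[k] polyGrading k n :=
  (Polynomial.monomial n : k →ₗ[k] Polynomial k).rangeRestrict

/-- The decomposition of a polynomial into its homogeneous components. -/
noncomputable def polyDecompose (p : Polynomial k) : DirectSum ℕ fun n => polyGrading k n :=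
  p.sum fun i a => DirectSum.of (fun n => polyGrading k n) i (polyPiece k i a)

lemma polyDecompose_add (p q : Polynomial k) :
    polyDecompose k (p + q) = polyDecompose k p + polyDecompose k q :=
  Polynomial.sum_add_index p q _ (fun i => by rw [map_zero, map_zero])
    (fun i a b => by rw [map_add, map_add])

lemma polyDecompose_monomial (n : ℕ) (c : k) : polyDecompose k (Polynomial.monomial n c) =
    DirectSum.of (fun n => polyGrading k n) n (polyPiece k n c) :=
  Polynomial.sum_monomial_index c _ (by rw [map_zero, map_zero])

noncomputable instance : GradedAlgebra (polyGrading k) where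
  one_mem := ⟨1, rfl⟩
  mul_mem := by
    rintro i j _ _ ⟨a, rfl⟩ ⟨b, rfl⟩
    exact ⟨a * b, (Polynomial.monomial_mul_monomial i j a b).symm⟩
  decompose' := polyDecompose k
  left_inv p := by
    induction p using Polynomial.induction_on' with
    | add p q hp hq => rw [polyDecompose_add, map_add, hp, hq]
    | monomial n c =>
      rw [polyDecompose_monomial, DirectSum.coeAddMonoidHom_of]
      rfl
  right_inv x := by
    induction x using DirectSum.induction_on with
    | zero =>
      rw [map_zero]
      exact Polynomial.sum_zero_index _
    | add x y hx hy => rw [map_add, polyDecompose_add, hx, hy]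
    | of i x =>
      obtain ⟨_, ⟨y, rfl⟩⟩ := x
      rw [DirectSum.coeAddMonoidHom_of]
      exact polyDecompose_monomial k i y

end PolynomialGrading

/-! ### Infinitesimal deformations and their modules -/

section Deformation

variable (k : Type u) (A : Type u) [Field k] [Ring A] [Algebra k A]

/-- A Hochschild `2`-cocycle `f : A ⊗ A → A`, written as a `k`-bilinear map. -/
structure HochschildCocycle where
  /-- the underlying bilinear map -/
  toFun : A →ₗ[k] A →ₗ[k] A
  cocycle : ∀ a b c, a * toFun b c - toFun (a * b) c + toFun a (b * c) - toFun a b * c = 0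

variable {k A}

instance : CoeFun (HochschildCocycle k A) fun _ => A → A → A where
  coe f a b := f.toFun a b

/-- The infinitesimal deformation `A_f = A ⊕ A t`; its elements are `c₀ + c₁ t`. -/
@[ext] structure Deformation (f : HochschildCocycle k A) : Type u where
  /-- the constant coefficient -/
  c₀ : A
  /-- the coefficient of `t` -/
  c₁ : A

namespace Deformation

variable (f : HochschildCocycle k A)

instance : Zero (Deformation f) := ⟨⟨0, 0⟩⟩
instance : Add (Deformation f) := ⟨fun x y => ⟨x.c₀ + y.c₀, x.c₁ + y.c₁⟩⟩
instance : Neg (Deformation f) := ⟨fun x => ⟨-x.c₀, -x.c₁⟩⟩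
instance : Sub (Deformation f) := ⟨fun x y => ⟨x.c₀ - y.c₀, x.c₁ - y.c₁⟩⟩
instance : SMul ℕ (Deformation f) := ⟨fun r x => ⟨r • x.c₀, r • x.c₁⟩⟩
instance : SMul ℤ (Deformation f) := ⟨fun r x => ⟨r • x.c₀, r • x.c₁⟩⟩
instance : SMul k (Deformation f) := ⟨fun r x => ⟨r • x.c₀, r • x.c₁⟩⟩

/-- The pair of coefficients. -/
def toProd (x : Deformation f) : A × A := (x.c₀, x.c₁)

lemma toProd_injective : Function.Injective (toProd f) := fun x y h => by
  cases x; cases y; simpa [toProd] using h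

instance : AddCommGroup (Deformation f) :=
  (toProd_injective f).addCommGroup _ rfl (fun _ _ => rfl) (fun _ => rfl) (fun _ _ => rfl)
    (fun _ _ => rfl) (fun _ _ => rfl)

instance : Module k (Deformation f) :=
  (toProd_injective f).module k ⟨⟨toProd f, rfl⟩, fun _ _ => rfl⟩ fun _ _ => rfl

instance : Mul (Deformation f) where
  mul x y := ⟨x.c₀ * y.c₀, x.c₀ * y.c₁ + x.c₁ * y.c₀ + f x.c₀ y.c₀⟩

instance : One (Deformation f) where
  one := ⟨1, -f 1 1⟩

variable {f}

@[simp] lemma mul_c₀ (x y : Deformation f) : (x * y).c₀ = x.c₀ * y.c₀ := rfl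
@[simp] lemma mul_c₁ (x y : Deformation f) :
    (x * y).c₁ = x.c₀ * y.c₁ + x.c₁ * y.c₀ + f x.c₀ y.c₀ := rfl
@[simp] lemma one_c₀ : (1 : Deformation f).c₀ = 1 := rfl
@[simp] lemma one_c₁ : (1 : Deformation f).c₁ = -f 1 1 := rfl
@[simp] lemma add_c₀ (x y : Deformation f) : (x + y).c₀ = x.c₀ + y.c₀ := rfl
@[simp] lemma add_c₁ (x y : Deformation f) : (x + y).c₁ = x.c₁ + y.c₁ := rfl
@[simp] lemma zero_c₀ : (0 : Deformation f).c₀ = 0 := rfl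
@[simp] lemma zero_c₁ : (0 : Deformation f).c₁ = 0 := rfl
@[simp] lemma smul_c₀ (r : k) (x : Deformation f) : (r • x).c₀ = r • x.c₀ := rfl
@[simp] lemma smul_c₁ (r : k) (x : Deformation f) : (r • x).c₁ = r • x.c₁ := rfl

lemma one_left (b : A) : f.toFun 1 b = f.toFun 1 1 * b := by
  have := f.cocycle 1 1 b
  simp only [one_mul] at this
  rw [sub_self, zero_add, sub_eq_zero] at this
  exact this

lemma one_right (a : A) : f.toFun a 1 = a * f.toFun 1 1 := by
  have := f.cocycle a 1 1
  simp only [mul_one] at this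
  rw [sub_add_cancel, sub_eq_zero] at this
  exact this.symm

variable (f)

instance : Ring (Deformation f) where
  __ := (inferInstance : AddCommGroup (Deformation f))
  zero_mul x := by ext <;> simp
  mul_zero x := by ext <;> simp
  left_distrib x y z := by
    ext
    · simp [mul_add]
    · simp only [mul_c₁, add_c₀, add_c₁, mul_add, map_add]; abel
  right_distrib x y z := by
    ext
    · simp [add_mul]
    · simp only [mul_c₁, add_c₀, add_c₁, add_mul, map_add, LinearMap.add_apply]; abel
  mul_assoc x y z := by
    ext
    · simp [mul_assoc]
    · have h := f.cocycle x.c₀ y.c₀ z.c₀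
      rw [sub_eq_zero, sub_add_eq_add_sub, sub_eq_iff_eq_add] at h
      simp only [mul_c₁, mul_c₀, mul_add, add_mul, mul_assoc] at h ⊢
      calc _ = x.c₀ * (y.c₀ * z.c₁) + (x.c₀ * (y.c₁ * z.c₀) + x.c₁ * (y.c₀ * z.c₀)) +
          (f.toFun x.c₀ y.c₀ * z.c₀ + f.toFun (x.c₀ * y.c₀) z.c₀) := by abel
        _ = _ := by rw [← h]; abel
  one_mul x := by
    ext
    · simp
    · simp only [mul_c₁, one_c₀, one_c₁, one_mul]
      rw [one_left x.c₀]; noncomm_ring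
  mul_one x := by
    ext
    · simp
    · simp only [mul_c₁, one_c₀, one_c₁, mul_one]
      rw [one_right x.c₀]; noncomm_ring

instance : Algebra k (Deformation f) :=
  Algebra.ofModule (fun c x y => by ext <;> simp [smul_add])
    (fun c x y => by ext <;> simp [smul_add])

end Deformation

/-- An object `(M₀, M₁, T, f_M)` of the category `C_f`, which is identified with the category of
modules over the deformation `A_f`. -/
structure DefTuple (f : HochschildCocycle k A) (M₀ M₁ : Type u)
    [AddCommGroup M₀] [Module A M₀] [Module k M₀] [IsScalarTower k A M₀]
    [AddCommGroup M₁] [Module A M₁] [Module k M₁] [IsScalarTower k A M₁] where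
  /-- the monomorphism `T_M` -/
  T : M₀ →ₗ[A] M₁
  T_inj : Function.Injective T
  /-- the bilinear map `f_M : A ⊗ M₀ → M₁` -/
  φ : A →ₗ[k] M₀ →ₗ[k] M₁
  cond : ∀ a b m, a • φ b m - φ (a * b) m + φ a (b • m) - f a b • T m = 0

namespace DefTuple

variable {f : HochschildCocycle k A} {M₀ M₁ : Type u}
    [AddCommGroup M₀] [Module A M₀] [Module k M₀] [IsScalarTower k A M₀]
    [AddCommGroup M₁] [Module A M₁] [Module k M₁] [IsScalarTower k A M₁]

/-- The `A_f`-module `M₀ ⊕ M₁` attached to `(M₀, M₁, T, f_M)`, with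
`(a₀ + a₁ t) (m₀, m₁) = (a₀ m₀, a₀ m₁ + f_M(a₀ ⊗ m₀) + a₁ T m₀)`. -/
@[ext] structure Carrier (X : DefTuple f M₀ M₁) : Type u where
  /-- the component in `M₀` -/
  m₀ : M₀
  /-- the component in `M₁` -/
  m₁ : M₁

namespace Carrier

variable (X : DefTuple f M₀ M₁)

instance : Zero X.Carrier := ⟨⟨0, 0⟩⟩
instance : Add X.Carrier := ⟨fun x y => ⟨x.m₀ + y.m₀, x.m₁ + y.m₁⟩⟩
instance : Neg X.Carrier := ⟨fun x => ⟨-x.m₀, -x.m₁⟩⟩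
instance : Sub X.Carrier := ⟨fun x y => ⟨x.m₀ - y.m₀, x.m₁ - y.m₁⟩⟩
instance : SMul ℕ X.Carrier := ⟨fun r x => ⟨r • x.m₀, r • x.m₁⟩⟩
instance : SMul ℤ X.Carrier := ⟨fun r x => ⟨r • x.m₀, r • x.m₁⟩⟩

/-- The pair of components. -/
def toProd (x : X.Carrier) : M₀ × M₁ := (x.m₀, x.m₁)

lemma toProd_injective : Function.Injective (toProd X) := fun x y h => by
  cases x; cases y; simpa [toProd] using h

instance : AddCommGroup X.Carrier :=
  (toProd_injective X).addCommGroup _ rfl (fun _ _ => rfl) (fun _ => rfl) (fun _ _ => rfl)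
    (fun _ _ => rfl) (fun _ _ => rfl)

instance : SMul (Deformation f) X.Carrier where
  smul a m := ⟨a.c₀ • m.m₀, a.c₀ • m.m₁ + X.φ a.c₀ m.m₀ + a.c₁ • X.T m.m₀⟩

variable {X}

@[simp] lemma smul_m₀ (a : Deformation f) (m : X.Carrier) : (a • m).m₀ = a.c₀ • m.m₀ := rfl
@[simp] lemma smul_m₁ (a : Deformation f) (m : X.Carrier) :
    (a • m).m₁ = a.c₀ • m.m₁ + X.φ a.c₀ m.m₀ + a.c₁ • X.T m.m₀ := rfl
@[simp] lemma add_m₀ (x y : X.Carrier) : (x + y).m₀ = x.m₀ + y.m₀ := rfl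
@[simp] lemma add_m₁ (x y : X.Carrier) : (x + y).m₁ = x.m₁ + y.m₁ := rfl
@[simp] lemma zero_m₀ : (0 : X.Carrier).m₀ = 0 := rfl
@[simp] lemma zero_m₁ : (0 : X.Carrier).m₁ = 0 := rfl

lemma φ_one (m : M₀) : X.φ 1 m = f.toFun 1 1 • X.T m := by
  have := X.cond 1 1 m
  simp only [one_smul, one_mul] at this
  rw [sub_self, zero_add, sub_eq_zero] at this
  exact this

variable (X)

instance : Module (Deformation f) X.Carrier where
  one_smul m := by
    ext
    · simp
    · simp [φ_one]
  mul_smul a b m := by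
    ext
    · simp [mul_smul]
    · have h := X.cond a.c₀ b.c₀ m.m₀
      rw [sub_eq_zero, sub_add_eq_add_sub, sub_eq_iff_eq_add] at h
      simp only [smul_m₁, smul_m₀, Deformation.mul_c₀, Deformation.mul_c₁, smul_add, add_smul,
        mul_smul, map_smul]
      calc _ = a.c₀ • b.c₀ • m.m₁ + a.c₀ • b.c₁ • X.T m.m₀ + a.c₁ • b.c₀ • X.T m.m₀ +
          (f.toFun a.c₀ b.c₀ • X.T m.m₀ + X.φ (a.c₀ * b.c₀) m.m₀) := by abel
        _ = _ := by rw [← h]; abel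
  smul_zero a := by ext <;> simp
  zero_smul m := by ext <;> simp
  smul_add a x y := by
    ext
    · simp
    · simp only [smul_m₁, add_m₀, add_m₁, smul_add, map_add]; abel
  add_smul a b x := by
    ext
    · simp [add_smul]
    · simp only [smul_m₁, add_m₁, Deformation.add_c₀, Deformation.add_c₁, add_smul, map_add,
        LinearMap.add_apply]
      abel

end Carrier

end DefTuple

/-- The `A`-module `M` seen as the `A_f`-module `(0, M, 0, 0)`. -/
def embed (f : HochschildCocycle k A) (M : Type u) [AddCommGroup M] [Module A M] [Module k M]
    [IsScalarTower k A M] : DefTuple f PUnit.{u + 1} M where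
  T := 0
  T_inj := Function.injective_of_subsingleton _
  φ := 0
  cond := by simp

/-! ### Projective modules and minimal resolutions -/

variable (A) in
/-- A complete set `e_1, …, e_n` of primitive orthogonal idempotents of `A` such that
`A = ⨁ A e_i` is a decomposition into pairwise non-isomorphic indecomposable projectives. -/
structure BasicDecomposition (n : ℕ) where
  /-- the idempotents -/
  e : Fin n → A
  complete : CompleteOrthogonalIdempotents e
  ne_zero : ∀ i, e i ≠ 0
  primitive : ∀ i p q, IsIdempotentElem p → IsIdempotentElem q → p * q = 0 → q * p = 0 →
    p + q = e i → p = 0 ∨ q = 0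
  not_iso : ∀ i j, i ≠ j → IsEmpty (Ideal.span {e i} ≃ₗ[A] Ideal.span {e j})

namespace BasicDecomposition

variable {n : ℕ} (E : BasicDecomposition A n)

/-- The indecomposable projective module `P_i = A e_i`. -/
abbrev P (i : Fin n) : Ideal A := Ideal.span {E.e i}

lemma mul_e_mem (a : A) (i : Fin n) : a * E.e i ∈ E.P i :=
  Ideal.mul_mem_left _ _ (Ideal.mem_span_singleton_self _)

lemma mul_e (i : Fin n) (x : E.P i) : (x : A) * E.e i = x := by
  obtain ⟨a, ha⟩ := Ideal.mem_span_singleton'.1 x.2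
  rw [← ha, mul_assoc, (E.complete.idem i).eq]

/-- The simple module `S_i = P_i / rad P_i`. -/
abbrev Simple (i : Fin n) : Type u := E.P i ⧸ Module.jacobson A (E.P i)

/-- The direct sum `S` of all the simple modules `S_1, …, S_n`. -/
abbrev SimpleSum : Type u := ∀ i, E.Simple i

/-- The projective module `⨁_r A e_{σ r}`. -/
abbrev Proj {r : ℕ} (σ : Fin r → Fin n) : Type u := ∀ j, E.P (σ j)

/-- The diagonal matrix with entries `e_{σ 1}, …, e_{σ r}`. -/
def diag {r : ℕ} (σ : Fin r → Fin n) : Matrix (Fin r) (Fin r) A :=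
  Matrix.diagonal fun j => E.e (σ j)

/-- The matrices `B` with `E_σ B E_τ = B`. -/
def Corner {r s : ℕ} (σ : Fin r → Fin n) (τ : Fin s → Fin n) : Type u :=
  {B : Matrix (Fin r) (Fin s) A // E.diag σ * B * E.diag τ = B}

variable {r s : ℕ} {σ : Fin r → Fin n} {τ : Fin s → Fin n}

lemma Corner.mem (B : E.Corner σ τ) (l : Fin r) (j : Fin s) : B.1 l j ∈ E.P (τ j) := by
  rw [← B.2]
  simp only [BasicDecomposition.diag, Matrix.mul_diagonal]
  exact E.mul_e_mem _ _

/-- The morphism `⨁ A e_{σ r} → ⨁ A e_{τ s}` given by right multiplication by a matrix. -/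
def mulRight (B : E.Corner σ τ) : E.Proj σ →ₗ[A] E.Proj τ where
  toFun x j := ⟨∑ l, (x l : A) * B.1 l j,
    Submodule.sum_mem _ fun l _ => Ideal.mul_mem_left _ _ (B.mem E l j)⟩
  map_add' x y := by
    funext j; apply Subtype.ext
    simp [add_mul, Finset.sum_add_distrib]
  map_smul' a x := by
    funext j; apply Subtype.ext
    simp [Finset.mul_sum, mul_assoc]

variable (f : HochschildCocycle k A)

/-- The map `x ↦ f̃([x] ⊗ B) E_τ` from `⨁ A e_{σ r}` to `⨁ A e_{τ s}`. -/
def fRight (B : E.Corner σ τ) (x : E.Proj σ) : E.Proj τ :=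
  fun j => ⟨(∑ l, f (x l) (B.1 l j)) * E.e (τ j), E.mul_e_mem _ _⟩

/-- The bilinear map `f_Q : A ⊗ Q → Q` of `Q = ⨁ A e_{σ r}`, given on each summand `A e` by
`a ⊗ b ↦ f(a ⊗ b) e`. -/
def fProj (σ : Fin r → Fin n) : A →ₗ[k] E.Proj σ →ₗ[k] E.Proj σ :=
  LinearMap.mk₂ k (fun a x j => ⟨f a (x j) * E.e (σ j), E.mul_e_mem _ _⟩)
    (fun a b x => by funext j; apply Subtype.ext; simp [add_mul])
    (fun c a x => by funext j; apply Subtype.ext; simp)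
    (fun a x y => by funext j; apply Subtype.ext; simp [add_mul])
    (fun c a x => by funext j; apply Subtype.ext; simp)

/-- The projective `A_f`-module `Q̂ = (Q, Q, Id, f_Q)` attached to `Q = ⨁ A e_{σ r}`. -/
def hat (σ : Fin r → Fin n) : DefTuple f (E.Proj σ) (E.Proj σ) where
  T := LinearMap.id
  T_inj := Function.injective_id
  φ := E.fProj f σ
  cond a b x := by
    funext j; apply Subtype.ext
    have h := congrArg (· * E.e (σ j)) (f.cocycle a b (x j))
    simp only [sub_mul, add_mul, zero_mul, mul_assoc, E.mul_e] at h
    simpa [fProj, mul_assoc] using h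

end BasicDecomposition

/-- `f̃ : M_{r×s}(A) ⊗ M_{s×t}(A) → M_{r×t}(A)`, `f̃(B ⊗ B')_{ij} = ∑_l f(b_{il} ⊗ b'_{lj})`. -/
def ftilde (f : HochschildCocycle k A) {r s t : ℕ} (B : Matrix (Fin r) (Fin s) A)
    (B' : Matrix (Fin s) (Fin t) A) : Matrix (Fin r) (Fin t) A :=
  Matrix.of fun i j => ∑ l, f (B i l) (B' l j)

/-- A minimal projective resolution `⋯ → Q_1 → Q_0 → M → 0` together with decompositions
`Q_i = ⨁_r A e_{i_r}`; the matrix `B i` is that of the differential `δ_{i+1} : Q_{i+1} → Q_i`. -/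
structure MinimalResolution {n : ℕ} (E : BasicDecomposition A n) (M : Type u) [AddCommGroup M]
    [Module A M] where
  /-- the number of indecomposable summands of `Q_i` -/
  rank : ℕ → ℕ
  /-- the indices of the summands of `Q_i` -/
  idx : ∀ i, Fin (rank i) → Fin n
  /-- the matrix of `δ_{i+1}` -/
  B : ∀ i, E.Corner (idx (i + 1)) (idx i)
  /-- the augmentation `δ_0` -/
  δ₀ : E.Proj (idx 0) →ₗ[A] M
  surjective : Function.Surjective δ₀
  exact_zero : Function.Exact (E.mulRight (B 0)) δ₀
  exact_succ : ∀ i, Function.Exact (E.mulRight (B (i + 1))) (E.mulRight (B i))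
  minimal : ∀ i, LinearMap.range (E.mulRight (B i)) ≤ Module.jacobson A (E.Proj (idx i))

namespace MinimalResolution

variable {n : ℕ} {E : BasicDecomposition A n} {M : Type u} [AddCommGroup M] [Module A M]
  (Q : MinimalResolution E M) (f : HochschildCocycle k A)

/-- The module `Q_i`. -/
abbrev X (i : ℕ) : Type u := E.Proj (Q.idx i)

/-- The differential `δ_{i+1} : Q_{i+1} → Q_i`. -/
def δ (i : ℕ) : Q.X (i + 1) →ₗ[A] Q.X i := E.mulRight (Q.B i)

/-- Condition `(∗)` for the resolution: `δ_0 α_1 δ_2 = 0`, where `[α_1(x)] = f̃([x] ⊗ B_1) E_0`. -/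
def Star : Prop := ∀ x : Q.X 2, Q.δ₀ (E.fRight f (Q.B 0) (Q.δ 1 x)) = 0

/-- The matrices `C_i` (here `C i` is `C_{i+1}`) of the construction of the resolution over `A_f`:
`E_i f̃(B_i ⊗ B_{i-1}) E_{i-2} = C_i B_{i-1} + B_i C_{i-1}` for `i ≥ 2`. -/
def IsCorrection (C : ∀ i, E.Corner (Q.idx (i + 1)) (Q.idx i)) : Prop :=
  ∀ i, E.diag (Q.idx (i + 2)) * ftilde f (Q.B (i + 1)).1 (Q.B i).1 * E.diag (Q.idx i) =
    (C (i + 1)).1 * (Q.B i).1 + (Q.B (i + 1)).1 * (C i).1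

variable (C : ∀ i, E.Corner (Q.idx (i + 1)) (Q.idx i))

/-- The map `α_{i+1} : Q_{i+1} → Q_i`,
`[α_{i+1}(x)] = (-1)^{i+2} (f̃([x] ⊗ B_{i+1}) E_i - [x] C_{i+1})`. -/
def α (i : ℕ) (x : Q.X (i + 1)) : Q.X i :=
  (-1 : ℤ) ^ (i + 2) • (E.fRight f (Q.B i) x - E.mulRight (C i) x)

/-- The `A_f`-module `⨁_{i=0}^m Q̂_i`. -/
abbrev HatX (m : ℕ) : Type u := ∀ i : Fin (m + 1), (E.hat f (Q.idx i)).Carrier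

/-- The map `δ̂_{m+1} = (u, v, u) : ⨁_{i=0}^{m+1} Q̂_i → ⨁_{i=0}^m Q̂_i`, where the `i`-th row of
`u` is `δ_{i+1}` and the `i`-th row of `v` is `(-1)^i (Id, α_{i+1})`. -/
def hatδ (m : ℕ) (x : Q.HatX f (m + 1)) : Q.HatX f m := fun i =>
  { m₀ := Q.δ i (x ⟨i + 1, by omega⟩).m₀
    m₁ := (-1 : ℤ) ^ (i : ℕ) • ((x ⟨i, by omega⟩).m₀ + Q.α f C i (x ⟨i + 1, by omega⟩).m₀) +
      Q.δ i (x ⟨i + 1, by omega⟩).m₁ }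

variable [Module k M] [IsScalarTower k A M]

/-- The augmentation `δ̂_0 = (0, δ_0, 0) : Q̂_0 → M`. -/
def hatδ₀ (x : Q.HatX f 0) : (embed f M).Carrier := ⟨0, Q.δ₀ (x ⟨0, by omega⟩).m₀⟩

/-- The morphism `(0, g, 0) : ⨁_{j=0}^{i+a} Q̂_j → N` which is `g : Q_i → N` on the summand
`Q̂_i` and zero on the other summands. -/
def hatHom {N : Type u} [AddCommGroup N] [Module A N] [Module k N] [IsScalarTower k A N]
    (i a : ℕ) (g : Q.X i →ₗ[A] N) :
    Q.HatX f (i + a) →ₗ[Deformation f] (embed f N).Carrier where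
  toFun x := ⟨0, g (x ⟨i, by omega⟩).m₀⟩
  map_add' x y := by
    ext
    simp
  map_smul' a x := by
    ext
    change g (a.c₀ • (x ⟨i, by omega⟩).m₀) = a.c₀ • g (x ⟨i, by omega⟩).m₀ + 0 + a.c₁ • 0
    rw [map_smul, smul_zero, add_zero, add_zero]

end MinimalResolution

/-- The semisimple module `S` as an object of the category of `A`-modules. -/
abbrev BasicDecomposition.S {n : ℕ} (E : BasicDecomposition A n) : ModuleCat.{u} A :=
  ModuleCat.of A E.SimpleSum

/-- The semisimple module `S = (0, S, 0, 0)` as an object of the category of `A_f`-modules. -/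
abbrev BasicDecomposition.Sf {n : ℕ} (E : BasicDecomposition A n) (f : HochschildCocycle k A) :
    ModuleCat.{u} (Deformation f) :=
  ModuleCat.of (Deformation f) (embed f E.SimpleSum).Carrier

end Deformation

/-! ### Resolutions computing `Ext` -/

/-- An identification of a complex `⋯ → X_1 → X_0 → M` of `R`-modules, given by maps `d` and `ε`,
with a projective resolution of `M`. -/
structure ResolutionModel (R : Type u) [Ring R] (M : Type u) [AddCommGroup M] [Module R M]
    (X : ℕ → Type u) [∀ i, AddCommGroup (X i)] [∀ i, Module R (X i)]
    (d : ∀ i, X (i + 1) → X i) (ε : X 0 → M) where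
  /-- the projective resolution -/
  res : ProjectiveResolution (ModuleCat.of R M)
  /-- the identification of its terms -/
  iso : ∀ i, res.complex.X i ≃ₗ[R] X i
  iso_d : ∀ i x, iso i ((res.complex.d (i + 1) i).hom x) = d i (iso (i + 1) x)
  iso_ε : ∀ x, (res.π.f 0).hom x = ε (iso 0 x)

namespace ResolutionModel

variable {R : Type u} [Ring R] {M : Type u} [AddCommGroup M] [Module R M]
    {X : ℕ → Type u} [∀ i, AddCommGroup (X i)] [∀ i, Module R (X i)]
    {d : ∀ i, X (i + 1) → X i} {ε : X 0 → M} (r : ResolutionModel R M X d ε)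
    {N : Type u} [AddCommGroup N] [Module R N]

/-- The class in `Ext^i(M, N)` of a cocycle `g : X_i → N`. -/
noncomputable def cls (i : ℕ) (g : X i →ₗ[R] N) (hg : ∀ x, g (d i x) = 0) :
    Ext (ModuleCat.of R M) (ModuleCat.of R N) i :=
  r.res.extMk (ModuleCat.ofHom (g ∘ₗ (r.iso i).toLinearMap)) (i + 1) rfl (by
    ext x
    simpa [r.iso_d] using hg (r.iso (i + 1) x))

end ResolutionModel

/-- The element `c ⊗ x^a` of the graded tensor product `Ext^*(X, X) ⊗ k[x]`, for
`c ∈ Ext^i(X, X)`. -/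
noncomputable def tensorX (k : Type u) [CommRing k] {C : Type v} [Category.{u} C] [Abelian C]
    [HasExt.{w} C] [Linear k C] {X : C} {i : ℕ} (c : Ext X X i) (a : ℕ) :
    GradedTensorProduct k (extGrading k X) (polyGrading k) :=
  GradedTensorProduct.tmul k (DirectSum.of (ExtPiece X) i c) (Polynomial.X ^ a)

/-- The component of total degree `n` of `Ext^*(X, X) ⊗ k[x]`. -/
noncomputable def tensorGrading (k : Type u) [CommRing k] {C : Type v} [Category.{u} C] [Abelian C]
    [HasExt.{w} C] [Linear k C] (X : C) (n : ℕ) :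
    Submodule k (GradedTensorProduct k (extGrading k X) (polyGrading k)) :=
  Submodule.span k {y | ∃ (i a : ℕ) (c : Ext X X i), i + a = n ∧ tensorX k c a = y}

end InfDef

open InfDef

/-! Write F for α without its sign. By the cocycle identity F fails to be A-linear in exactly the
way that makes (x, y) ↦ (δx, δy + Fx) an A_f-linear map Q̂_{i+1} → Q̂_i, and the choice of the C_i
says Fδ + δF = 0 (`F_δ`). The complex ⨁ Q̂_i glues these maps to the signed multiplications by t,
(x, y) ↦ (0, ±x), on each Q̂_i. Its exactness reduces to that of the minimal resolution, row by row
(`exists_preimage`); the Q̂_i are projective because the hat of A itself is free of rank one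
(`projective_hat_id`).

Since S has zero radical, every map to S kills the image of δ. Since t acts by zero on S, a map Q̂_j
→ S is the same as an A-map Q_j → S (`homComp_apply`). So all differentials of both Hom complexes
vanish, and Ext^p over A_f is ⨁_{j ≤ p} Hom_A(Q_j, S), that is, ⨁ Ext^j_A(S, S) x^(p-j)
(`hatEquiv`).

For the products, a lifting γ of g over A must be deformed to A_f-maps (x, y) ↦ (γx, γy + Ux)
compatible with F (`exists_deformedLifting`). A first guess for U applies f to the matrices of γ.
Its defect is A-linear and anticommutes with δ, so it can be removed by an inductive correction as
soon as δ₀ kills its lowest component. This is where Im α ⊂ rad enters, together with a choice of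
γ_0 as a matrix of scalar multiples of idempotents: applying f to such a matrix preserves radical
entries (`fRight_mem_jacobson`).

The same γ then computes products over A and over A_f, up to the signs (-1)^(s(i+j)) forced by the
signs of the multiplications by t. Hence [g] ↦ [g] is an algebra map. The variable x is the class of
δ₀ on Q̂_0 ⊕ Q̂_1; it lifts by forgetting the last summand, so right multiplication by x raises the
exponent of x, and x[g] = (-1)^s [g]x. The universal property of the graded tensor product gives the
algebra map, the description of Ext^p gives bijectivity, and the product formula is the Koszul rule.
-/

namespace InfDef

open CategoryTheory CategoryTheory.Abelian CochainComplex HomComplex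

/-! ### Composition of cocycles and of shifted morphisms. -/

section Composition

variable {C : Type v} [Category.{u} C] [Preadditive C]

/-- Passing from cocycles to morphisms into a shift inserts no sign, so both compositions have the
same components up to `eqToHom`. -/
lemma equivHomShift_symm_comp {K L M : CochainComplex C ℤ} {n m p : ℤ} (α : Cocycle K L n)
    (β : Cocycle L M m) (h : m + n = p) (γ : Cocycle K M p)
    (hγ : γ.1 = α.1.comp β.1 (by lia)) :
    ShiftedHom.comp (Cocycle.equivHomShift.symm α) (Cocycle.equivHomShift.symm β) h =
      Cocycle.equivHomShift.symm γ := by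
  apply Cocycle.equivHomShift.injective
  ext p₁ p₂ hp
  obtain ⟨f, rfl⟩ := Cocycle.equivHomShift.surjective α
  obtain ⟨g, rfl⟩ := Cocycle.equivHomShift.surjective β
  rw [AddEquiv.apply_symm_apply, AddEquiv.symm_apply_apply, AddEquiv.symm_apply_apply, hγ,
    Cochain.comp_v _ _ _ p₁ (p₁ + n) p₂ rfl (by lia)]
  simp [ShiftedHom.comp, Cocycle.equivHomShift_apply, Cochain.rightUnshift_v _ _ _ _ _ _ _ (add_zero _),
    CochainComplex.shiftFunctorAdd'_inv_app_f', HomologicalComplex.XIsoOfEq]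
  have hf : f.f p₁ ≫ 𝟙 (L.X (p₁ + n)) = f.f p₁ := Category.comp_id _
  refine Eq.trans ?_ (congrArg (· ≫ g.f (p₁ + n) ≫ eqToHom _) hf.symm)
  exact (Category.assoc _ _ _).trans (congrArg (f.f p₁ ≫ ·)
    ((Category.assoc _ _ _).trans (congrArg (g.f (p₁ + n) ≫ ·) (eqToHom_trans _ _))))

end Composition

/-- When two classes computed from resolutions are composed, the augmentation `r` of the middle
resolution meets its formal inverse `b` (up to the identification `i`); the pair cancels and leaves
the composite of the two cocycles. -/
lemma shiftedHom_comp_comp_of_eq_id {D : Type*} [Category* D] [HasShift D ℤ]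
    {X Y Z K L W M : D} {n m p : ℤ} (hp : m + n = p) (a : X ⟶ K) (g : ShiftedHom K L n)
    (r : L ⟶ W) (i : W ⟶ Y) (b : Y ⟶ L) (h : ShiftedHom L M m) (z : M ⟶ Z)
    (hb : r ≫ i ≫ b = 𝟙 L) {c₀ c₁ c₂ c₃ c₄ c₅ : ℤ} (h₀ : c₀ = 0) (h₁ : c₁ = 0) (h₂ : c₂ = 0)
    (h₃ : c₃ = 0) (h₄ : c₄ = 0) (h₅ : c₅ = 0) :
    (((ShiftedHom.mk₀ c₀ h₀ a).comp ((g.comp (.mk₀ c₁ h₁ r) (by rw [h₁, zero_add])).comp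
      (.mk₀ c₂ h₂ i) (by rw [h₂, zero_add])) (by rw [h₀, add_zero])).comp
      ((ShiftedHom.mk₀ c₃ h₃ b).comp (h.comp (.mk₀ c₄ h₄ z) (by rw [h₄, zero_add]))
        (by rw [h₃, add_zero])) hp : ShiftedHom X Z p) =
    (ShiftedHom.mk₀ c₀ h₀ a).comp ((g.comp h hp).comp (.mk₀ c₅ h₅ z) (by rw [h₅, zero_add]))
      (by rw [h₀, add_zero]) := by
  have hb' : r⟦n⟧' ≫ i⟦n⟧' ≫ b⟦n⟧' = 𝟙 (L⟦n⟧) := by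
    rw [← Functor.map_comp, ← Functor.map_comp, hb, CategoryTheory.Functor.map_id]
  simp only [ShiftedHom.mk₀_comp, ShiftedHom.comp_mk₀]
  simp only [ShiftedHom.comp, Functor.map_comp, Category.assoc, reassoc_of% hb']
  rw [← NatTrans.naturality]
  rfl

/-! ### Yoneda products computed by liftings. -/

section Lifting

variable {C : Type v} [Category.{u} C] [Abelian C] {X Y : C}
  (R : ProjectiveResolution X) (R' : ProjectiveResolution Y) (n : ℕ)

/-- The cochain of degree `n` with components `(-1) ^ (n j) γ_j`. -/
noncomputable def liftingCochain (γ : ∀ j, R.complex.X (n + j) ⟶ R'.complex.X j) :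
    Cochain R.cochainComplex R'.cochainComplex n :=
  -- The term R'_j sits in cohomological degree -j, so `(-q).toNat` recovers j, and in positive
  -- degrees the target vanishes.
  Cochain.mk fun p q hpq => if hq : q ≤ 0 then
    (R.cochainComplexXIso p (n + (-q).toNat) (by lia)).hom ≫
      ((-1 : ℤ) ^ (n * (-q).toNat) • γ (-q).toNat) ≫
      (R'.cochainComplexXIso q (-q).toNat (by lia)).inv else 0

variable {R R' n}

lemma liftingCochain_v (γ : ∀ j, R.complex.X (n + j) ⟶ R'.complex.X j) (p q : ℤ) (j : ℕ)
    (hpq : p + n = q) (hq : -(j : ℤ) = q) :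
    (liftingCochain R R' n γ).v p q hpq = (R.cochainComplexXIso p (n + j) (by lia)).hom ≫
      ((-1 : ℤ) ^ (n * j) • γ j) ≫ (R'.cochainComplexXIso q j hq).inv := by
  obtain rfl : j = (-q).toNat := by lia
  simp only [liftingCochain, Cochain.mk_v]
  rw [dif_pos (by lia)]

/-- The coboundary in degree n puts (-1)^(n+1) on one of its two terms. The ratio (-1)^n of
consecutive signs in the cochain compensates for it, because γ commutes with the differentials
without signs. -/
lemma δ_liftingCochain (γ : ∀ j, R.complex.X (n + j) ⟶ R'.complex.X j)
    (hγ : ∀ j, γ (j + 1) ≫ R'.complex.d (j + 1) j = R.complex.d (n + (j + 1)) (n + j) ≫ γ j) :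
    δ n (n + 1) (liftingCochain R R' n γ) = 0 := by
  ext p q hpq
  by_cases hq : q ≤ 0
  · obtain ⟨j, rfl⟩ := Int.exists_eq_neg_ofNat hq
    rw [δ_v _ _ rfl _ _ _ hpq (-(j : ℤ) - 1) (p + 1) rfl rfl]
    rw [liftingCochain_v γ p (-(j : ℤ) - 1) (j + 1) (by lia) (by push_cast; ring),
      liftingCochain_v γ (p + 1) (-(j : ℤ)) j (by lia) rfl,
      R'.cochainComplex_d _ _ (j + 1) j (by push_cast; ring) rfl,
      R.cochainComplex_d _ _ (n + (j + 1)) (n + j) (by push_cast; lia) (by lia)]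
    simp only [Category.assoc, Iso.inv_hom_id_assoc, Linear.smul_comp, Linear.comp_smul,
      reassoc_of% (hγ j)]
    rw [Int.negOnePow_succ, mul_add, mul_one, pow_add, Units.smul_def, Cochain.zero_v, smul_smul,
      ← add_smul, Units.val_neg, Int.coe_negOnePow_natCast]
    ring_nf
    rw [zero_smul]
  · exact (CochainComplex.isZero_of_isStrictlyLE _ 0 _ (by lia)).eq_of_tgt _ _

variable (R) in
/-- The cocycle of degree `n` with values in the single complex attached to `g : R_n ⟶ Y`. -/
noncomputable def singleCocycle (g : R.complex.X n ⟶ Y) (hg : R.complex.d (n + 1) n ≫ g = 0) :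
    Cocycle R.cochainComplex ((singleFunctor C 0).obj Y) n :=
  Cocycle.toSingleMk ((R.cochainComplexXIso (-n) n rfl).hom ≫ g) (by simp) (-((n + 1 : ℕ) : ℤ))
    (by lia) (by simp only [R.cochainComplex_d _ _ (n + 1) n rfl rfl, Category.assoc,
      Iso.inv_hom_id_assoc, hg, Limits.comp_zero])

lemma singleCocycle_v (g : R.complex.X n ⟶ Y) (hg : R.complex.d (n + 1) n ≫ g = 0) :
    (singleCocycle R g hg).1.v (-n) 0 (by simp) = (R.cochainComplexXIso (-n) n rfl).hom ≫ g ≫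
      (HomologicalComplex.singleObjXSelf (.up ℤ) 0 Y).inv := by
  exact (Cochain.toSingleMk_v _ _).trans (Category.assoc _ _ _)

lemma cochain_to_single_ext {K : CochainComplex C ℤ} {a : ℤ}
    {z z' : Cochain K ((singleFunctor C 0).obj Y) a}
    (h : z.v (-a) 0 (by simp) = z'.v (-a) 0 (by simp)) : z = z' := by
  apply (Cochain.toSingleEquiv (neg_add_cancel a)).injective
  simp [Cochain.toSingleEquiv, h]

variable [HasExt.{w} C] {Z : C} {m p : ℕ}

/-- The Yoneda product of the classes of `g` and `h` is the class of `h γ_m`, for a lifting `γ`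
of `g` that commutes with the differentials without signs. -/
theorem extMk_yoneda (g : R.complex.X n ⟶ Y) (hg : R.complex.d (n + 1) n ≫ g = 0)
    (h : R'.complex.X m ⟶ Z) (hh : R'.complex.d (m + 1) m ≫ h = 0)
    (γ : ∀ j, R.complex.X (n + j) ⟶ R'.complex.X j)
    (hγ : ∀ j, γ (j + 1) ≫ R'.complex.d (j + 1) j = R.complex.d (n + (j + 1)) (n + j) ≫ γ j)
    (hγ₀ : γ 0 ≫ R'.π.f 0 = g) (hc : R.complex.d (n + m + 1) (n + m) ≫ γ m ≫ h = 0) :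
    yoneda (R'.extMk h (m + 1) rfl hh) (R.extMk g (n + 1) rfl hg) (add_comm m n) =
      R.extMk (γ m ≫ h) (n + m + 1) rfl hc := by
  have := HasDerivedCategory.standard C
  let γ' : Cocycle R.cochainComplex R'.cochainComplex n :=
    Cocycle.mk (liftingCochain R R' n γ) _ rfl (δ_liftingCochain γ hγ)
  -- Only the component j = 0 matters here, and its sign is 1.
  have h₁ : γ'.postcomp R'.π' = singleCocycle R g hg := by
    ext : 1
    apply cochain_to_single_ext
    rw [singleCocycle_v]
    simp only [γ', Cocycle.postcomp, Cocycle.mk_coe, Cochain.comp_zero_cochain_v, Cochain.ofHom_v,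
      liftingCochain_v γ (-n) 0 0 (by simp) rfl, ← hγ₀, ProjectiveResolution.π'_f_zero, mul_zero,
      pow_zero, one_smul]
    refine (Category.assoc _ _ _).trans (congrArg (_ ≫ ·) ?_)
    refine (Category.assoc _ _ _).trans ((congrArg (_ ≫ ·) ?_).trans (Category.assoc _ _ _).symm)
    exact Iso.inv_hom_id_assoc _ _
  -- The component j = m carries (-1)^(nm), exactly the sign separating `yoneda` from `Ext.comp`.
  have h₂ : ((-1 : ℤ) ^ (m * n) • singleCocycle R (γ m ≫ h) hc).1 =
      γ'.1.comp (singleCocycle R' h hh).1 (by lia) := by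
    apply cochain_to_single_ext
    rw [Cochain.comp_v _ _ _ _ (-m) _ (by lia) (by lia)]
    refine (congrArg ((-1 : ℤ) ^ (m * n) • ·) (singleCocycle_v _ hc)).trans ?_
    refine Eq.trans ?_ (congrArg₂ (· ≫ ·)
      (liftingCochain_v γ (-((n + m : ℕ) : ℤ)) (-m) m (by lia) rfl) (singleCocycle_v h hh)).symm
    have key {a b c d e : C} (x : a ⟶ b) (y : b ⟶ c) (i : e ≅ c) (z : c ⟶ d) {t : C} (w : d ⟶ t)
        (r : ℤ) : r • x ≫ (y ≫ z) ≫ w = (x ≫ (r • y) ≫ i.inv) ≫ i.hom ≫ z ≫ w := by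
      simp [Linear.smul_comp, Linear.comp_smul]
    rw [mul_comm n m]
    exact key _ _ _ _ _ _
  have h₃ : (R.extMk g (n + 1) rfl hg).comp (R'.extMk h (m + 1) rfl hh) rfl =
      R.extEquivCohomologyClass.symm (.mk ((-1 : ℤ) ^ (m * n) • singleCocycle R (γ m ≫ h) hc)) := by
    ext
    have e₁ : (R.extMk g (n + 1) rfl hg).hom = _ :=
      R.extEquivCohomologyClass_symm_mk_hom (singleCocycle R g hg)
    have e₂ : (R'.extMk h (m + 1) rfl hh).hom = _ :=
      R'.extEquivCohomologyClass_symm_mk_hom (singleCocycle R' h hh)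
    have e₃ := equivHomShift_symm_comp γ' (singleCocycle R' h hh) (by lia) _ h₂
    have e₄ : Cocycle.equivHomShift.symm (singleCocycle R g hg) =
        ShiftedHom.comp (Cocycle.equivHomShift.symm γ') (.mk₀ 0 rfl R'.π') (by lia) := by
      rw [← h₁, Cocycle.equivHomShift_symm_postcomp, ← ShiftedHom.comp_mk₀ _ 0 rfl]
    rw [e₄, ShiftedHom.map_comp, ShiftedHom.map_mk₀] at e₁
    rw [Ext.comp_hom, e₁, e₂]
    rw [ProjectiveResolution.extEquivCohomologyClass_symm_mk_hom, ← e₃, ShiftedHom.map_comp]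
    refine shiftedHom_comp_comp_of_eq_id _ _ _ _ _ _ _ _ ?_ _ _ _ _ _ _
    rw [Iso.inv_hom_id_app_assoc]
    exact IsIso.hom_inv_id _
  rw [yoneda, h₃]
  obtain hs | hs := neg_one_pow_eq_or ℤ (m * n) <;> rw [hs]
  · simp only [one_smul]
    rfl
  · simp only [neg_smul, one_smul, CohomologyClass.mk_neg,
      ProjectiveResolution.extEquivCohomologyClass_symm_neg, neg_neg]
    rfl

lemma smul_extMk {k : Type*} [CommRing k] [Linear k C] (r : k) (g : R.complex.X n ⟶ Y)
    (hg : R.complex.d (n + 1) n ≫ g = 0) :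
    r • R.extMk g (n + 1) rfl hg = R.extMk (r • g) (n + 1) rfl (by rw [Linear.comp_smul, hg,
      smul_zero]) := by
  rw [Ext.smul_eq_comp_mk₀, ProjectiveResolution.extMk_comp_mk₀]
  congr 1
  rw [Linear.comp_smul, Category.comp_id]

/-- Let f represent the identity class. The augmentation lifts to the identity of the resolution, so
1 ∘ [π] = [f] = 1. -/
lemma extMk_π (R : ProjectiveResolution X) (h : R.complex.d (0 + 1) 0 ≫ R.π.f 0 = 0) :
    R.extMk (Y := X) (R.π.f 0) 1 rfl h = Ext.mk₀ (𝟙 X) := by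
  obtain ⟨f, hf, hf'⟩ := R.extMk_surjective (Ext.mk₀ (𝟙 X)) 1 rfl
  have := extMk_yoneda (R := R) (R' := R) (R.π.f 0) h f hf
    (fun j => (R.complex.XIsoOfEq (zero_add j)).hom) (by simp) (by exact Category.id_comp _)
    (by simpa [HomologicalComplex.XIsoOfEq] using hf)
  rw [hf', one_yoneda] at this
  rw [this, ← hf']
  congr 1
  simp [HomologicalComplex.XIsoOfEq]

/-- There are no coboundaries in degree zero: g factors as π followed by some l, and its class is
`Ext.mk₀ l`. -/
lemma eq_zero_of_extMk_eq_zero (g : R.complex.X 0 ⟶ Y) (hg : R.complex.d 1 0 ≫ g = 0)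
    (h : R.extMk g 1 rfl hg = 0) : g = 0 := by
  obtain ⟨l, hl⟩ : ∃ l : X ⟶ Y, R.π.f 0 ≫ l = g :=
    ⟨_, (Limits.CokernelCofork.IsColimit.desc' R.isColimitCokernelCofork _ hg).2⟩
  subst hl
  have h₁ := ProjectiveResolution.extMk_comp_mk₀ R (Y := X) (R.π.f 0) 1 rfl
    R.complex_d_comp_π_f_zero l
  have h₂ := extMk_π R R.complex_d_comp_π_f_zero
  have h₃ : Ext.mk₀ l = 0 := by
    rw [← Ext.mk₀_id_comp (Ext.mk₀ l), ← h₂]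
    exact h₁.trans h
  rw [(Ext.mk₀_eq_zero_iff l).1 h₃]
  exact Limits.comp_zero

end Lifting

/-! ### Classes of cocycles on explicit complexes of modules. -/

namespace ResolutionModel

variable {k : Type u} [Field k] {R : Type u} [Ring R] [Algebra k R]
    {M M' N : Type u} [AddCommGroup M] [Module R M] [AddCommGroup M'] [Module R M']
    [AddCommGroup N] [Module R N] [Module k N] [IsScalarTower k R N]
    {X X' : ℕ → Type u} [∀ i, AddCommGroup (X i)] [∀ i, Module R (X i)]
    [∀ i, AddCommGroup (X' i)] [∀ i, Module R (X' i)]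
    {d : ∀ i, X (i + 1) → X i} {ε : X 0 → M} (r : ResolutionModel R M X d ε)
    {d' : ∀ i, X' (i + 1) → X' i} {ε' : X' 0 → M'} (r' : ResolutionModel R M' X' d' ε')

lemma cls_add {i : ℕ} (g h : X i →ₗ[R] N) (hg : ∀ x, g (d i x) = 0) (hh : ∀ x, h (d i x) = 0)
    (hgh : ∀ x, (g + h) (d i x) = 0) :
    r.cls i (g + h) hgh = r.cls i g hg + r.cls i h hh := by
  rw [cls, cls, cls, ProjectiveResolution.add_extMk]
  rfl

lemma cls_smul {i : ℕ} (c : k) (g : X i →ₗ[R] N) (hg : ∀ x, g (d i x) = 0)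
    (hcg : ∀ x, (c • g) (d i x) = 0) :
    r.cls i (c • g) hcg = c • r.cls i g hg := by
  rw [cls, cls, smul_extMk]
  congr 1
  ext x
  exact algebra_compatible_smul R c _

lemma cls_surjective {i : ℕ} (c : Ext (ModuleCat.of R M) (ModuleCat.of R N) i) :
    ∃ (g : X i →ₗ[R] N) (hg : ∀ x, g (d i x) = 0), r.cls i g hg = c := by
  obtain ⟨f, hf, hf'⟩ := r.res.extMk_surjective c (i + 1) rfl
  refine ⟨f.hom ∘ₗ (r.iso i).symm.toLinearMap, fun x => ?_, ?_⟩
  · obtain ⟨y, rfl⟩ := (r.iso (i + 1)).surjective x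
    have := congrArg (fun t => t.hom y) hf
    simpa [← r.iso_d] using this
  · rw [← hf', cls]
    congr 1
    ext x
    simp

/-- Under `hN` the differentials of Hom(X, N) vanish, so a coboundary is zero. Degree zero is
separate, as nothing precedes it. -/
lemma cls_eq_zero {i : ℕ} (g : X i →ₗ[R] N) (hg : ∀ x, g (d i x) = 0)
    (hN : ∀ (j : ℕ) (h : X j →ₗ[R] N) x, h (d j x) = 0) (h0 : r.cls i g hg = 0) : g = 0 := by
  have hd : r.res.complex.d (i + 1) i ≫ ModuleCat.ofHom (g ∘ₗ (r.iso i).toLinearMap) = 0 := by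
    ext x
    simpa [r.iso_d] using hg (r.iso (i + 1) x)
  suffices h : ModuleCat.ofHom (g ∘ₗ (r.iso i).toLinearMap) = 0 by
    ext x
    obtain ⟨y, rfl⟩ := (r.iso i).surjective x
    exact congrArg (fun t => t.hom y) h
  change r.res.extMk _ (i + 1) rfl hd = 0 at h0
  cases i with
  | zero =>
    exact eq_zero_of_extMk_eq_zero _ hd h0
  | succ i =>
    obtain ⟨l, hl⟩ := (r.res.extMk_eq_zero_iff _ _ _ hd i rfl).1 h0
    rw [← hl]
    ext x
    have := hN i (l.hom ∘ₗ (r.iso i).symm.toLinearMap) (r.iso (i + 1) x)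
    simpa [← r.iso_d] using this

lemma cls_ε (ε : X 0 →ₗ[R] M) (r : ResolutionModel R M X d ε) (h : ∀ x, ε (d 0 x) = 0) :
    r.cls 0 ε h = Ext.mk₀ (𝟙 _) := by
  rw [← extMk_π r.res r.res.complex_d_comp_π_f_zero, cls]
  congr 1
  ext x
  exact (r.iso_ε x).symm

theorem cls_yoneda {n m : ℕ} (g : X n →ₗ[R] M') (hg : ∀ x, g (d n x) = 0) (h : X' m →ₗ[R] N)
    (hh : ∀ x, h (d' m x) = 0) (γ : ∀ j, X (n + j) →ₗ[R] X' j)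
    (hγ : ∀ j x, d' j (γ (j + 1) x) = γ j (d (n + j) x)) (hγ₀ : ∀ x, ε' (γ 0 x) = g x)
    (hc : ∀ x, (h ∘ₗ γ m) (d (n + m) x) = 0) :
    yoneda (r'.cls m h hh) (r.cls n g hg) (add_comm m n) = r.cls (n + m) (h ∘ₗ γ m) hc := by
  have := extMk_yoneda (R := r.res) (R' := r'.res) (ModuleCat.ofHom (g ∘ₗ (r.iso n).toLinearMap))
    (by ext x; simpa [r.iso_d] using hg (r.iso (n + 1) x))
    (ModuleCat.ofHom (h ∘ₗ (r'.iso m).toLinearMap))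
    (by ext x; simpa [r'.iso_d] using hh (r'.iso (m + 1) x))
    (fun j => ModuleCat.ofHom ((r'.iso j).symm.toLinearMap ∘ₗ γ j ∘ₗ (r.iso (n + j)).toLinearMap))
    (fun j => by
      ext x
      apply (r'.iso j).injective
      have h₁ := r.iso_d (n + j) x
      simp only [ModuleCat.hom_comp, ModuleCat.hom_ofHom, LinearMap.comp_apply,
        LinearEquiv.coe_coe, LinearEquiv.apply_symm_apply, r'.iso_d, hγ]
      exact congrArg (γ j) h₁.symm)
    (by
      ext x
      have h₁ := r'.iso_ε ((r'.iso 0).symm (γ 0 (r.iso n x)))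
      rw [LinearEquiv.apply_symm_apply, hγ₀] at h₁
      exact h₁)
    (by ext x; simpa [r.iso_d] using hc (r.iso (n + m + 1) x))
  rw [cls, cls, this, cls]
  congr 1
  ext x
  simp

variable (d : ∀ i, X (i + 1) →ₗ[R] X i) (ε : X 0 →ₗ[R] M) (h₀ : Function.Exact (d 0) ε)
  (hs : ∀ i, Function.Exact (d (i + 1)) (d i))

/-- The chain complex attached to an exact sequence of modules. -/
noncomputable def complexOfExact : ChainComplex (ModuleCat.{u} R) ℕ :=
  ChainComplex.of (fun i => ModuleCat.of R (X i)) (fun i => ModuleCat.ofHom (d i)) fun i => by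
    ext x
    exact (hs i).apply_apply_eq_zero x

lemma complexOfExact_d (i : ℕ) :
    (complexOfExact d hs).d (i + 1) i = ModuleCat.ofHom (d i) :=
  ChainComplex.of_d (fun i => ModuleCat.of R (X i)) (fun i => ModuleCat.ofHom (d i)) i

/-- The augmentation of `complexOfExact`. -/
noncomputable def augmentationOfExact :
    complexOfExact d hs ⟶ (ChainComplex.single₀ (ModuleCat.{u} R)).obj (ModuleCat.of R M) :=
  (ChainComplex.toSingle₀Equiv _ _).symm ⟨ModuleCat.ofHom ε, by
    rw [complexOfExact_d]
    ext x
    exact h₀.apply_apply_eq_zero x⟩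

lemma augmentationOfExact_f : (augmentationOfExact d ε h₀ hs).f 0 = ModuleCat.ofHom ε :=
  rfl

/-- In degree zero this is exactness at X_0 together with surjectivity of ε; in positive degrees it
is exactness of the complex, the target being zero there. -/
lemma quasiIso_augmentationOfExact (hε : Function.Surjective ε) :
    QuasiIso (augmentationOfExact d ε h₀ hs) := ⟨fun n => by
  cases n with
  | zero =>
    rw [ChainComplex.quasiIsoAt₀_iff, ShortComplex.quasiIso_iff_of_zeros']
    · refine (ShortComplex.exact_and_epi_g_iff_of_iso (S₂ := ShortComplex.mk
        (ModuleCat.ofHom (d 0)) (ModuleCat.ofHom ε) (by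
          ext x
          exact h₀.apply_apply_eq_zero x)) ?_).2
          ⟨(ShortComplex.ShortExact.moduleCat_exact_iff_function_exact _).2 h₀,
            (ModuleCat.epi_iff_surjective _).2 hε⟩
      refine ShortComplex.isoMk (Iso.refl _) (Iso.refl _) (Iso.refl _) ?_ ?_
      · exact (Category.id_comp _).trans
          ((complexOfExact_d d hs 0).symm.trans (Category.comp_id _).symm)
      · exact (Category.id_comp _).trans ((augmentationOfExact_f d ε h₀ hs).symm.trans (Category.comp_id _).symm)
    all_goals rfl
  | succ n =>
    rw [quasiIsoAt_iff_exactAt']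
    · rw [HomologicalComplex.exactAt_iff' _ (n + 1 + 1) (n + 1) n (by simp) (by simp)]
      refine (ShortComplex.ShortExact.moduleCat_exact_iff_function_exact _).2 ?_
      change Function.Exact ((complexOfExact d hs).d (n + 2) (n + 1)).hom
        ((complexOfExact d hs).d (n + 1) n).hom
      rw [complexOfExact_d, complexOfExact_d]
      exact hs n
    · apply ChainComplex.exactAt_succ_single_obj⟩

/-- An exact sequence of projective modules is a projective resolution. -/
noncomputable def ofExact [∀ i, Module.Projective R (X i)] (hε : Function.Surjective ε) :
    ResolutionModel R M X (fun i => d i) ε where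
  res :=
    { complex := complexOfExact d hs
      projective := fun n => inferInstanceAs (Projective (ModuleCat.of R (X n)))
      π := augmentationOfExact d ε h₀ hs
      quasiIso := quasiIso_augmentationOfExact d ε h₀ hs hε }
  iso i := LinearEquiv.refl R (X i)
  iso_d i x := by
    simp only [complexOfExact_d]
    rfl
  iso_ε x := by
    change ((augmentationOfExact d ε h₀ hs).f 0).hom x = ε x
    rw [augmentationOfExact_f]
    rfl

end ResolutionModel

end InfDef

/-! ### Nilpotents in corner rings and the radical. -/

namespace InfDef

section Jacobson

variable {k : Type u} {A : Type u} [Field k] [Ring A] [Algebra k A]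

/-- Split off a root c from the minimal polynomial as (X - c)^m q with coprime factors. A Bézout
relation makes v(b)q(b) idempotent, and the value 1 forces (b - c)^m = 0. -/
lemma exists_isNilpotent_sub_algebraMap [IsAlgClosed k] {R : Type*} [Ring R] [Algebra k R] [FiniteDimensional k R]
    [Nontrivial R] (h : ∀ p : R, IsIdempotentElem p → p = 0 ∨ p = 1) (b : R) :
    ∃ c : k, IsNilpotent (b - algebraMap k R c) := by
  have hb : IsIntegral k b := Algebra.IsIntegral.isIntegral b
  obtain ⟨c, hc⟩ := IsAlgClosed.exists_root (minpoly k b) (minpoly.degree_pos hb).ne'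
  obtain ⟨q, hq, hqc⟩ := Polynomial.exists_eq_pow_rootMultiplicity_mul_and_not_dvd (minpoly k b)
    (minpoly.ne_zero hb) c
  set m := (minpoly k b).rootMultiplicity c
  have hm : 0 < m := (Polynomial.rootMultiplicity_pos (minpoly.ne_zero hb)).2 hc
  have hcop : IsCoprime ((Polynomial.X - Polynomial.C c) ^ m) q :=
    IsCoprime.pow_left (((Polynomial.irreducible_X_sub_C c).coprime_iff_not_dvd).2 hqc)
  obtain ⟨u, v, huv⟩ := hcop
  set N := Polynomial.aeval b ((Polynomial.X - Polynomial.C c) ^ m) with hN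
  have h0 : N * Polynomial.aeval b q = 0 := by
    rw [hN, ← map_mul, ← hq, minpoly.aeval]
  have h0' : Polynomial.aeval b q * N = 0 := by
    rw [hN, ← map_mul, mul_comm q, ← hq, minpoly.aeval]
  have h1 := congrArg (Polynomial.aeval b) huv
  rw [map_add, map_mul, map_mul, map_one, ← hN] at h1
  have hNe : N = (b - algebraMap k R c) ^ m := by simp [hN]
  have hidem : IsIdempotentElem (Polynomial.aeval b v * Polynomial.aeval b q) := by
    have : Polynomial.aeval b v * Polynomial.aeval b q * (Polynomial.aeval b u * N) = 0 := by
      rw [hN, ← map_mul, ← map_mul, ← map_mul, show v * q * (u * (Polynomial.X - Polynomial.C c) ^ m)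
        = v * u * ((Polynomial.X - Polynomial.C c) ^ m * q) by ring, ← hq, map_mul, minpoly.aeval,
        mul_zero]
    rw [IsIdempotentElem]
    conv_rhs => rw [← mul_one (Polynomial.aeval b v * Polynomial.aeval b q), ← h1, mul_add, this,
      zero_add]
  refine ⟨c, ?_⟩
  rcases h _ hidem with h2 | h2
  -- If the idempotent is 0, then (b - c)^m has a left inverse and q(b) = 0, although q has smaller
  -- degree than the minimal polynomial.
  · exfalso
    rw [h2, add_zero] at h1
    have hq0 : Polynomial.aeval b q = 0 := by
      rw [← one_mul (Polynomial.aeval b q), ← h1, mul_assoc, h0, mul_zero]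
    have hqn : q ≠ 0 := by rintro rfl; simp at hqc
    have hle := Polynomial.natDegree_le_of_dvd (minpoly.dvd k b hq0) hqn
    have hdeg := congrArg Polynomial.natDegree hq
    rw [Polynomial.natDegree_mul (pow_ne_zero _ (Polynomial.X_sub_C_ne_zero c)) hqn,
      Polynomial.natDegree_pow, Polynomial.natDegree_X_sub_C] at hdeg
    omega
  · refine ⟨m, ?_⟩
    rw [← hNe, ← mul_one N, ← h2, ← mul_assoc, hN, ← map_mul, ← map_mul,
      show (Polynomial.X - Polynomial.C c) ^ m * v * q = v * ((Polynomial.X - Polynomial.C c) ^ m * q)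
        by ring, ← hq, map_mul, minpoly.aeval, mul_zero]

/-- The corner ring `e A e` as a `k`-algebra. -/
noncomputable instance cornerAlgebra {e : A} (he : IsIdempotentElem e) : Algebra k he.Corner :=
  RingHom.toAlgebra'
    { toFun := fun c => ⟨c • e, c • e, by simp [he.eq]⟩
      map_one' := Subtype.ext (one_smul k e)
      map_mul' := fun c d => Subtype.ext (by
        change (c * d) • e = c • e * d • e
        rw [smul_mul_smul_comm, he.eq])
      map_zero' := Subtype.ext (zero_smul k e)
      map_add' := fun c d => Subtype.ext (add_smul c d e) }
    fun c x => Subtype.ext (by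
      obtain ⟨h₁, h₂⟩ := (Subsemigroup.mem_corner_iff he).1 x.2
      change c • e * x.1 = x.1 * c • e
      rw [smul_mul_assoc, mul_smul_comm, h₁, h₂])

lemma coe_algebraMap_corner {e : A} (he : IsIdempotentElem e) (c : k) :
    ((algebraMap k he.Corner c).1 : A) = c • e := rfl

lemma coe_mul_corner {e : A} (he : IsIdempotentElem e) (x y : he.Corner) :
    (x * y).1 = x.1 * y.1 := rfl

lemma coe_one_corner {e : A} (he : IsIdempotentElem e) : (1 : he.Corner).1 = e := rfl

instance [FiniteDimensional k A] {e : A} (he : IsIdempotentElem e) : FiniteDimensional k he.Corner := by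
  let φ : he.Corner →ₗ[k] A :=
    { toFun := fun x => x.1
      map_add' := fun _ _ => rfl
      map_smul' := fun c x => by
        obtain ⟨h₁, h₂⟩ := (Subsemigroup.mem_corner_iff he).1 x.2
        rw [Algebra.smul_def, coe_mul_corner, coe_algebraMap_corner, smul_mul_assoc, h₁]
        rfl }
  exact Module.Finite.of_injective φ Subtype.val_injective

lemma mem_jacobson_of_isNilpotent_mul {a : A} (h : ∀ x, IsNilpotent (x * a)) :
    a ∈ Ring.jacobson A := by
  rw [← Ideal.jacobson_bot, Ideal.mem_jacobson_iff]
  intro y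
  obtain ⟨z, hz⟩ := (h y).isUnit_one_add.exists_left_inv
  refine ⟨z, ?_⟩
  rw [Ideal.mem_bot, ← hz]
  noncomm_ring

/-- Nilpotency of xa reduces to that of axe: (xa)^(t+1) = x(ax)^t a, and ea = a allows an e after
each factor ax. -/
lemma mem_jacobson_of_isNilpotent_corner {e a : A} (ha : e * a = a)
    (h : ∀ x, IsNilpotent (a * x * e)) : a ∈ Ring.jacobson A := by
  refine mem_jacobson_of_isNilpotent_mul fun x => ?_
  obtain ⟨t, ht⟩ := h x
  have h₁ : ∀ t, (a * x * e) ^ t * a = (a * x) ^ t * a := by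
    intro t
    induction t with
    | zero => simp
    | succ t ih =>
      calc (a * x * e) ^ (t + 1) * a = (a * x * e) ^ t * a * (x * (e * a)) := by
            rw [pow_succ]; simp only [mul_assoc]
        _ = _ := by rw [ih, ha, pow_succ]; simp only [mul_assoc]
  have h₂ : ∀ t, (x * a) ^ (t + 1) = x * ((a * x) ^ t * a) := by
    intro t
    induction t with
    | zero => simp
    | succ t ih => rw [pow_succ, ih, pow_succ]; simp only [mul_assoc]
  exact ⟨t + 1, by rw [h₂, ← h₁, ht, zero_mul, mul_zero]⟩

end Jacobson

/-! ### Local corner rings of a basic algebra. -/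

namespace BasicDecomposition

variable {k : Type u} {A : Type u} [Field k] [Ring A] [Algebra k A]
  {n : ℕ} (E : BasicDecomposition A n)

lemma e_mul_e (i : Fin n) : E.e i * E.e i = E.e i := (E.complete.idem i).eq

/-- The ring `e_i A e_i`. -/
abbrev EndRing (i : Fin n) : Type u := (E.complete.idem i).Corner

instance (i : Fin n) : Nontrivial (E.EndRing i) :=
  ⟨1, 0, fun h => E.ne_zero i (congrArg Subtype.val h)⟩

lemma endRing_idempotent (i : Fin n) (p : E.EndRing i) (hp : IsIdempotentElem p) :
    p = 0 ∨ p = 1 := by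
  rcases E.primitive i p.1 (1 - p).1 (congrArg Subtype.val hp.eq)
    (congrArg Subtype.val hp.one_sub.eq)
    (congrArg Subtype.val (show p * (1 - p) = 0 by rw [mul_sub, hp.eq, mul_one, sub_self]))
    (congrArg Subtype.val (show (1 - p) * p = 0 by rw [sub_mul, hp.eq, one_mul, sub_self]))
    (congrArg Subtype.val (show p + (1 - p) = 1 by abel)) with h | h
  · exact Or.inl (Subtype.ext h)
  · have h' : 1 - p = 0 := Subtype.ext h
    exact Or.inr (sub_eq_zero.1 h').symm

variable (k)

/-- An element is a scalar plus a nilpotent, hence a unit unless the scalar is zero. -/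
lemma endRing_isNilpotent_or_isUnit [IsAlgClosed k] [FiniteDimensional k A] (i : Fin n)
    (b : E.EndRing i) : IsNilpotent b ∨ IsUnit b := by
  obtain ⟨c, hc⟩ := exists_isNilpotent_sub_algebraMap (k := k) (E.endRing_idempotent i) b
  by_cases h : c = 0
  · left
    simpa only [h, map_zero, sub_zero] using hc
  · right
    have := hc.isUnit_add_left_of_commute ((isUnit_iff_ne_zero.2 h).map (algebraMap k (E.EndRing i)))
      (Algebra.commutes c _).symm
    rwa [add_sub_cancel] at this

/-- Otherwise xy would be a unit, x would have a right inverse, and so would the power x^t = 0. -/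
lemma endRing_isNilpotent_mul [IsAlgClosed k] [FiniteDimensional k A] (i : Fin n)
    {x : E.EndRing i} (hx : IsNilpotent x) (y : E.EndRing i) : IsNilpotent (x * y) := by
  refine (E.endRing_isNilpotent_or_isUnit k i (x * y)).resolve_right fun h => ?_
  obtain ⟨z, hz⟩ := h.exists_right_inv
  rw [mul_assoc] at hz
  obtain ⟨t, ht⟩ := hx
  have h₁ : ∀ t, x ^ t * (y * z) ^ t = 1 := by
    intro t
    induction t with
    | zero => simp
    | succ t ih => rw [pow_succ, pow_succ', mul_assoc, ← mul_assoc x, hz, one_mul, ih]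
  have h₂ := h₁ t
  rw [ht, zero_mul] at h₂
  exact zero_ne_one h₂

lemma coe_pow_endRing (i : Fin n) (x : E.EndRing i) (t : ℕ) :
    (x ^ (t + 1)).1 = x.1 ^ (t + 1) := by
  induction t with
  | zero => simp
  | succ t ih => rw [pow_succ, coe_mul_corner, ih, ← pow_succ]

lemma isNilpotent_coe_endRing (i : Fin n) {x : E.EndRing i} (hx : IsNilpotent x) :
    IsNilpotent x.1 := by
  obtain ⟨t, ht⟩ := hx
  refine ⟨t + 1, ?_⟩
  rw [← coe_pow_endRing, pow_succ, ht, zero_mul]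
  rfl

/-- The element `e_i a e_i` of `e_i A e_i`. -/
def toEndRing (i : Fin n) (a : A) : E.EndRing i := ⟨E.e i * a * E.e i, a, rfl⟩

lemma coe_toEndRing (i : Fin n) (a : A) : (E.toEndRing i a).1 = E.e i * a * E.e i := rfl

/-- An element of `e_i A e_i` is the sum of a multiple of `e_i` and an element of the radical. -/
lemma exists_sub_smul_mem_jacobson [IsAlgClosed k] [FiniteDimensional k A] (i : Fin n) (a : A) :
    ∃ c : k, E.e i * a * E.e i - c • E.e i ∈ Ring.jacobson A := by
  obtain ⟨c, hc⟩ :=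
    exists_isNilpotent_sub_algebraMap (k := k) (E.endRing_idempotent i) (E.toEndRing i a)
  refine ⟨c, ?_⟩
  set x := E.toEndRing i a - algebraMap k (E.EndRing i) c with hx
  have hx' : x.1 = E.e i * a * E.e i - c • E.e i := rfl
  rw [← hx']
  obtain ⟨h₁, h₂⟩ := (Subsemigroup.mem_corner_iff (E.complete.idem i)).1 x.2
  -- Since x = x e_i, the element x y e_i is the product of x and e_i y e_i inside the local ring
  -- e_i A e_i.
  refine mem_jacobson_of_isNilpotent_corner h₁ fun y => ?_
  have := E.isNilpotent_coe_endRing i (E.endRing_isNilpotent_mul k i hc (E.toEndRing i y))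
  convert this using 1
  rw [coe_mul_corner, coe_toEndRing, ← mul_assoc, ← mul_assoc, h₂]

/-- Right multiplications by a and by b are mutually inverse. Only e_j b matters on P_j, so b need
not satisfy e_j b = b. -/
lemma nonempty_equiv_of_mul_eq {i j : Fin n} {a b : A} (ha : a * E.e j = a) (hb : b * E.e i = b)
    (hab : a * b = E.e i) (hba : E.e j * b * a = E.e j) :
    Nonempty (E.P i ≃ₗ[A] E.P j) := by
  refine ⟨LinearEquiv.ofLinearMap
    { toFun := fun y => ⟨y * a, by rw [← ha, ← mul_assoc]; exact E.mul_e_mem _ _⟩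
      map_add' := fun y z => Subtype.ext (add_mul _ _ _)
      map_smul' := fun c y => Subtype.ext (mul_assoc _ _ _) }
    { toFun := fun y => ⟨y * b, by rw [← hb, ← mul_assoc]; exact E.mul_e_mem _ _⟩
      map_add' := fun y z => Subtype.ext (add_mul _ _ _)
      map_smul' := fun c y => Subtype.ext (mul_assoc _ _ _) } ?_ ?_⟩
  · ext y
    change (y : A) * b * a = y
    rw [← E.mul_e j y, mul_assoc, mul_assoc, ← mul_assoc, ← mul_assoc]
    conv_rhs => rw [← hba]
    simp only [mul_assoc]
  · ext y
    change (y : A) * a * b = y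
    rw [mul_assoc, hab, E.mul_e]

/-- The elements of `e_i A e_j` with `i ≠ j` are in the radical. -/
lemma e_mul_mul_e_mem_jacobson [IsAlgClosed k] [FiniteDimensional k A] {i j : Fin n} (hij : i ≠ j)
    (a : A) : E.e i * a * E.e j ∈ Ring.jacobson A := by
  have ha₁ : E.e i * (E.e i * a * E.e j) = E.e i * a * E.e j := by
    rw [← mul_assoc, ← mul_assoc, E.e_mul_e]
  have ha₂ : (E.e i * a * E.e j) * E.e j = E.e i * a * E.e j := by
    rw [mul_assoc, E.e_mul_e]
  generalize E.e i * a * E.e j = a at ha₁ ha₂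
  refine mem_jacobson_of_isNilpotent_corner ha₁ fun x => ?_
  have hw : (E.toEndRing i (a * x)).1 = a * x * E.e i := by
    rw [coe_toEndRing, ← mul_assoc, ha₁]
  rcases E.endRing_isNilpotent_or_isUnit k i (E.toEndRing i (a * x)) with h | h
  · rw [← hw]
    exact E.isNilpotent_coe_endRing i h
  -- If w inverts a x e_i in e_i A e_i, then e_j x w a is an idempotent of e_j A e_j. It cannot be
  -- 0, as that would give e_i = 0; if it is e_j, then a and xw give P_i ≅ P_j, which is excluded.
  · exfalso
    obtain ⟨w, hw₁, hw₂⟩ := isUnit_iff_exists.1 h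
    replace hw₁ := congrArg Subtype.val hw₁
    obtain ⟨h₁, h₂⟩ := (Subsemigroup.mem_corner_iff (E.complete.idem i)).1 w.2
    rw [coe_mul_corner, hw, mul_assoc, h₁, coe_one_corner] at hw₁
    generalize w.1 = w at hw₁ h₁ h₂
    have hp : (E.toEndRing j (x * w * a)).1 = E.e j * (x * w * a) := by
      rw [coe_toEndRing, mul_assoc, mul_assoc _ a, ha₂]
    have hidem : IsIdempotentElem (E.toEndRing j (x * w * a)) := by
      apply Subtype.ext
      rw [coe_mul_corner, hp]
      simp only [mul_assoc]
      rw [← mul_assoc a (E.e j), ha₂, ← mul_assoc a x, ← mul_assoc (a * x), hw₁,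
        ← mul_assoc w (E.e i), h₂]
    rcases E.endRing_idempotent j _ hidem with h0 | h1
    · replace h0 : E.e j * (x * w * a) = 0 := hp.symm.trans (congrArg Subtype.val h0)
      apply E.ne_zero i
      calc E.e i = a * x * w * (a * x * w) := by rw [hw₁, E.e_mul_e]
        _ = a * E.e j * x * w * (a * x * w) := by rw [ha₂]
        _ = a * (E.e j * (x * w * a)) * (x * w) := by simp only [mul_assoc]
        _ = 0 := by rw [h0, mul_zero, zero_mul]
    · replace h1 : E.e j * (x * w * a) = E.e j := hp.symm.trans (congrArg Subtype.val h1)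
      have := E.nonempty_equiv_of_mul_eq (b := x * w) ha₂ (by rw [mul_assoc, h₂])
        (by rw [← mul_assoc, hw₁]) (by rw [mul_assoc, h1])
      exact (E.not_iso i j hij).false this.some

end BasicDecomposition
end InfDef

/-! ### Lifting through exact sequences of modules. -/

namespace InfDef

section ProjectiveLifting

variable {R : Type*} [Ring R]

instance projective_pi {ι : Type*} [Finite ι] (M : ι → Type*) [∀ i, AddCommGroup (M i)]
    [∀ i, Module R (M i)] [∀ i, Module.Projective R (M i)] : Module.Projective R (∀ i, M i) := by
  classical
  have := Fintype.ofFinite ι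
  exact Module.Projective.of_equiv (DFinsupp.linearEquivFunOnFintype (R := R) (M := M))

lemma exists_lift_of_mem_range {P Q N : Type*} [AddCommGroup P] [Module R P]
    [Module.Projective R P] [AddCommGroup Q] [Module R Q] [AddCommGroup N] [Module R N]
    (d : Q →ₗ[R] N) (g : P →ₗ[R] N) (h : ∀ x, g x ∈ LinearMap.range d) :
    ∃ l : P →ₗ[R] Q, ∀ x, d (l x) = g x := by
  obtain ⟨l, hl⟩ := Module.projective_lifting_property d.rangeRestrict (g.codRestrict _ h)
    d.surjective_rangeRestrict
  exact ⟨l, fun x => congrArg Subtype.val (LinearMap.congr_fun hl x)⟩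

/-- Inductive construction of a homotopy between maps from a complex of projective modules to an
exact complex. -/
lemma exists_homotopy {P Q : ℕ → Type*} [∀ i, AddCommGroup (P i)] [∀ i, Module R (P i)]
    [∀ i, Module.Projective R (P i)] [∀ i, AddCommGroup (Q i)] [∀ i, Module R (Q i)]
    (d : ∀ i, P (i + 1) →ₗ[R] P i) (d' : ∀ i, Q (i + 1) →ₗ[R] Q i)
    (hd : ∀ i x, d i (d (i + 1) x) = 0) (hd' : ∀ i, Function.Exact (d' (i + 1)) (d' i))
    (W : ∀ i, P (i + 1) →ₗ[R] Q i) (hW : ∀ i x, W i (d (i + 1) x) + d' i (W (i + 1) x) = 0)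
    (D₀ : P 0 →ₗ[R] Q 0) (hD₀ : ∀ x, D₀ (d 0 x) - W 0 x ∈ LinearMap.range (d' 0)) :
    ∃ D : ∀ i, P i →ₗ[R] Q i, D 0 = D₀ ∧ ∀ i x, d' i (D (i + 1) x) = D i (d i x) - W i x := by
  -- The recursion carries two consecutive components with the relation between them, since the next
  -- component exists only because of that relation. With W = 0 the result is a lifting of chain
  -- maps.
  let T (i : ℕ) := {p : (P i →ₗ[R] Q i) × (P (i + 1) →ₗ[R] Q (i + 1)) //
    ∀ x, d' i (p.2 x) = p.1 (d i x) - W i x}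
  obtain ⟨D₁, hD₁⟩ := exists_lift_of_mem_range (d' 0) (D₀ ∘ₗ d 0 - W 0) hD₀
  have step (i : ℕ) (p : T i) : ∃ q : T (i + 1), q.1.1 = p.1.2 := by
    obtain ⟨D, hD⟩ := exists_lift_of_mem_range (d' (i + 1)) (p.1.2 ∘ₗ d (i + 1) - W (i + 1))
      fun x => (hd' i _).1 (by
        have := hW i x
        simp only [LinearMap.sub_apply, LinearMap.comp_apply, map_sub, p.2, hd, map_zero, zero_sub]
        rw [← neg_add', this, neg_zero])
    exact ⟨⟨(p.1.2, D), hD⟩, rfl⟩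
  choose next hnext using step
  let seq (i : ℕ) : T i := Nat.rec ⟨(D₀, D₁), hD₁⟩ next i
  refine ⟨fun i => (seq i).1.1, rfl, fun i x => ?_⟩
  have : (seq (i + 1)).1.1 = (seq i).1.2 := hnext i (seq i)
  change d' i ((seq (i + 1)).1.1 x) = _
  rw [this]
  exact (seq i).2 x

end ProjectiveLifting

/-! ### Maps between projectives as matrices. -/

namespace BasicDecomposition

variable {k : Type u} {A : Type u} [Field k] [Ring A] [Algebra k A]
  {n : ℕ} (E : BasicDecomposition A n) {r s t : ℕ} {σ : Fin r → Fin n} {τ : Fin s → Fin n}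
  {ρ : Fin t → Fin n}

instance (i : Fin n) : Module.Projective A (E.P i) :=
  Module.Projective.of_split (E.P i).subtype
    { toFun := fun a => ⟨a * E.e i, E.mul_e_mem a i⟩
      map_add' := fun _ _ => Subtype.ext (add_mul _ _ _)
      map_smul' := fun _ _ => Subtype.ext (mul_assoc _ _ _) }
    (LinearMap.ext fun x => Subtype.ext (E.mul_e i x))

/-- The generator of the `l`-th summand of `⨁_r A e_{σ r}`. -/
def gen (σ : Fin r → Fin n) (l : Fin r) : E.Proj σ :=
  Pi.single l ⟨E.e (σ l), Ideal.mem_span_singleton_self _⟩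

lemma eq_sum_gen (x : E.Proj σ) : x = ∑ l, (x l : A) • E.gen σ l := by
  funext j
  rw [Finset.sum_apply, Finset.sum_eq_single j]
  · apply Subtype.ext
    simp [gen, E.mul_e]
  · intro l _ hl
    simp [gen, hl.symm]
  · simp

lemma e_smul_gen (l : Fin r) : E.e (σ l) • E.gen σ l = E.gen σ l := by
  funext j
  apply Subtype.ext
  by_cases h : j = l
  · subst h
    simp [gen, E.e_mul_e]
  · simp [gen, h]

variable {M : Type*} [AddCommGroup M] [Module A M]

lemma hom_apply (g : E.Proj σ →ₗ[A] M) (x : E.Proj σ) : g x = ∑ l, (x l : A) • g (E.gen σ l) := by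
  conv_lhs => rw [E.eq_sum_gen x]
  simp only [map_sum, map_smul]

lemma hom_ext_gen {g h : E.Proj σ →ₗ[A] M} (H : ∀ l, g (E.gen σ l) = h (E.gen σ l)) : g = h :=
  LinearMap.ext fun x => by
    rw [hom_apply, hom_apply]
    simp only [H]

lemma corner_apply (B : E.Corner σ τ) (l : Fin r) (j : Fin s) :
    E.e (σ l) * B.1 l j * E.e (τ j) = B.1 l j := by
  conv_rhs => rw [← B.2]
  simp [diag, Matrix.mul_diagonal, Matrix.diagonal_mul]

lemma corner_mul_e (B : E.Corner σ τ) (l : Fin r) (j : Fin s) :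
    B.1 l j * E.e (τ j) = B.1 l j := by
  rw [← E.corner_apply B l j, mul_assoc, E.e_mul_e]

lemma e_mul_corner (B : E.Corner σ τ) (l : Fin r) (j : Fin s) :
    E.e (σ l) * B.1 l j = B.1 l j := by
  rw [← E.corner_apply B l j, ← mul_assoc, ← mul_assoc, E.e_mul_e]

lemma mulRight_coe (B : E.Corner σ τ) (x : E.Proj σ) (j : Fin s) :
    (E.mulRight B x j : A) = ∑ l, (x l : A) * B.1 l j := rfl

lemma mulRight_gen (B : E.Corner σ τ) (l : Fin r) (j : Fin s) :
    (E.mulRight B (E.gen σ l) j : A) = B.1 l j := by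
  rw [mulRight_coe, Finset.sum_eq_single l]
  · simp [gen, E.e_mul_corner]
  · intro b _ hb
    simp [gen, hb]
  · simp

/-- The matrix with given entries in `e_{σ l} A e_{τ j}`. -/
def cornerOf (σ : Fin r → Fin n) (τ : Fin s → Fin n) (B : Matrix (Fin r) (Fin s) A)
    (h : ∀ l j, E.e (σ l) * B l j * E.e (τ j) = B l j) : E.Corner σ τ :=
  ⟨B, by ext l j; simp [diag, Matrix.mul_diagonal, Matrix.diagonal_mul, h]⟩

lemma exists_mulRight_eq (g : E.Proj σ →ₗ[A] E.Proj τ) : ∃ B : E.Corner σ τ, E.mulRight B = g := by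
  refine ⟨E.cornerOf σ τ (fun l j => g (E.gen σ l) j) fun l j => ?_, ?_⟩
  · rw [mul_assoc, E.mul_e]
    conv_rhs => rw [← E.e_smul_gen, map_smul]
    rfl
  · refine E.hom_ext_gen fun l => funext fun j => Subtype.ext ?_
    rw [mulRight_gen]
    rfl

lemma mulRight_injective : Function.Injective (E.mulRight (σ := σ) (τ := τ)) := fun B B' h => by
  apply Subtype.ext
  ext l j
  rw [← E.mulRight_gen, ← E.mulRight_gen, h]

/-! ### The radical -/

lemma jacobson_simpleSum : Module.jacobson A E.SimpleSum = ⊥ :=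
  Module.jacobson_pi_eq_bot _ _ fun _ => Module.jacobson_quotient_jacobson _ _

/-- Homomorphisms carry radicals into radicals, and S has radical zero. -/
lemma hom_eq_zero_of_mem_jacobson {N : Type*} [AddCommGroup N] [Module A N]
    (g : N →ₗ[A] E.SimpleSum) {x : N} (hx : x ∈ Module.jacobson A N) : g x = 0 := by
  have := Module.le_comap_jacobson g hx
  rwa [jacobson_simpleSum] at this

lemma smul_simpleSum_eq_zero {a : A} (ha : a ∈ Ring.jacobson A) (y : E.SimpleSum) : a • y = 0 := by
  have := Ring.jacobson_smul_top_le A E.SimpleSum (Submodule.smul_mem_smul ha (Submodule.mem_top (x := y)))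
  rwa [jacobson_simpleSum] at this

lemma hom_eq_zero_of_forall_mem (g : E.Proj σ →ₗ[A] E.SimpleSum) {x : E.Proj σ}
    (hx : ∀ l, (x l : A) ∈ Ring.jacobson A) : g x = 0 := by
  rw [hom_apply]
  exact Finset.sum_eq_zero fun l _ => E.smul_simpleSum_eq_zero (hx l) _

lemma mem_jacobson_of_mem_jacobson_proj {x : E.Proj σ} (hx : x ∈ Module.jacobson A (E.Proj σ))
    (l : Fin r) : (x l : A) ∈ Ring.jacobson A :=
  Module.le_comap_jacobson ((E.P (σ l)).subtype ∘ₗ LinearMap.proj (φ := fun l => E.P (σ l)) l) hx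

/-- A homomorphism `⨁ A e_{σ r} → S` lifts through an epimorphism to a matrix whose entries are
multiples of the idempotents. -/
lemma exists_scalar_lift [IsAlgClosed k] [FiniteDimensional k A]
    (p : E.Proj τ →ₗ[A] E.SimpleSum) (hp : Function.Surjective p)
    (g : E.Proj σ →ₗ[A] E.SimpleSum) :
    ∃ (G : E.Corner σ τ) (c : Fin r → Fin s → k),
      (∀ l j, G.1 l j = if σ l = τ j then c l j • E.e (τ j) else 0) ∧
      ∀ x, p (E.mulRight G x) = g x := by
  choose y hy using fun l => hp (g (E.gen σ l))
  -- Any lift of g has entries which are, modulo the radical, scalars times idempotents if the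
  -- indices agree, and zero otherwise. Only this leading part is kept.
  choose c₀ hc₀ using fun l j => E.exists_sub_smul_mem_jacobson k (τ j) (y l j : A)
  have hc l j (h : σ l = τ j) := hc₀ l j
  let G : E.Corner σ τ := E.cornerOf σ τ
    (fun l j => if σ l = τ j then c₀ l j • E.e (τ j) else 0) (fun l j => by
      split_ifs with h
      · rw [h, mul_smul_comm, smul_mul_assoc, E.e_mul_e, E.e_mul_e]
      · simp)
  refine ⟨G, c₀, fun l j => rfl, fun x => ?_⟩
  suffices H : p ∘ₗ E.mulRight G = g from LinearMap.congr_fun H x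
  refine E.hom_ext_gen fun l => ?_
  rw [LinearMap.comp_apply, ← E.e_smul_gen l (σ := σ), map_smul g, ← hy, ← map_smul, ← sub_eq_zero,
    ← map_sub, E.e_smul_gen]
  -- The discarded part has radical entries, hence is invisible to p.
  refine E.hom_eq_zero_of_forall_mem p fun j => ?_
  rw [← neg_mem_iff]
  change -((E.mulRight G (E.gen σ l) j : A) - E.e (σ l) * y l j) ∈ _
  rw [mulRight_gen, neg_sub]
  change E.e (σ l) * (y l j : A) - (if σ l = τ j then c₀ l j • E.e (τ j) else 0) ∈ _
  rw [← E.mul_e (τ j) (y l j), ← mul_assoc]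
  split_ifs with h
  · rw [h]
    exact hc₀ l j
  · rw [sub_zero]
    exact E.e_mul_mul_e_mem_jacobson k h _

/-! ### The cocycle applied to matrices. -/

variable (f : HochschildCocycle k A)

lemma cocycle_eq (a b c : A) :
    f.toFun (a * b) c = a * f.toFun b c + f.toFun a (b * c) - f.toFun a b * c := by
  have := f.cocycle a b c
  rw [sub_eq_zero] at this
  rw [← this]
  abel

lemma fRight_coe (B : E.Corner σ τ) (x : E.Proj σ) (j : Fin s) :
    (E.fRight f B x j : A) = (∑ l, f (x l) (B.1 l j)) * E.e (τ j) := rfl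

lemma fProj_coe (a : A) (x : E.Proj σ) (j : Fin r) :
    (E.fProj f σ a x j : A) = f a (x j) * E.e (σ j) := rfl

/-- In general f need not respect the radical. But if xe = x, the cocycle identity for (x, e, e)
gives f(x, e)e = x f(e, e), which is in the radical with x. -/
lemma fRight_mem_jacobson {G : E.Corner σ τ} {c : Fin r → Fin s → k}
    (hG : ∀ l j, G.1 l j = if σ l = τ j then c l j • E.e (τ j) else 0) {x : E.Proj σ}
    (hx : ∀ l, (x l : A) ∈ Ring.jacobson A) (j : Fin s) :
    (E.fRight f G x j : A) ∈ Ring.jacobson A := by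
  rw [fRight_coe, Finset.sum_mul]
  refine Submodule.sum_mem _ fun l _ => ?_
  rw [hG]
  split_ifs with h
  · have h₁ := cocycle_eq f (x l) (E.e (τ j)) (E.e (τ j))
    have h₂ : (x l : A) * E.e (τ j) = x l := by
      have := E.mul_e (σ l) (x l)
      rwa [congrArg E.e h] at this
    rw [E.e_mul_e, h₂, add_sub_right_comm, eq_comm, add_eq_right, sub_eq_zero] at h₁
    change f.toFun _ _ * _ ∈ _
    rw [map_smul, smul_mul_assoc, ← h₁, ← smul_mul_assoc, Algebra.smul_def]
    exact Ideal.mul_mem_right _ _ (Ideal.mul_mem_left _ _ (hx l))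
  · simp

lemma fRight_add (B : E.Corner σ τ) (x y : E.Proj σ) :
    E.fRight f B (x + y) = E.fRight f B x + E.fRight f B y := by
  funext j
  apply Subtype.ext
  simp [fRight_coe, Finset.sum_add_distrib, add_mul]

/-- This is the cocycle identity for (a, x_l, b_lj), summed over l and cut by e_{τ j}. The two extra
terms are the deformations of target and source. -/
lemma fRight_smul (B : E.Corner σ τ) (a : A) (x : E.Proj σ) :
    E.fRight f B (a • x) = a • E.fRight f B x + E.fProj f τ a (E.mulRight B x) -
      E.mulRight B (E.fProj f σ a x) := by
  funext j
  apply Subtype.ext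
  change (∑ l, f.toFun (a * x l) (B.1 l j)) * E.e (τ j) =
    a * ((∑ l, f.toFun (x l) (B.1 l j)) * E.e (τ j)) +
      f.toFun a (∑ l, (x l : A) * B.1 l j) * E.e (τ j) -
        ∑ l, f.toFun a (x l) * E.e (σ l) * B.1 l j
  simp only [map_sum, Finset.sum_mul, Finset.mul_sum, ← Finset.sum_add_distrib,
    ← Finset.sum_sub_distrib]
  refine Finset.sum_congr rfl fun l _ => ?_
  rw [cocycle_eq, mul_assoc (f.toFun a (x l)), e_mul_corner, sub_mul, add_mul,
    mul_assoc (f.toFun a (x l)), corner_mul_e, mul_assoc a]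

/-- The matrix `E_σ f̃(B ⊗ B') E_ρ`. -/
def cornerF (B : E.Corner σ τ) (B' : E.Corner τ ρ) : E.Corner σ ρ :=
  E.cornerOf σ ρ (E.diag σ * ftilde f B.1 B'.1 * E.diag ρ) fun l j => by
    simp only [diag, Matrix.mul_diagonal, Matrix.diagonal_mul]
    simp only [mul_assoc, E.e_mul_e]
    rw [← mul_assoc (E.e (σ l)) (E.e (σ l)), E.e_mul_e]

lemma cornerF_apply (B : E.Corner σ τ) (B' : E.Corner τ ρ) (l : Fin r) (j : Fin t) :
    (E.cornerF f B B').1 l j =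
      E.e (σ l) * ((∑ i, f.toFun (B.1 l i) (B'.1 i j)) * E.e (ρ j)) := by
  change (E.diag σ * ftilde f B.1 B'.1 * E.diag ρ) l j = _
  simp only [diag, Matrix.mul_diagonal, Matrix.diagonal_mul, mul_assoc]
  rfl

/-- The product of matrices. -/
def cornerMul (B : E.Corner σ τ) (B' : E.Corner τ ρ) : E.Corner σ ρ :=
  E.cornerOf σ ρ (B.1 * B'.1) fun l j => by
    rw [Matrix.mul_apply, Finset.mul_sum, Finset.sum_mul]
    refine Finset.sum_congr rfl fun i _ => ?_
    rw [← mul_assoc, e_mul_corner, mul_assoc, corner_mul_e]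

lemma mulRight_cornerMul (B : E.Corner σ τ) (B' : E.Corner τ ρ) (x : E.Proj σ) :
    E.mulRight (E.cornerMul B B') x = E.mulRight B' (E.mulRight B x) := by
  funext j
  apply Subtype.ext
  change ∑ l, (x l : A) * (B.1 * B'.1) l j = ∑ i, (∑ l, (x l : A) * B.1 l i) * B'.1 i j
  simp only [Matrix.mul_apply, Finset.mul_sum, Finset.sum_mul]
  rw [Finset.sum_comm]
  simp only [mul_assoc]

/-- The cocycle identity for the triple ([x], B, B'), with the idempotents placed so that every term
lies in the target. -/
lemma fRight_mulRight (B : E.Corner σ τ) (B' : E.Corner τ ρ) (x : E.Proj σ) :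
    E.fRight f B' (E.mulRight B x) + E.mulRight B' (E.fRight f B x) =
      E.mulRight (E.cornerF f B B') x + E.fRight f (E.cornerMul B B') x := by
  funext j
  apply Subtype.ext
  change (∑ i, f.toFun (∑ l, (x l : A) * B.1 l i) (B'.1 i j)) * E.e (ρ j) +
      ∑ i, (∑ l, f.toFun (x l) (B.1 l i)) * E.e (τ i) * B'.1 i j =
    ∑ l, (x l : A) * (E.cornerF f B B').1 l j +
      (∑ l, f.toFun (x l) ((B.1 * B'.1) l j)) * E.e (ρ j)
  have key (x : Fin r → A) (b : Fin r → Fin s → A) (c : Fin s → A) (eσ : Fin r → A)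
      (eτ : Fin s → A) (eρ : A) (hx : ∀ l, x l * eσ l = x l) (hτ : ∀ i, eτ i * c i = c i)
      (hρ : ∀ i, c i * eρ = c i) :
      (∑ i, f.toFun (∑ l, x l * b l i) (c i)) * eρ + ∑ i, (∑ l, f.toFun (x l) (b l i)) * eτ i * c i =
        ∑ l, x l * (eσ l * ((∑ i, f.toFun (b l i) (c i)) * eρ)) +
          (∑ l, f.toFun (x l) (∑ i, b l i * c i)) * eρ := by
    simp only [← mul_assoc, hx]
    simp only [mul_assoc, hτ]
    simp only [map_sum, LinearMap.sum_apply, Finset.sum_mul, Finset.mul_sum]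
    rw [Finset.sum_comm, Finset.sum_comm (f := fun i l => f.toFun (x l) (b l i) * c i)]
    simp only [← Finset.sum_add_distrib]
    refine Finset.sum_congr rfl fun l _ => Finset.sum_congr rfl fun i _ => ?_
    rw [cocycle_eq, sub_mul, add_mul, mul_assoc (f.toFun (x l) (b l i)), hρ, mul_assoc]
    abel
  simp only [cornerF_apply]
  exact key (fun l => x l) (fun l i => B.1 l i) (fun i => B'.1 i j) (fun l => E.e (σ l))
    (fun i => E.e (τ i)) (E.e (ρ j)) (fun l => E.mul_e _ _) (fun i => E.e_mul_corner B' i j)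
    (fun i => E.corner_mul_e B' i j)

end BasicDecomposition

end InfDef

/-! ### The projective resolution over the deformation. -/

namespace InfDef

variable {k : Type u} {A : Type u} [Field k] [Ring A] [Algebra k A] {n : ℕ}

namespace BasicDecomposition

variable (E : BasicDecomposition A n) (f : HochschildCocycle k A) {r s t : ℕ} {σ : Fin r → Fin n}
  {τ : Fin s → Fin n} {ρ : Fin t → Fin n}

lemma hat_smul_m₁ (a : Deformation f) (x : (E.hat f σ).Carrier) :
    (a • x).m₁ = a.c₀ • x.m₁ + E.fProj f σ a.c₀ x.m₀ + a.c₁ • x.m₀ := rfl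

/-- The element of `⨁_j A e_j` corresponding to `1 ∈ A`. -/
def unitVec : E.Proj (id : Fin n → Fin n) :=
  fun j => ⟨E.e j, Ideal.mem_span_singleton_self _⟩

lemma smul_unitVec_coe (a : A) (j : Fin n) : ((a • E.unitVec) j : A) = a * E.e j := rfl

lemma sum_smul_unitVec (a : A) : ∑ j, ((a • E.unitVec) j : A) = a := by
  simp only [smul_unitVec_coe, ← Finset.mul_sum, E.complete.complete, mul_one]

lemma smul_unitVec_sum (x : E.Proj (id : Fin n → Fin n)) : (∑ j, (x j : A)) • E.unitVec = x := by
  funext j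
  apply Subtype.ext
  rw [smul_unitVec_coe, Finset.sum_mul, Finset.sum_eq_single j]
  · exact E.mul_e j (x j)
  · intro i _ hij
    rw [← E.mul_e i (x i)]
    change (x i : A) * E.e i * E.e j = 0
    rw [mul_assoc, E.complete.ortho hij, mul_zero]
  · simp

/-- The hat of ⨁ A e_j = A is free of rank one over A_f, on the generator (1, 0). -/
instance projective_hat_id :
    Module.Projective (Deformation f) (E.hat f (id : Fin n → Fin n)).Carrier := by
  let u : (E.hat f (id : Fin n → Fin n)).Carrier := ⟨E.unitVec, 0⟩
  have h₀ (a : Deformation f) : (a • u).m₀ = a.c₀ • E.unitVec := rfl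
  have h₁ (a : Deformation f) : (a • u).m₁ = E.fProj f id a.c₀ E.unitVec + a.c₁ • E.unitVec := by
    rw [hat_smul_m₁]
    change a.c₀ • (0 : E.Proj id) + _ + _ = _
    rw [smul_zero, zero_add]
  refine Module.Projective.of_equiv (LinearEquiv.ofBijective
    (LinearMap.toSpanSingleton (Deformation f) _ u) ⟨fun a b hab => ?_, fun x => ?_⟩)
  · change a • u = b • u at hab
    have e₀ := congrArg DefTuple.Carrier.m₀ hab
    have e₁ := congrArg DefTuple.Carrier.m₁ hab
    rw [h₀, h₀] at e₀
    have e₂ : a.c₀ = b.c₀ := by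
      rw [← E.sum_smul_unitVec a.c₀, e₀, E.sum_smul_unitVec]
    rw [h₁, h₁, e₂, add_right_inj] at e₁
    have e₃ : a.c₁ = b.c₁ := by
      rw [← E.sum_smul_unitVec a.c₁, e₁, E.sum_smul_unitVec]
    exact Deformation.ext e₂ e₃
  -- The coefficient of t is corrected by the value of f that the constant coefficient already
  -- contributes.
  · refine ⟨⟨∑ j, (x.m₀ j : A), ∑ j, ((x.m₁ - E.fProj f id (∑ j, (x.m₀ j : A)) E.unitVec) j : A)⟩, ?_⟩
    change (⟨_, _⟩ : Deformation f) • u = x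
    refine DefTuple.Carrier.ext ?_ ?_
    · rw [h₀, E.smul_unitVec_sum]
    · rw [h₁, E.smul_unitVec_sum, add_sub_cancel]

/-- Each hat of A e_{σ l} is a direct summand of the hat of A, so Q̂ is a retract of a power of the
latter. -/
instance projective_hat (σ : Fin r → Fin n) :
    Module.Projective (Deformation f) (E.hat f σ).Carrier := by
  let ε (l : Fin r) : E.P (σ l) →ₗ[A] E.Proj (id : Fin n → Fin n) :=
    LinearMap.single A (fun j => E.P j) (σ l)
  have hε (l : Fin r) (x : E.P (σ l)) : ε l x (σ l) = x :=
    Pi.single_eq_same (M := fun j => E.P j) (σ l) x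
  have hε' (l : Fin r) (x : E.P (σ l)) (j : Fin n) (hj : j ≠ σ l) : ε l x j = 0 :=
    Pi.single_eq_of_ne (M := fun j => E.P j) hj x
  let ι : (E.hat f σ).Carrier →ₗ[Deformation f]
      (Fin r → (E.hat f (id : Fin n → Fin n)).Carrier) :=
    { toFun := fun x l => ⟨ε l (x.m₀ l), ε l (x.m₁ l)⟩
      map_add' := fun x y => funext fun l => DefTuple.Carrier.ext
        (map_add (ε l) _ _) (map_add (ε l) _ _)
      map_smul' := fun a x => funext fun l => by
        refine DefTuple.Carrier.ext (map_smul (ε l) _ _) ?_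
        change ε l (a.c₀ • x.m₁ l + E.fProj f σ a.c₀ x.m₀ l + a.c₁ • x.m₀ l) =
          a.c₀ • ε l (x.m₁ l) + E.fProj f id a.c₀ (ε l (x.m₀ l)) + a.c₁ • ε l (x.m₀ l)
        rw [map_add, map_add, map_smul, map_smul]
        congr 2
        funext j
        apply Subtype.ext
        rw [fProj_coe]
        obtain rfl | hj := eq_or_ne j (σ l)
        · rw [hε, hε, fProj_coe]
          rfl
        · rw [hε' _ _ _ hj, hε' _ _ _ hj]
          simp }
  let π : (Fin r → (E.hat f (id : Fin n → Fin n)).Carrier) →ₗ[Deformation f]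
      (E.hat f σ).Carrier :=
    { toFun := fun y => ⟨fun l => (y l).m₀ (σ l), fun l => (y l).m₁ (σ l)⟩
      map_add' := fun x y => rfl
      map_smul' := fun a x => rfl }
  refine Module.Projective.of_split ι π (LinearMap.ext fun x => ?_)
  refine DefTuple.Carrier.ext (funext fun l => ?_) (funext fun l => ?_)
  · exact hε l (x.m₀ l)
  · exact hε l (x.m₁ l)

lemma fRight_eq_zero {B : E.Corner σ τ} (hB : ∀ x, E.mulRight B x = 0) (x : E.Proj σ) :
    E.fRight f B x = 0 := by
  funext j
  apply Subtype.ext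
  rw [fRight_coe]
  have (l : Fin r) : B.1 l j = 0 := by
    rw [← mulRight_gen, hB]
    rfl
  simp [this]

end BasicDecomposition

namespace MinimalResolution

open BasicDecomposition

variable {E : BasicDecomposition A n} {M : Type u} [AddCommGroup M] [Module A M]
  (Q : MinimalResolution E M) (f : HochschildCocycle k A)
  (C : ∀ i, E.Corner (Q.idx (i + 1)) (Q.idx i))

lemma δ_δ (i : ℕ) (x : Q.X (i + 2)) : Q.δ i (Q.δ (i + 1) x) = 0 :=
  (Q.exact_succ i).apply_apply_eq_zero x

lemma δ₀_δ (x : Q.X 1) : Q.δ₀ (Q.δ 0 x) = 0 :=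
  Q.exact_zero.apply_apply_eq_zero x

/-- The map `α_{i+1}` without its sign. -/
def F (i : ℕ) (x : Q.X (i + 1)) : Q.X i := E.fRight f (Q.B i) x - E.mulRight (C i) x

lemma α_eq (i : ℕ) (x : Q.X (i + 1)) : Q.α f C i x = (-1 : ℤ) ^ i • Q.F f C i x := by
  simp [α, F, pow_add]

lemma F_add (i : ℕ) (x y : Q.X (i + 1)) : Q.F f C i (x + y) = Q.F f C i x + Q.F f C i y := by
  simp only [F, fRight_add, map_add]
  abel

lemma F_smul (i : ℕ) (a : A) (x : Q.X (i + 1)) :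
    Q.F f C i (a • x) = a • Q.F f C i x + E.fProj f _ a (Q.δ i x) - Q.δ i (E.fProj f _ a x) := by
  simp only [F, fRight_smul, map_smul, smul_sub]
  change _ + E.fProj f _ a (Q.δ i x) - Q.δ i _ - _ = _
  abel

variable {Q f C}

/-- The cocycle identity for ([x], B_{i+2}, B_{i+1}) loses its last term because δδ = 0; what
remains is the matrix E f̃(B ⊗ B') E, which the C terms cancel by their defining equation. -/
lemma F_δ (hC : Q.IsCorrection f C) (i : ℕ) (x : Q.X (i + 2)) :
    Q.F f C i (Q.δ (i + 1) x) + Q.δ i (Q.F f C (i + 1) x) = 0 := by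
  have h := E.fRight_mulRight f (Q.B (i + 1)) (Q.B i) x
  rw [E.fRight_eq_zero f (B := E.cornerMul (Q.B (i + 1)) (Q.B i))
    (fun y => by rw [E.mulRight_cornerMul]; exact Q.δ_δ i y), add_zero] at h
  have h' : E.mulRight (E.cornerF f (Q.B (i + 1)) (Q.B i)) x =
      E.mulRight (Q.B i) (E.mulRight (C (i + 1)) x) +
        E.mulRight (C i) (E.mulRight (Q.B (i + 1)) x) := by
    rw [← mulRight_cornerMul, ← mulRight_cornerMul]
    funext j
    apply Subtype.ext
    change ∑ l, (x l : A) * (E.diag (Q.idx (i + 2)) * ftilde f (Q.B (i + 1)).1 (Q.B i).1 *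
        E.diag (Q.idx i)) l j =
      ∑ l, (x l : A) * ((C (i + 1)).1 * (Q.B i).1) l j +
        ∑ l, (x l : A) * ((Q.B (i + 1)).1 * (C i).1) l j
    rw [hC i, ← Finset.sum_add_distrib]
    refine Finset.sum_congr rfl fun l _ => ?_
    rw [Matrix.add_apply, mul_add]
  have : Q.F f C i (Q.δ (i + 1) x) + Q.δ i (Q.F f C (i + 1) x) =
      (E.fRight f (Q.B i) (E.mulRight (Q.B (i + 1)) x) +
        E.mulRight (Q.B i) (E.fRight f (Q.B (i + 1)) x)) -
      (E.mulRight (Q.B i) (E.mulRight (C (i + 1)) x) +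
        E.mulRight (C i) (E.mulRight (Q.B (i + 1)) x)) := by
    simp only [F, δ, map_sub]
    abel
  rw [this, h, h', sub_self]

variable (Q f C)

lemma zsmul_neg_one_pow_twice {G : Type*} [AddCommGroup G] (i : ℕ) (x : G) :
    (-1 : ℤ) ^ i • (-1 : ℤ) ^ i • x = x := by
  rw [smul_smul, ← mul_pow, neg_one_mul, neg_neg, one_pow, one_smul]

lemma neg_one_pow_smul_α (i : ℕ) (x : Q.X (i + 1)) : (-1 : ℤ) ^ i • Q.α f C i x = Q.F f C i x := by
  rw [α_eq, zsmul_neg_one_pow_twice]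

lemma hatδ_m₀ (m : ℕ) (x : Q.HatX f (m + 1)) (i : Fin (m + 1)) :
    (Q.hatδ f C m x i).m₀ = Q.δ i (x ⟨i + 1, by omega⟩).m₀ := rfl

lemma hatδ_m₁ (m : ℕ) (x : Q.HatX f (m + 1)) (i : Fin (m + 1)) :
    (Q.hatδ f C m x i).m₁ = (-1 : ℤ) ^ (i : ℕ) • (x ⟨i, by omega⟩).m₀ +
      Q.F f C i (x ⟨i + 1, by omega⟩).m₀ + Q.δ i (x ⟨i + 1, by omega⟩).m₁ := by
  change (-1 : ℤ) ^ (i : ℕ) • ((x ⟨i, by omega⟩).m₀ + Q.α f C i (x ⟨i + 1, by omega⟩).m₀) +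
      Q.δ i (x ⟨i + 1, by omega⟩).m₁ = _
  rw [smul_add, neg_one_pow_smul_α]

/-- The differential `δ̂` as a linear map. -/
def hatδLin (m : ℕ) : Q.HatX f (m + 1) →ₗ[Deformation f] Q.HatX f m where
  toFun := Q.hatδ f C m
  map_add' x y := funext fun i => by
    refine DefTuple.Carrier.ext (map_add _ _ _) ?_
    simp only [Pi.add_apply, DefTuple.Carrier.add_m₁, hatδ_m₁, DefTuple.Carrier.add_m₀, F_add,
      map_add, smul_add]
    abel
  map_smul' a x := funext fun i => by
    refine DefTuple.Carrier.ext (map_smul _ _ _) ?_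
    simp only [RingHom.id_apply, Pi.smul_apply, hat_smul_m₁, hatδ_m₁, hatδ_m₀,
      DefTuple.Carrier.smul_m₀, F_smul, map_add, map_smul, smul_add, smul_comm _ a.c₀]
    abel

variable {Q f C}

/-- Exactness of δ gives z_{i+1} over x_i, leaving z_0 free. Then w_{i+1} must solve row i; for i >
0 the required cycle condition is row i - 1 of the hypothesis combined with `F_δ`. -/
lemma exists_preimage (hC : Q.IsCorrection f C) (m : ℕ) (x y : ∀ i, Q.X i)
    (h₀ : Q.δ₀ (x 0) = 0) (hx : ∀ i < m, Q.δ i (x (i + 1)) = 0)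
    (hy : ∀ i < m, (-1 : ℤ) ^ i • x i + Q.F f C i (x (i + 1)) + Q.δ i (y (i + 1)) = 0) :
    ∃ z w : ∀ i, Q.X i, ∀ i < m + 1, Q.δ i (z (i + 1)) = x i ∧
      (-1 : ℤ) ^ i • z i + Q.F f C i (z (i + 1)) + Q.δ i (w (i + 1)) = y i := by
  have H (i : ℕ) : ∃ z, i < m + 1 → Q.δ i z = x i := by
    by_cases hi : i < m + 1
    · obtain _ | i := i
      · obtain ⟨z, hz⟩ := (Q.exact_zero (x 0)).1 h₀
        exact ⟨z, fun _ => hz⟩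
      · obtain ⟨z, hz⟩ := (Q.exact_succ i (x (i + 1))).1 (hx i (by omega))
        exact ⟨z, fun _ => hz⟩
    · exact ⟨0, fun h => absurd h hi⟩
  choose z' hz' using H
  -- Row 0 has no cycle condition to offer, so it is solved by the free component z_0, with w_1 = 0.
  let z : ∀ i, Q.X i := fun i => match i with
    | 0 => y 0 - Q.F f C 0 (z' 0)
    | i + 1 => z' i
  have H' (i : ℕ) : ∃ w, i < m + 1 →
      (-1 : ℤ) ^ i • z i + Q.F f C i (z (i + 1)) + Q.δ i w = y i := by
    by_cases hi : i < m + 1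
    · obtain _ | i := i
      · refine ⟨0, fun _ => ?_⟩
        change (-1 : ℤ) ^ 0 • (y 0 - Q.F f C 0 (z' 0)) + Q.F f C 0 (z' 0) + _ = _
        rw [map_zero, pow_zero, one_smul, sub_add_cancel, add_zero]
      · obtain ⟨w, hw⟩ := (Q.exact_succ i (y (i + 1) - ((-1 : ℤ) ^ (i + 1) • z' i +
          Q.F f C (i + 1) (z' (i + 1))))).1 (by
            change Q.δ i _ = 0
            have e₁ := F_δ hC i (z' (i + 1))
            have e₂ := hy i (by omega)
            rw [hz' _ hi] at e₁
            rw [map_sub, map_add, map_zsmul, hz' i (by omega), eq_neg_of_add_eq_zero_right e₁,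
              eq_neg_of_add_eq_zero_right e₂, pow_succ,
              mul_neg_one, neg_smul]
            abel)
        refine ⟨w, fun _ => ?_⟩
        change _ + _ + E.mulRight (Q.B (i + 1)) w = _
        rw [hw]
        change (-1 : ℤ) ^ (i + 1) • z' i + Q.F f C (i + 1) (z' (i + 1)) + _ = _
        abel
    · exact ⟨0, fun h => absurd h hi⟩
  choose w hw using H'
  exact ⟨z, fun i => match i with | 0 => 0 | i + 1 => w i, fun i hi => ⟨hz' i hi, hw i hi⟩⟩

lemma exists_hatδ_eq (hC : Q.IsCorrection f C) (m : ℕ) (x : Q.HatX f m)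
    (h₀ : Q.δ₀ (x ⟨0, by omega⟩).m₀ = 0)
    (hx : ∀ i (hi : i < m), Q.δ i (x ⟨i + 1, by omega⟩).m₀ = 0)
    (hy : ∀ i (hi : i < m), (-1 : ℤ) ^ i • (x ⟨i, by omega⟩).m₀ +
      Q.F f C i (x ⟨i + 1, by omega⟩).m₀ + Q.δ i (x ⟨i + 1, by omega⟩).m₁ = 0) :
    ∃ z, Q.hatδ f C m z = x := by
  let x₀ (i : ℕ) : Q.X i := if h : i < m + 1 then (x ⟨i, h⟩).m₀ else 0
  let x₁ (i : ℕ) : Q.X i := if h : i < m + 1 then (x ⟨i, h⟩).m₁ else 0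
  have e₀ (i : ℕ) (h : i < m + 1) : x₀ i = (x ⟨i, h⟩).m₀ := dif_pos h
  have e₁ (i : ℕ) (h : i < m + 1) : x₁ i = (x ⟨i, h⟩).m₁ := dif_pos h
  obtain ⟨z, w, hzw⟩ := exists_preimage hC m x₀ x₁ (by rw [e₀]; exact h₀)
    (fun i hi => by rw [e₀ _ (by omega)]; exact hx i hi)
    (fun i hi => by rw [e₀ _ (by omega), e₀ _ (by omega), e₁ _ (by omega)]; exact hy i hi)
  refine ⟨fun i => ⟨z i, w i⟩, funext fun i => DefTuple.Carrier.ext ?_ ?_⟩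
  · rw [hatδ_m₀]
    exact (hzw i i.2).1.trans (e₀ _ _)
  · rw [hatδ_m₁]
    exact (hzw i i.2).2.trans (e₁ _ _)

lemma hatδ_hatδ (hC : Q.IsCorrection f C) (m : ℕ) (x : Q.HatX f (m + 2)) :
    Q.hatδ f C m (Q.hatδ f C (m + 1) x) = 0 := by
  funext i
  refine DefTuple.Carrier.ext (Q.δ_δ i _) ?_
  rw [hatδ_m₁]
  simp only [hatδ_m₁, hatδ_m₀, map_add, δ_δ, map_zsmul, add_zero]
  rw [pow_succ, mul_neg_one, neg_smul]
  change _ = (0 : Q.X i)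
  have := F_δ hC i (x ⟨i + 2, by omega⟩).m₀
  rw [← this]
  abel

variable [Module k M] [IsScalarTower k A M]

variable (Q f) in
/-- The augmentation `δ̂₀` as a linear map. -/
def hatδ₀Lin : Q.HatX f 0 →ₗ[Deformation f] (embed f M).Carrier :=
  hatHom (k := k) Q f 0 0 Q.δ₀

/-- The modules `⨁ Q̂_i` form a projective resolution over the deformation. -/
noncomputable def hatModel (hC : Q.IsCorrection f C) (hα : ∀ x, Q.δ₀ (Q.α f C 0 x) = 0) :
    ResolutionModel (Deformation f) (embed f M).Carrier (Q.HatX f) (Q.hatδ f C) (Q.hatδ₀ f) := by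
  have hF (x) : Q.δ₀ (Q.F f C 0 x) = 0 := by rw [← neg_one_pow_smul_α]; simpa using hα x
  refine ResolutionModel.ofExact (fun i => Q.hatδLin f C i) (hatδ₀Lin Q f) (fun x => ⟨fun hx => ?_, ?_⟩)
    (fun m x => ⟨fun hx => ?_, ?_⟩) ?_
  · exact exists_hatδ_eq hC 0 x (congrArg DefTuple.Carrier.m₁ hx) (fun i hi => absurd hi (by omega))
      (fun i hi => absurd hi (by omega))
  · rintro ⟨z, rfl⟩
    refine DefTuple.Carrier.ext rfl ?_
    exact Q.δ₀_δ _
  · have h₀ (i) (hi : i < m + 1) : Q.δ i (x ⟨i + 1, by omega⟩).m₀ = 0 :=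
      congrArg DefTuple.Carrier.m₀ (congrFun hx ⟨i, hi⟩)
    have h₁ (i) (hi : i < m + 1) : (-1 : ℤ) ^ i • (x ⟨i, by omega⟩).m₀ +
        Q.F f C i (x ⟨i + 1, by omega⟩).m₀ + Q.δ i (x ⟨i + 1, by omega⟩).m₁ = 0 :=
      (Q.hatδ_m₁ f C m x ⟨i, hi⟩).symm.trans
        (congrArg DefTuple.Carrier.m₁ (congrFun hx ⟨i, hi⟩))
    refine exists_hatδ_eq hC (m + 1) x ?_ h₀ h₁
    -- In positive degrees δ₀x_0 = 0 is not given. It comes from row 0, x_0 + F x_1 + δ y_1 = 0,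
    -- because δ₀F = 0.
    have := congrArg Q.δ₀ (h₁ 0 (by omega))
    rw [map_add, map_add, hF, δ₀_δ, add_zero, add_zero, map_zero, pow_zero, one_smul] at this
    exact this
  · rintro ⟨z, rfl⟩
    exact hatδ_hatδ hC m z
  · rintro ⟨⟨⟩, y⟩
    obtain ⟨x, rfl⟩ := Q.surjective y
    exact ⟨fun i => ⟨i.1.rec x fun _ _ => 0, 0⟩, rfl⟩

/-- The minimal resolution. -/
noncomputable def model (Q : MinimalResolution E M) :
    ResolutionModel A M Q.X (fun i => Q.δ i) Q.δ₀ :=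
  ResolutionModel.ofExact Q.δ Q.δ₀ Q.exact_zero Q.exact_succ Q.surjective

end MinimalResolution

end InfDef

/-! ### Morphisms from hats to A-modules. -/

namespace InfDef

open CategoryTheory CategoryTheory.Abelian

variable {k : Type u} {A : Type u} [Field k] [Ring A] [Algebra k A] {n : ℕ}

namespace MinimalResolution

open BasicDecomposition

section Homs

variable {E : BasicDecomposition A n} {M : Type u} [AddCommGroup M] [Module A M]
  (Q : MinimalResolution E M) (f : HochschildCocycle k A)
  {N : Type u} [AddCommGroup N] [Module A N] [Module k N] [IsScalarTower k A N]

/-- The morphism `⨁_{j ≤ p} Q̂_j → N` which is `g : Q_j → N` on the summand `Q̂_j` and zero on the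
other summands. -/
def hatComp (p j : ℕ) (hj : j < p + 1) (g : Q.X j →ₗ[A] N) :
    Q.HatX f p →ₗ[Deformation f] (embed f N).Carrier where
  toFun x := ⟨0, g (x ⟨j, hj⟩).m₀⟩
  map_add' x y := DefTuple.Carrier.ext rfl (map_add g _ _)
  map_smul' a x := by
    refine DefTuple.Carrier.ext rfl ?_
    change g (a.c₀ • (x ⟨j, hj⟩).m₀) = a.c₀ • g (x ⟨j, hj⟩).m₀ + 0 + a.c₁ • 0
    rw [map_smul, smul_zero, add_zero, add_zero]

lemma hatComp_apply (p j : ℕ) (hj : j < p + 1) (g : Q.X j →ₗ[A] N) (x : Q.HatX f p) :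
    Q.hatComp f p j hj g x = ⟨0, g (x ⟨j, hj⟩).m₀⟩ := rfl

/-- The element (0, y) is t(y, 0), and t acts by zero on N. -/
lemma hom_m₁_eq_zero {f : HochschildCocycle k A} {r : ℕ} {σ : Fin r → Fin n}
    (h : (E.hat f σ).Carrier →ₗ[Deformation f] (embed f N).Carrier) (y : E.Proj σ) :
    h ⟨0, y⟩ = 0 := by
  have : (⟨0, y⟩ : (E.hat f σ).Carrier) = (⟨0, 1⟩ : Deformation f) • ⟨y, 0⟩ := by
    refine DefTuple.Carrier.ext (zero_smul A y).symm ?_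
    rw [hat_smul_m₁]
    simp
  rw [this, map_smul]
  refine DefTuple.Carrier.ext rfl ?_
  change (0 : A) • (h ⟨y, 0⟩).m₁ + 0 + (1 : A) • (0 : N) = 0
  simp

/-- The component in `Hom_A(Q, N)` of a morphism `Q̂ → N`. -/
def homComp {f : HochschildCocycle k A} {r : ℕ} {σ : Fin r → Fin n}
    (h : (E.hat f σ).Carrier →ₗ[Deformation f] (embed f N).Carrier) : E.Proj σ →ₗ[A] N where
  toFun x := (h ⟨x, 0⟩).m₁
  map_add' x y := by
    have : (⟨x + y, 0⟩ : (E.hat f σ).Carrier) = ⟨x, 0⟩ + ⟨y, 0⟩ :=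
      DefTuple.Carrier.ext rfl (add_zero _).symm
    rw [this, map_add]
    rfl
  map_smul' a x := by
    -- The embedding x ↦ (x, 0) is A-linear only up to second components, which any morphism to N
    -- kills.
    have : (⟨a • x, 0⟩ : (E.hat f σ).Carrier) + ⟨0, E.fProj f σ a x⟩ =
        (⟨a, 0⟩ : Deformation f) • ⟨x, 0⟩ := by
      refine DefTuple.Carrier.ext (add_zero _) ?_
      rw [hat_smul_m₁]
      simp
    have h' := congrArg h this
    rw [map_add, hom_m₁_eq_zero, add_zero, map_smul] at h'
    rw [h']
    change a • (h ⟨x, 0⟩).m₁ + 0 + (0 : A) • (0 : N) = _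
    simp

lemma homComp_apply {f : HochschildCocycle k A} {r : ℕ} {σ : Fin r → Fin n}
    (h : (E.hat f σ).Carrier →ₗ[Deformation f] (embed f N).Carrier) (x : (E.hat f σ).Carrier) :
    h x = ⟨0, homComp h x.m₀⟩ := by
  have : x = ⟨x.m₀, 0⟩ + ⟨0, x.m₁⟩ :=
    DefTuple.Carrier.ext (add_zero _).symm (zero_add _).symm
  conv_lhs => rw [this, map_add, hom_m₁_eq_zero, add_zero]
  rfl

lemma exists_eq_sum_hatComp (p : ℕ) (h : Q.HatX f p →ₗ[Deformation f] (embed f N).Carrier) :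
    ∃ g : ∀ j : Fin (p + 1), Q.X j →ₗ[A] N, h = ∑ j : Fin (p + 1), Q.hatComp f p j j.2 (g j) := by
  refine ⟨fun j => homComp (h ∘ₗ LinearMap.single (Deformation f)
    (fun i : Fin (p + 1) => (E.hat f (Q.idx i)).Carrier) j), LinearMap.pi_ext' fun j => ?_⟩
  refine LinearMap.ext fun x => ?_
  rw [homComp_apply, LinearMap.comp_apply, LinearMap.sum_apply, Finset.sum_eq_single j]
  · rw [hatComp_apply]
    refine DefTuple.Carrier.ext rfl ?_
    change _ = homComp _ (Pi.single (M := fun i : Fin (p + 1) => (E.hat f (Q.idx i)).Carrier)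
      j x j).m₀
    rw [Pi.single_eq_same]
  · intro i _ hi
    refine DefTuple.Carrier.ext rfl ?_
    change homComp _ (Pi.single (M := fun i : Fin (p + 1) => (E.hat f (Q.idx i)).Carrier)
      j x i).m₀ = 0
    rw [Pi.single_eq_of_ne hi]
    exact map_zero _
  · simp

lemma sum_hatComp_injective (p : ℕ) (g : ∀ j : Fin (p + 1), Q.X j →ₗ[A] N)
    (hg : ∑ j : Fin (p + 1), Q.hatComp f p j j.2 (g j) = 0) : g = 0 := by
  funext j
  refine LinearMap.ext fun x => ?_
  have h := LinearMap.congr_fun hg (Pi.single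
    (M := fun i : Fin (p + 1) => (E.hat f (Q.idx i)).Carrier) j ⟨x, 0⟩)
  rw [LinearMap.sum_apply, Finset.sum_eq_single j, hatComp_apply] at h
  · have := congrArg DefTuple.Carrier.m₁ h
    change g j (Pi.single (M := fun i : Fin (p + 1) => (E.hat f (Q.idx i)).Carrier)
      j ⟨x, 0⟩ j).m₀ = 0 at this
    rwa [Pi.single_eq_same] at this
  · intro i _ hi
    refine DefTuple.Carrier.ext rfl ?_
    change g i (Pi.single (M := fun i : Fin (p + 1) => (E.hat f (Q.idx i)).Carrier)
      j ⟨x, 0⟩ i).m₀ = 0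
    rw [Pi.single_eq_of_ne hi]
    exact map_zero _
  · simp

end Homs

/-! ### Liftings of cocycles deformed to A_f. -/

section Lifting

variable {E : BasicDecomposition A n} {Q : MinimalResolution E E.SimpleSum}
  {f : HochschildCocycle k A} {C : ∀ i, E.Corner (Q.idx (i + 1)) (Q.idx i)}

lemma hom_δ (i : ℕ) (g : Q.X i →ₗ[A] E.SimpleSum) (x : Q.X (i + 1)) : g (Q.δ i x) = 0 :=
  E.hom_eq_zero_of_mem_jacobson g (Q.minimal i ⟨x, rfl⟩)

lemma hom_F (hα : ∀ i x, Q.α f C i x ∈ Module.jacobson A (Q.X i)) (i : ℕ)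
    (g : Q.X i →ₗ[A] E.SimpleSum) (x : Q.X (i + 1)) : g (Q.F f C i x) = 0 := by
  rw [← neg_one_pow_smul_α, map_zsmul, E.hom_eq_zero_of_mem_jacobson g (hα i x), smul_zero]

/-- A morphism to S sees only first components, where the differential is δ, with image in the
radical. -/
lemma hom_hatδ (p : ℕ) (h : Q.HatX f p →ₗ[Deformation f] (embed f E.SimpleSum).Carrier)
    (x : Q.HatX f (p + 1)) : h (Q.hatδ f C p x) = 0 := by
  obtain ⟨g, rfl⟩ := Q.exists_eq_sum_hatComp f p h
  rw [LinearMap.sum_apply]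
  refine Finset.sum_eq_zero fun j _ => DefTuple.Carrier.ext rfl ?_
  exact hom_δ _ _ _

/-! ### Twisted maps -/

/-- The pair `(γ, V)` defines a morphism over the deformation, when the sources and the targets
are deformed by `φ` and `ψ`. -/
structure IsTwisted {P Q : Type*} [AddCommGroup P] [Module A P] [AddCommGroup Q] [Module A Q]
    (φ : A → P → P) (ψ : A → Q → Q) (γ : P →ₗ[A] Q) (V : P → Q) : Prop where
  add : ∀ x y, V (x + y) = V x + V y
  smul : ∀ a x, V (a • x) = a • V x + ψ a (γ x) - γ (φ a x)

namespace IsTwisted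

variable {P Q R : Type*} [AddCommGroup P] [Module A P] [AddCommGroup Q] [Module A Q]
  [AddCommGroup R] [Module A R] {φ : A → P → P} {ψ : A → Q → Q} {χ : A → R → R}
  {γ : P →ₗ[A] Q} {γ' : Q →ₗ[A] R} {V W : P → Q} {V' : Q → R}

lemma zero (hV : IsTwisted φ ψ γ V) : V 0 = 0 := by
  have := hV.add 0 0
  rwa [add_zero, right_eq_add] at this

lemma comp (hV : IsTwisted φ ψ γ V) (hV' : IsTwisted ψ χ γ' V') :
    IsTwisted φ χ (γ' ∘ₗ γ) fun x => V' (γ x) + γ' (V x) where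
  add x y := by
    rw [map_add, hV.add, hV'.add, map_add]
    abel
  smul a x := by
    rw [map_smul, hV.smul, hV'.smul, map_sub, map_add, map_smul, smul_add]
    change _ = _ + χ a (γ' (γ x)) - γ' (γ (φ a x))
    abel

/-- The failure of linearity depends only on γ, so it cancels in the difference. -/
lemma exists_eq_sub (hV : IsTwisted φ ψ γ V) (hW : IsTwisted φ ψ γ W) :
    ∃ D : P →ₗ[A] Q, ∀ x, D x = V x - W x :=
  ⟨{ toFun := fun x => V x - W x
     map_add' := fun x y => by rw [hV.add, hW.add]; abel
     map_smul' := fun a x => by rw [hV.smul, hW.smul, RingHom.id_apply, smul_sub]; abel },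
    fun _ => rfl⟩

lemma sub_linear (hV : IsTwisted φ ψ γ V) (D : P →ₗ[A] Q) :
    IsTwisted φ ψ γ fun x => V x - D x where
  add x y := by
    rw [hV.add, map_add]
    abel
  smul a x := by
    rw [hV.smul, map_smul, smul_sub]
    abel

/-- W is the commutator of V with F and δ; the anticommutation of F with δ and γδ = δγ make all
terms of Wδ + δW cancel. This is the compatibility required by `exists_homotopy`. -/
lemma obstruction_cocycle {P₀ P₁ P₂ Q₀ Q₁ Q₂ : Type*} [AddCommGroup P₀] [Module A P₀]
    [AddCommGroup P₁] [Module A P₁] [AddCommGroup P₂] [Module A P₂] [AddCommGroup Q₀]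
    [Module A Q₀] [AddCommGroup Q₁] [Module A Q₁] [AddCommGroup Q₂] [Module A Q₂]
    {d₀ : P₁ →ₗ[A] P₀} {d₁ : P₂ →ₗ[A] P₁} {d₀' : Q₁ →ₗ[A] Q₀} {d₁' : Q₂ →ₗ[A] Q₁}
    {γ₀ : P₀ →ₗ[A] Q₀} {γ₁ : P₁ →ₗ[A] Q₁} {γ₂ : P₂ →ₗ[A] Q₂}
    (F₀ : P₁ → P₀) (F₁ : P₂ → P₁) (F₀' : Q₁ → Q₀) (F₁' : Q₂ → Q₁)
    (V₀ : P₀ → Q₀) (V₁ : P₁ → Q₁) (V₂ : P₂ → Q₂) (hV₀ : V₀ 0 = 0)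
    (h₀ : ∀ x, d₀' (γ₁ x) = γ₀ (d₀ x)) (h₁ : ∀ x, d₁' (γ₂ x) = γ₁ (d₁ x))
    (hd : ∀ x, d₀ (d₁ x) = 0) (hd' : ∀ x, d₀' (d₁' x) = 0)
    (hF : ∀ x, F₀ (d₁ x) + d₀ (F₁ x) = 0) (hF' : ∀ x, F₀' (d₁' x) + d₀' (F₁' x) = 0)
    (W₀ : P₁ → Q₀) (hW₀ : ∀ x, W₀ x = V₀ (d₀ x) + γ₀ (F₀ x) - (F₀' (γ₁ x) + d₀' (V₁ x)))
    (W₁ : P₂ → Q₁) (hW₁ : ∀ x, W₁ x = V₁ (d₁ x) + γ₁ (F₁ x) - (F₁' (γ₂ x) + d₁' (V₂ x)))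
    (x : P₂) : W₀ (d₁ x) + d₀' (W₁ x) = 0 := by
  rw [hW₀, hW₁, hd, hV₀, map_sub, map_add, map_add, hd', h₀, ← h₁, eq_neg_of_add_eq_zero_left (hF x),
    eq_neg_of_add_eq_zero_left (hF' (γ₂ x)), map_neg]
  abel

end IsTwisted

variable (Q f C) in
lemma isTwisted_F (i : ℕ) : IsTwisted (fun a x => E.fProj f (Q.idx (i + 1)) a x)
    (fun a x => E.fProj f (Q.idx i) a x) (Q.δ i) (Q.F f C i) where
  add := Q.F_add f C i
  smul := Q.F_smul f C i

/-- The morphism over the deformation defined by a twisted map. -/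
def hatMap {r s : ℕ} {σ : Fin r → Fin n} {τ : Fin s → Fin n} {γ : E.Proj σ →ₗ[A] E.Proj τ}
    {V : E.Proj σ → E.Proj τ}
    (hV : IsTwisted (fun a x => E.fProj f σ a x) (fun a x => E.fProj f τ a x) γ V) :
    (E.hat f σ).Carrier →ₗ[Deformation f] (E.hat f τ).Carrier where
  toFun x := ⟨γ x.m₀, γ x.m₁ + V x.m₀⟩
  map_add' x y := by
    refine DefTuple.Carrier.ext (map_add _ _ _) ?_
    change γ (x.m₁ + y.m₁) + V (x.m₀ + y.m₀) = γ x.m₁ + V x.m₀ + (γ y.m₁ + V y.m₀)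
    rw [map_add, hV.add]
    abel
  map_smul' a x := by
    refine DefTuple.Carrier.ext (map_smul _ _ _) ?_
    change γ (a.c₀ • x.m₁ + E.fProj f _ a.c₀ x.m₀ + a.c₁ • x.m₀) + V (a.c₀ • x.m₀) =
      a.c₀ • (γ x.m₁ + V x.m₀) + E.fProj f _ a.c₀ (γ x.m₀) + a.c₁ • γ x.m₀
    rw [map_add, map_add, hV.smul, map_smul, map_smul, smul_add]
    abel

/-- A lifting of a cocycle `g : Q_s → S` to the minimal resolution over `A`, together with the
additional maps that define a lifting over the deformation. -/
structure DeformedLifting (Q : MinimalResolution E E.SimpleSum) (f : HochschildCocycle k A)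
    (C : ∀ i, E.Corner (Q.idx (i + 1)) (Q.idx i)) {s : ℕ} (g : Q.X s →ₗ[A] E.SimpleSum) where
  /-- the lifting over `A` -/
  γ : ∀ j, Q.X (s + j) →ₗ[A] Q.X j
  δ_γ : ∀ j (x : Q.X (s + j + 1)), Q.δ j (γ (j + 1) x) = γ j (Q.δ (s + j) x)
  δ₀_γ : ∀ x, Q.δ₀ (γ 0 x) = g x
  /-- the off-diagonal part of the lifting over the deformation -/
  U : ∀ j, Q.X (s + j) → Q.X j
  isTwisted_U : ∀ j, IsTwisted (fun a x => E.fProj f (Q.idx (s + j)) a x)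
    (fun a x => E.fProj f (Q.idx j) a x) (γ j) (U j)
  U_δ : ∀ j (x : Q.X (s + j + 1)), U j (Q.δ (s + j) x) + γ j (Q.F f C (s + j) x) =
    Q.F f C j (γ (j + 1) x) + Q.δ j (U (j + 1) x)

/-- Applying f to the matrices of γ gives a twisted map V. Its defect W is A-linear and anticommutes
with δ, so V - D commutes once D solves δD = Dδ - W; with D_0 = 0 this needs δ₀W_0 = 0. -/
lemma exists_deformedLifting [IsAlgClosed k] [FiniteDimensional k A] (hC : Q.IsCorrection f C)
    (hα : ∀ i x, Q.α f C i x ∈ Module.jacobson A (Q.X i)) {s : ℕ}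
    (g : Q.X s →ₗ[A] E.SimpleSum) : Nonempty (DeformedLifting Q f C g) := by
  -- An arbitrary lift in degree zero would not do: the scalar entries are needed for δ₀ V_0 δ = 0
  -- below.
  obtain ⟨G₀, c, hc, hG₀⟩ := E.exists_scalar_lift (k := k) Q.δ₀ Q.surjective g
  obtain ⟨γ, hγ₀, hγ⟩ := exists_homotopy (P := fun j => Q.X (s + j)) (Q := Q.X)
    (fun j => Q.δ (s + j)) Q.δ (fun j => Q.δ_δ (s + j)) Q.exact_succ (fun _ => 0) (fun _ _ => by simp)
    (E.mulRight G₀) (fun x => (Q.exact_zero _).1 (by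
      rw [LinearMap.zero_apply, sub_zero]
      exact (hG₀ _).trans (hom_δ s g x)))
  simp only [LinearMap.zero_apply, sub_zero] at hγ
  choose G hG using fun j => E.exists_mulRight_eq (γ j)
  have hGG : G 0 = G₀ := E.mulRight_injective ((hG 0).trans hγ₀)
  let V (j : ℕ) (x : Q.X (s + j)) : Q.X j := E.fRight f (G j) x
  have hV (j : ℕ) : IsTwisted (fun a x => E.fProj f (Q.idx (s + j)) a x)
      (fun a x => E.fProj f (Q.idx j) a x) (γ j) (V j) :=
    ⟨E.fRight_add f (G j), fun a x => by rw [← hG]; exact E.fRight_smul f (G j) a x⟩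
  have hW (j : ℕ) : ∃ W : Q.X (s + j + 1) →ₗ[A] Q.X j, ∀ x, W x =
      V j (Q.δ (s + j) x) + γ j (Q.F f C (s + j) x) -
        (Q.F f C j (γ (j + 1) x) + Q.δ j (V (j + 1) x)) := by
    have h₁ := (isTwisted_F Q f C (s + j)).comp (hV j)
    have h₂ := (hV (j + 1)).comp (isTwisted_F Q f C j)
    have h₃ : Q.δ j ∘ₗ γ (j + 1) = γ j ∘ₗ Q.δ (s + j) := LinearMap.ext (hγ j)
    -- Both composites are now twisted over the same A-linear map, so their difference is A-linear.
    rw [h₃] at h₂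
    exact h₁.exists_eq_sub h₂
  choose W hW using hW
  obtain ⟨D, hD₀, hD⟩ := exists_homotopy (P := fun j => Q.X (s + j)) (Q := Q.X)
    (fun j => Q.δ (s + j)) Q.δ (fun j => Q.δ_δ (s + j)) Q.exact_succ W
    (fun j => IsTwisted.obstruction_cocycle (Q.F f C (s + j)) (Q.F f C (s + j + 1)) (Q.F f C j)
      (Q.F f C (j + 1)) (V j) (V (j + 1)) (V (j + 2)) (hV j).zero (hγ j) (hγ (j + 1))
      (Q.δ_δ (s + j)) (Q.δ_δ j) (F_δ hC (s + j)) (F_δ hC j) (W j) (hW j) (W (j + 1)) (hW (j + 1)))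
    0 (fun x => (Q.exact_zero _).1 (by
      rw [LinearMap.zero_apply, zero_sub, map_neg, neg_eq_zero, hW, map_sub, map_add, map_add,
        δ₀_δ, hom_F hα, add_zero (0 : E.SimpleSum), sub_zero]
      -- Of the four terms of δ₀W_0, two are already gone, by δ₀F = 0 and δ₀δ = 0. This one is gF,
      -- zero since F has image in the radical; the other, `e₂`, uses minimality and the scalar
      -- matrix.
      have e₁ : Q.δ₀ (γ 0 (Q.F f C s x)) = 0 := by
        rw [hγ₀]
        exact (hG₀ _).trans (hom_F hα s g x)
      have e₂ : Q.δ₀ (V 0 (Q.δ s x)) = 0 := by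
        refine E.hom_eq_zero_of_forall_mem _ fun l => ?_
        change (E.fRight f (G 0) _ l : A) ∈ _
        rw [hGG]
        exact E.fRight_mem_jacobson f hc
          (E.mem_jacobson_of_mem_jacobson_proj (Q.minimal s ⟨x, rfl⟩)) l
      exact (congrArg₂ (· + ·) e₂ e₁).trans (add_zero 0)))
  refine ⟨⟨γ, hγ, fun x => ?_, fun j x => V j x - D j x, fun j => (hV j).sub_linear (D j),
    fun j x => ?_⟩⟩
  · rw [hγ₀, hG₀]
  · have e₁ := hD j x
    rw [hW] at e₁
    rw [map_sub, e₁]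
    abel

namespace DeformedLifting

variable {s : ℕ} {g : Q.X s →ₗ[A] E.SimpleSum} (L : DeformedLifting Q f C g)

/-- The lifting over the deformation. -/
def hatγ (j : ℕ) : Q.HatX f (s + j) →ₗ[Deformation f] Q.HatX f j :=
  -- The summands below s are dropped. The sign is constant when i and j both increase by one, and
  -- changes by (-1)^s when only j does, matching (-1)^(s+i) on Q̂_{s+i} with (-1)^i on Q̂_i.
  LinearMap.pi fun i => (-1 : ℤ) ^ (s * (i + j)) • hatMap (L.isTwisted_U i) ∘ₗ
    LinearMap.proj (φ := fun i : Fin (s + j + 1) => (E.hat f (Q.idx i)).Carrier)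
      (⟨s + i, by omega⟩ : Fin (s + j + 1))

lemma hatγ_m₁ (j : ℕ) (x : Q.HatX f (s + j)) (i : Fin (j + 1)) :
    (L.hatγ j x i).m₁ = (-1 : ℤ) ^ (s * (i + j)) •
      (L.γ i (x ⟨s + i, by omega⟩).m₁ + L.U i (x ⟨s + i, by omega⟩).m₀) := rfl

variable (Q f C) in
lemma F_zsmul (r : ℤ) (i : ℕ) (x : Q.X (i + 1)) : Q.F f C i (r • x) = r • Q.F f C i x :=
  map_zsmul (AddMonoidHom.mk' (Q.F f C i) (Q.F_add f C i)) r x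

lemma hatδ_hatγ (j : ℕ) (x : Q.HatX f (s + j + 1)) :
    Q.hatδ f C j (L.hatγ (j + 1) x) = L.hatγ j (Q.hatδ f C (s + j) x) := by
  have hs (i : ℕ) : (-1 : ℤ) ^ (s * (i + 1 + (j + 1))) = (-1) ^ (s * (i + j)) := by
    rw [show s * (i + 1 + (j + 1)) = s * (i + j) + 2 * s by ring, pow_add, pow_mul (-1) 2]
    simp
  have hs' (i : ℕ) : (-1 : ℤ) ^ i * (-1 : ℤ) ^ (s * (i + (j + 1))) =
      (-1) ^ (s * (i + j)) * (-1) ^ (s + i) := by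
    rw [← pow_add, ← pow_add]
    congr 1
    ring
  have key (i : ℕ) (v : Q.X (s + i)) (x y : Q.X (s + i + 1)) :
      (-1 : ℤ) ^ i • (-1 : ℤ) ^ (s * (i + (j + 1))) • L.γ i v +
        Q.F f C i ((-1 : ℤ) ^ (s * (i + 1 + (j + 1))) • L.γ (i + 1) x) +
        Q.δ i ((-1 : ℤ) ^ (s * (i + 1 + (j + 1))) • (L.γ (i + 1) y + L.U (i + 1) x)) =
      (-1 : ℤ) ^ (s * (i + j)) • (L.γ i ((-1 : ℤ) ^ (s + i) • v + Q.F f C (s + i) x +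
        Q.δ (s + i) y) + L.U i (Q.δ (s + i) x)) := by
    have h₁ := L.U_δ i x
    have h₂ := L.δ_γ i y
    rw [F_zsmul, map_zsmul, hs, smul_smul, hs', mul_smul, ← smul_add, ← smul_add, map_add, map_add,
      map_add, map_zsmul, h₂, add_assoc _ (Q.F f C i _), add_left_comm (Q.F f C i _), ← h₁]
    abel_nf
  funext i
  refine DefTuple.Carrier.ext ?_ ?_
  · exact (map_zsmul (Q.δ i) _ _).trans (congrArg₂ _ (hs i) (L.δ_γ i _))
  · rw [hatδ_m₁, hatγ_m₁ L j, hatδ_m₁]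
    exact key i _ _ _

lemma hatδ₀_hatγ (x : Q.HatX f s) : Q.hatδ₀ f (L.hatγ 0 x) = Q.hatHom f s 0 g x := by
  refine DefTuple.Carrier.ext rfl ?_
  refine Eq.trans ?_ (L.δ₀_γ _)
  change Q.δ₀ ((-1 : ℤ) ^ (s * (0 + 0)) • L.γ 0 (x ⟨s, by omega⟩).m₀) = _
  rw [add_zero, mul_zero, pow_zero, one_smul]

end DeformedLifting

/-- The lifting of the class of `δ̂₀ : Q̂_0 ⊕ Q̂_1 → S`, which forgets the last summand. -/
def dropLast (Q : MinimalResolution E E.SimpleSum) (f : HochschildCocycle k A) (j : ℕ) :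
    Q.HatX f (1 + j) →ₗ[Deformation f] Q.HatX f j where
  toFun x i := x ⟨i, by omega⟩
  map_add' _ _ := rfl
  map_smul' _ _ := rfl

end Lifting

end MinimalResolution

end InfDef

/-! ### Ext groups as spaces of homomorphisms. -/

namespace InfDef

open CategoryTheory CategoryTheory.Abelian

variable {k : Type u} {A : Type u} [Field k] [Ring A] [Algebra k A] {n : ℕ}

noncomputable instance (f : HochschildCocycle k A) (M : Type u) [AddCommGroup M] [Module A M]
    [Module k M] [IsScalarTower k A M] : Module k (embed f M).Carrier :=
  Module.compHom _ (algebraMap k (Deformation f))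

instance (f : HochschildCocycle k A) (M : Type u) [AddCommGroup M] [Module A M]
    [Module k M] [IsScalarTower k A M] : IsScalarTower k (Deformation f) (embed f M).Carrier :=
  IsScalarTower.of_algebraMap_smul fun _ _ => rfl

namespace MinimalResolution

open BasicDecomposition

section

variable {E : BasicDecomposition A n} {M : Type u} [AddCommGroup M] [Module A M]
  (Q : MinimalResolution E M) (f : HochschildCocycle k A)
  {N : Type u} [AddCommGroup N] [Module A N] [Module k N] [IsScalarTower k A N]

lemma hatComp_add (p j : ℕ) (hj : j < p + 1) (g h : Q.X j →ₗ[A] N) :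
    Q.hatComp f p j hj (g + h) = Q.hatComp f p j hj g + Q.hatComp f p j hj h :=
  LinearMap.ext fun _ => DefTuple.Carrier.ext rfl rfl

lemma hatComp_smul (p j : ℕ) (hj : j < p + 1) (c : k) (g : Q.X j →ₗ[A] N) :
    Q.hatComp f p j hj (c • g) = c • Q.hatComp f p j hj g :=
  LinearMap.ext fun x => DefTuple.Carrier.ext rfl (by
    -- The unit of A_f is 1 - f(1, 1)t, and its t-part acts by zero on N.
    change c • g (x ⟨j, hj⟩).m₀ = (c • (1 : A)) • g (x ⟨j, hj⟩).m₀ + 0 + (c • -f.toFun 1 1) • (0 : N)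
    rw [smul_zero, add_zero, add_zero, smul_assoc, one_smul])

end

variable {E : BasicDecomposition A n} {Q : MinimalResolution E E.SimpleSum}
  {f : HochschildCocycle k A} {C : ∀ i, E.Corner (Q.idx (i + 1)) (Q.idx i)}
  (rA : ResolutionModel A E.SimpleSum Q.X (fun i => Q.δ i) Q.δ₀)
  (rf : ResolutionModel (Deformation f) (embed f E.SimpleSum).Carrier (Q.HatX f)
    (Q.hatδ f C) (Q.hatδ₀ f))

variable (k) in
/-- The isomorphism of `Hom_A(Q_i, S)` with `Ext^i_A(S, S)`. -/
noncomputable def clsEquiv (i : ℕ) : (Q.X i →ₗ[A] E.SimpleSum) ≃ₗ[k] Ext E.S E.S i :=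
  LinearEquiv.ofBijective
    { toFun := fun g => rA.cls i g (hom_δ i g)
      map_add' := fun g h => rA.cls_add g h (hom_δ i g) (hom_δ i h) (hom_δ i (g + h))
      map_smul' := fun c g => by rw [RingHom.id_apply, rA.cls_smul c g (hom_δ i g)] }
    ⟨(injective_iff_map_eq_zero _).2 fun g hg => rA.cls_eq_zero g (hom_δ i g) (fun j h => hom_δ j h) hg,
      fun c => (rA.cls_surjective c).imp fun _ h => h.choose_spec⟩

/-- The class of the morphism `⨁_{j ≤ p} Q̂_j → S` which is `g` on `Q̂_j`. -/
noncomputable def hatCls (p j : ℕ) (hj : j < p + 1) :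
    (Q.X j →ₗ[A] E.SimpleSum) →ₗ[k] Ext (E.Sf f) (E.Sf f) p where
  toFun g := rf.cls p (Q.hatComp f p j hj g) (hom_hatδ p _)
  map_add' g h := by
    rw [← rf.cls_add _ _ _ _ (hom_hatδ p _)]
    simp only [hatComp_add]
  map_smul' c g := by
    rw [RingHom.id_apply, ← rf.cls_smul c _ _ (hom_hatδ p _)]
    simp only [hatComp_smul]

lemma hatCls_apply (p j : ℕ) (hj : j < p + 1) (g : Q.X j →ₗ[A] E.SimpleSum) :
    hatCls rf p j hj g = rf.cls p (Q.hatComp f p j hj g) (hom_hatδ p _) := rfl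

lemma sum_hatCls (p : ℕ) (g : ∀ j : Fin (p + 1), Q.X j →ₗ[A] E.SimpleSum) :
    ∑ j : Fin (p + 1), hatCls rf p j j.2 (g j) =
      rf.cls p (∑ j : Fin (p + 1), Q.hatComp f p j j.2 (g j)) (hom_hatδ p _) := by
  let c : (Q.HatX f p →ₗ[Deformation f] (embed f E.SimpleSum).Carrier) →+
      Ext (E.Sf f) (E.Sf f) p :=
    AddMonoidHom.mk' (fun g => rf.cls p g (hom_hatδ p g)) fun g h => rf.cls_add g h _ _ _
  exact (map_sum c _ _).symm

/-- The isomorphism of `⨁_{j ≤ p} Hom_A(Q_j, S)` with `Ext^p(S, S)` over the deformation. -/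
noncomputable def hatEquiv (p : ℕ) :
    (∀ j : Fin (p + 1), Q.X j →ₗ[A] E.SimpleSum) ≃ₗ[k] Ext (E.Sf f) (E.Sf f) p :=
  LinearEquiv.ofBijective
    (∑ j : Fin (p + 1), hatCls rf p j j.2 ∘ₗ LinearMap.proj j) (by
    have H (g : ∀ j : Fin (p + 1), Q.X j →ₗ[A] E.SimpleSum) :
        (∑ j : Fin (p + 1), hatCls rf p j j.2 ∘ₗ LinearMap.proj j :
          (∀ j : Fin (p + 1), Q.X j →ₗ[A] E.SimpleSum) →ₗ[k] Ext (E.Sf f) (E.Sf f) p) g =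
        rf.cls p (∑ j : Fin (p + 1), Q.hatComp f p j j.2 (g j)) (hom_hatδ p _) := by
      rw [LinearMap.sum_apply]
      exact sum_hatCls rf p g
    refine ⟨(injective_iff_map_eq_zero _).2 fun g hg => ?_, fun c => ?_⟩
    · rw [H] at hg
      exact Q.sum_hatComp_injective f p g (rf.cls_eq_zero _ _ (fun j h => hom_hatδ j h) hg)
    · obtain ⟨h, hh, rfl⟩ := rf.cls_surjective c
      obtain ⟨g, rfl⟩ := Q.exists_eq_sum_hatComp f p h
      exact ⟨g, H g⟩)

lemma hatEquiv_apply (p : ℕ) (g : ∀ j : Fin (p + 1), Q.X j →ₗ[A] E.SimpleSum) :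
    hatEquiv rf p g = ∑ j : Fin (p + 1), hatCls rf p j j.2 (g j) :=
  LinearMap.sum_apply _ _ _

lemma hatEquiv_symm_hatCls (p : ℕ) (j : Fin (p + 1)) (g : Q.X j →ₗ[A] E.SimpleSum) :
    (hatEquiv rf p).symm (hatCls rf p j j.2 g) = Pi.single j g := by
  rw [LinearEquiv.symm_apply_eq, hatEquiv_apply, Finset.sum_eq_single j]
  · rw [Pi.single_eq_same]
  · intro i _ hi
    rw [Pi.single_eq_of_ne hi, map_zero]
  · simp

/-! ### Products of classes -/

lemma cls_yoneda_cls {s : ℕ} {g : Q.X s →ₗ[A] E.SimpleSum} (L : DeformedLifting Q f C g) (i : ℕ)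
    (h : Q.X i →ₗ[A] E.SimpleSum) :
    yoneda (rA.cls i h (hom_δ i h)) (rA.cls s g (hom_δ s g)) (add_comm i s) =
      rA.cls (s + i) (h ∘ₗ L.γ i) (hom_δ (s + i) _) :=
  ResolutionModel.cls_yoneda rA rA g _ h _ L.γ L.δ_γ L.δ₀_γ _

/-- The component i of the lifting in degree i + a carries (-1)^(s(2i+a)) = (-1)^(sa). -/
lemma hatCls_yoneda_hatCls {s : ℕ} {g : Q.X s →ₗ[A] E.SimpleSum} (L : DeformedLifting Q f C g)
    (i a : ℕ) (h : Q.X i →ₗ[A] E.SimpleSum) :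
    yoneda (hatCls rf (i + a) i (by omega) h) (hatCls rf s s (by omega) g) (add_comm _ _) =
      (-1 : k) ^ (s * a) • hatCls rf (s + (i + a)) (s + i) (by omega) (h ∘ₗ L.γ i) := by
  rw [← map_smul]
  refine (ResolutionModel.cls_yoneda rf rf _ (hom_hatδ s (Q.hatComp f s s (by omega) g)) _
    (hom_hatδ (i + a) (Q.hatComp f (i + a) i (by omega) h)) L.hatγ L.hatδ_hatγ L.hatδ₀_hatγ
    (hom_hatδ _ _)).trans ?_
  rw [hatCls_apply]
  congr 1
  refine LinearMap.ext fun x => DefTuple.Carrier.ext rfl ?_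
  change h ((-1 : ℤ) ^ (s * (i + (i + a))) • L.γ i _) = (-1 : k) ^ (s * a) • h (L.γ i _)
  rw [map_zsmul, show s * (i + (i + a)) = 2 * (s * i) + s * a by ring, pow_add, pow_mul]
  rcases Nat.even_or_odd (s * a) with o | o <;> simp [o.neg_one_pow]

/-- The rows of the differential have the same formula in every degree, so forgetting the last
summand commutes with it strictly. Composing with h leaves h on Q̂_j, one degree higher. -/
lemma hatCls_yoneda_polyGen (m j : ℕ) (hj : j < m + 1) (h : Q.X j →ₗ[A] E.SimpleSum) :
    yoneda (hatCls rf m j hj h) (hatCls rf 1 0 (by omega) Q.δ₀) (add_comm m 1) =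
      hatCls rf (1 + m) j (by omega) h :=
  ResolutionModel.cls_yoneda rf rf _ (hom_hatδ 1 (Q.hatComp f 1 0 (by omega) Q.δ₀)) _
    (hom_hatδ m (Q.hatComp f m j hj h)) (dropLast Q f) (fun _ _ => rfl) (fun _ => rfl)
    (hom_hatδ _ _)

end MinimalResolution

end InfDef

/-! ### The isomorphism of graded algebras. -/

namespace InfDef

open CategoryTheory CategoryTheory.Abelian

section

variable {C : Type v} [Category.{u} C] [Abelian C] [HasExt.{w} C] {X : C}

lemma of_yoneda {m n p : ℕ} (h : Ext X X m) (g : Ext X X n) (hp : m + n = p) :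
    DirectSum.of (ExtPiece X) p (yoneda h g hp) =
      DirectSum.of (ExtPiece X) m h * DirectSum.of (ExtPiece X) n g := by
  subst hp
  exact (DirectSum.of_mul_of (A := ExtPiece X) h g).symm

variable (k : Type u) [CommRing k] [Linear k C]

/-- The map `c ↦ c ⊗ x^a` is linear. -/
noncomputable def tensorXLin (X : C) (i a : ℕ) : Ext X X i →ₗ[k]
    GradedTensorProduct k (extGrading k X) (polyGrading k) :=
  (GradedTensorProduct.of k (extGrading k X) (polyGrading k)).toLinearMap ∘ₗ
    (TensorProduct.mk k (ExtAlgebra X) (Polynomial k)).flip (Polynomial.X ^ a) ∘ₗ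
      DirectSum.lof k ℕ (ExtPiece X) i

lemma span_tensorX (x : GradedTensorProduct k (extGrading k X) (polyGrading k)) :
    x ∈ Submodule.span k {y | ∃ (i a : ℕ) (c : Ext X X i), tensorX k c a = y} := by
  suffices H : ∀ (y : ExtAlgebra X) (b : Polynomial k),
      GradedTensorProduct.tmul k (𝒜 := extGrading k X) (ℬ := polyGrading k) y b ∈
        Submodule.span k {y | ∃ (i a : ℕ) (c : Ext X X i), tensorX k c a = y} by
    obtain ⟨z, rfl⟩ := (GradedTensorProduct.of k (extGrading k X) (polyGrading k)).surjective x
    induction z using TensorProduct.induction_on with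
    | zero => rw [map_zero]; exact zero_mem _
    | tmul y b => exact H y b
    | add y z hy hz => rw [map_add]; exact add_mem hy hz
  intro y b
  induction y using DirectSum.induction_on with
  | zero => rw [GradedTensorProduct.tmul, TensorProduct.zero_tmul, map_zero]; exact zero_mem _
  | add y z hy hz =>
    rw [GradedTensorProduct.tmul, TensorProduct.add_tmul, map_add]
    exact add_mem hy hz
  | of i c =>
    induction b using Polynomial.induction_on' with
    | add p q hp hq =>
      rw [GradedTensorProduct.tmul, TensorProduct.tmul_add, map_add]
      exact add_mem hp hq
    | monomial a r =>
      rw [← Polynomial.C_mul_X_pow_eq_monomial, ← Polynomial.smul_eq_C_mul,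
        GradedTensorProduct.tmul, TensorProduct.tmul_smul, map_smul]
      exact Submodule.smul_mem _ _ (Submodule.subset_span ⟨i, a, c, rfl⟩)

lemma neg_one_uzpow_smul {M : Type*} [AddCommGroup M] (m : ℕ) (x : M) :
    ((-1 : ℤˣ) ^ m) • x = (-1 : ℤ) ^ m • x := by
  rw [Units.smul_def]
  simp

lemma neg_one_zpow_smul {M : Type*} [AddCommGroup M] [Module k M] (m : ℕ) (x : M) :
    (-1 : ℤ) ^ m • x = (-1 : k) ^ m • x := by
  rcases Nat.even_or_odd m with o | o <;> simp [o.neg_one_pow]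

/-- The Koszul sign for moving x^a past d. -/
lemma tensorX_mul_tensorX {i s p : ℕ} (c : Ext X X i) (a : ℕ) (d : Ext X X s) (b : ℕ)
    (hp : i + s = p) :
    tensorX k c a * tensorX k d b = (-1 : k) ^ (a * s) • tensorX k (yoneda c d hp) (a + b) := by
  have h := GradedTensorProduct.tmul_coe_mul_coe_tmul (R := k) (extGrading k X) (polyGrading k)
    (DirectSum.of (ExtPiece X) i c)
    (⟨Polynomial.X ^ a, 1, Polynomial.monomial_one_right_eq_X_pow a⟩ : polyGrading k a)
    (⟨DirectSum.of (ExtPiece X) s d, d, rfl⟩ : extGrading k X s) (Polynomial.X ^ b)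
  refine h.trans ?_
  rw [tensorX, of_yoneda, pow_add]
  exact (neg_one_uzpow_smul _ _).trans (neg_one_zpow_smul k _ _)

end

namespace MinimalResolution

open BasicDecomposition

variable {k : Type u} {A : Type u} [Field k] [Ring A] [Algebra k A] {n : ℕ}
  {E : BasicDecomposition A n} {Q : MinimalResolution E E.SimpleSum}
  {f : HochschildCocycle k A} {C : ∀ i, E.Corner (Q.idx (i + 1)) (Q.idx i)}
  (rA : ResolutionModel A E.SimpleSum Q.X (fun i => Q.δ i) Q.δ₀)
  (rf : ResolutionModel (Deformation f) (embed f E.SimpleSum).Carrier (Q.HatX f)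
    (Q.hatδ f C) (Q.hatδ₀ f))

/-- The class of the morphism `⨁_{j ≤ p} Q̂_j → S` which is `g` on `Q̂_j`, as an element of the
Yoneda algebra. -/
noncomputable def hatOf (p j : ℕ) (hj : j < p + 1) (g : Q.X j →ₗ[A] E.SimpleSum) :
    ExtAlgebra (E.Sf f) :=
  DirectSum.of (ExtPiece (E.Sf f)) p (hatCls rf p j hj g)

lemma hatOf_congr {p p' j : ℕ} (hp : p = p') (hj : j < p + 1) (hj' : j < p' + 1)
    (g : Q.X j →ₗ[A] E.SimpleSum) : hatOf rf p j hj g = hatOf rf p' j hj' g := by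
  subst hp
  rfl

/-- The class of `δ̂₀ : Q̂_0 ⊕ Q̂_1 → S`, which is the image of the variable. -/
noncomputable def hatVar : ExtAlgebra (E.Sf f) := hatOf rf 1 0 (by omega) Q.δ₀

lemma hatOf_mul_hatVar (m j : ℕ) (hj : j < m + 1) (g : Q.X j →ₗ[A] E.SimpleSum) :
    hatOf rf m j hj g * hatVar rf = hatOf rf (m + 1) j (by omega) g := by
  rw [hatOf, hatVar, hatOf, ← of_yoneda _ _ (add_comm m 1), hatCls_yoneda_polyGen]
  exact hatOf_congr rf (add_comm 1 m) _ _ g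

lemma hatOf_mul_hatVar_pow (i a : ℕ) (g : Q.X i →ₗ[A] E.SimpleSum) :
    hatOf rf i i (by omega) g * hatVar rf ^ a = hatOf rf (i + a) i (by omega) g := by
  induction a with
  | zero => rw [pow_zero, mul_one]; rfl
  | succ a ih => rw [pow_succ, ← mul_assoc, ih, hatOf_mul_hatVar]; rfl

lemma hatOf_mul_hatOf {s : ℕ} {g : Q.X s →ₗ[A] E.SimpleSum} (L : DeformedLifting Q f C g)
    (i a : ℕ) (h : Q.X i →ₗ[A] E.SimpleSum) :
    hatOf rf (i + a) i (by omega) h * hatOf rf s s (by omega) g =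
      (-1 : k) ^ (s * a) • hatOf rf (s + (i + a)) (s + i) (by omega) (h ∘ₗ L.γ i) := by
  rw [hatOf, hatOf, ← of_yoneda _ _ (add_comm (i + a) s), hatCls_yoneda_hatCls rf L]
  exact map_smul (DirectSum.lof k ℕ (ExtPiece (E.Sf f)) _) _ _

/-- The variable is δ₀ on Q̂_0 in degree 0 + 1, and δ₀γ_0 = g; the sign is the case a = 1 of
`hatOf_mul_hatOf`. -/
lemma hatVar_mul_hatOf {s : ℕ} {g : Q.X s →ₗ[A] E.SimpleSum} (L : DeformedLifting Q f C g) :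
    hatVar rf * hatOf rf s s (by omega) g =
      (-1 : ℤ) ^ s • (hatOf rf s s (by omega) g * hatVar rf) := by
  have h := hatOf_mul_hatOf rf L 0 1 Q.δ₀
  have hg : Q.δ₀ ∘ₗ L.γ 0 = g := LinearMap.ext L.δ₀_γ
  rw [hg] at h
  rw [hatOf_mul_hatVar, neg_one_zpow_smul k]
  refine Eq.trans h ?_
  rw [mul_one]
  rfl

lemma hatOf_mul_hatVar_pow_comm {s : ℕ} {g : Q.X s →ₗ[A] E.SimpleSum}
    (L : DeformedLifting Q f C g) (j : ℕ) :
    hatOf rf s s (by omega) g * hatVar rf ^ j =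
      (-1 : ℤ) ^ (j * s) • (hatVar rf ^ j * hatOf rf s s (by omega) g) := by
  induction j with
  | zero => simp
  | succ j ih =>
    have h := congrArg ((-1 : ℤ) ^ s • ·) (hatVar_mul_hatOf rf L)
    simp only [zsmul_neg_one_pow_twice] at h
    rw [pow_succ, ← mul_assoc, ih, smul_mul_assoc, mul_assoc, ← h, mul_smul_comm, smul_smul,
      ← mul_assoc, ← pow_add, add_mul, one_mul]

/-- The component of degree `i` of the morphism `Ext_A(S, S) → Ext_{A_f}(S, S)`. -/
noncomputable def inclPiece (i : ℕ) : ExtPiece E.S i →ₗ[k] ExtAlgebra (E.Sf f) :=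
  DirectSum.lof k ℕ (ExtPiece (E.Sf f)) i ∘ₗ
    (hatCls rf i i (by omega) ∘ₗ (clsEquiv k rA i).symm.toLinearMap :
      Ext E.S E.S i →ₗ[k] Ext (E.Sf f) (E.Sf f) i)

lemma inclPiece_clsEquiv (i : ℕ) (g : Q.X i →ₗ[A] E.SimpleSum) :
    inclPiece rA rf i (clsEquiv k rA i g) = hatOf rf i i (by omega) g := by
  change DirectSum.of (ExtPiece (E.Sf f)) i
    (hatCls rf i i _ ((clsEquiv k rA i).symm (clsEquiv k rA i g))) = _
  rw [LinearEquiv.symm_apply_apply]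
  rfl

/-- On both sides the unit is the class of the augmentation. -/
lemma inclPiece_one :
    inclPiece rA rf 0 (GradedMonoid.GOne.one : ExtPiece E.S 0) = 1 := by
  have h : (GradedMonoid.GOne.one : ExtPiece E.S 0) = clsEquiv k rA 0 Q.δ₀ :=
    (ResolutionModel.cls_ε (M := E.SimpleSum) (X := Q.X) (d := fun i => Q.δ i) Q.δ₀ rA
      (hom_δ 0 Q.δ₀)).symm
  have h' : hatCls rf 0 0 (by omega) Q.δ₀ = Ext.mk₀ (𝟙 (E.Sf f)) :=
    ResolutionModel.cls_ε (hatδ₀Lin Q f) rf (hom_hatδ 0 (hatδ₀Lin Q f))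
  rw [h, inclPiece_clsEquiv, hatOf, h']
  rfl

/-- The same γ computes the product over A and, inside the deformed lifting, over A_f; for a = 0 the
sign is trivial. -/
lemma inclPiece_yoneda (H : ∀ {s : ℕ} (g : Q.X s →ₗ[A] E.SimpleSum),
    Nonempty (DeformedLifting Q f C g)) {i s p : ℕ} (hp : i + s = p) (c : Ext E.S E.S i)
    (d : Ext E.S E.S s) :
    inclPiece rA rf p (yoneda c d hp) = inclPiece rA rf i c * inclPiece rA rf s d := by
  obtain rfl : s + i = p := by omega
  obtain ⟨h, rfl⟩ := (clsEquiv k rA i).surjective c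
  obtain ⟨g, rfl⟩ := (clsEquiv k rA s).surjective d
  obtain ⟨L⟩ := H g
  rw [inclPiece_clsEquiv, inclPiece_clsEquiv]
  have h₁ := cls_yoneda_cls rA L i h
  change yoneda (clsEquiv k rA i h) (clsEquiv k rA s g) _ = clsEquiv k rA (s + i) _ at h₁
  rw [h₁, inclPiece_clsEquiv]
  have h₂ := hatOf_mul_hatOf rf L i 0 h
  rw [mul_zero, pow_zero, one_smul] at h₂
  exact h₂.symm

/-- The morphism `Ext_A(S, S) → Ext_{A_f}(S, S)`. -/
noncomputable def incl (H : ∀ {s : ℕ} (g : Q.X s →ₗ[A] E.SimpleSum),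
    Nonempty (DeformedLifting Q f C g)) : ExtAlgebra E.S →ₐ[k] ExtAlgebra (E.Sf f) :=
  DirectSum.toAlgebra k (ExtPiece E.S) (inclPiece rA rf) (inclPiece_one rA rf)
    fun c d => inclPiece_yoneda rA rf H rfl c d

lemma incl_of (H : ∀ {s : ℕ} (g : Q.X s →ₗ[A] E.SimpleSum),
    Nonempty (DeformedLifting Q f C g)) (i : ℕ) (g : Q.X i →ₗ[A] E.SimpleSum) :
    incl rA rf H (DirectSum.of (ExtPiece E.S) i (clsEquiv k rA i g)) =
      hatOf rf i i (by omega) g :=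
  (DirectSum.toSemiring_of (A := ExtPiece E.S) _ (inclPiece_one rA rf)
    (fun c d => inclPiece_yoneda rA rf H rfl c d) i _).trans (inclPiece_clsEquiv rA rf i g)

/-- The morphism `Ext_A(S, S) ⊗ k[x] → Ext_{A_f}(S, S)`. -/
noncomputable def comparison (H : ∀ {s : ℕ} (g : Q.X s →ₗ[A] E.SimpleSum),
    Nonempty (DeformedLifting Q f C g)) :
    GradedTensorProduct k (extGrading k E.S) (polyGrading k) →ₐ[k] ExtAlgebra (E.Sf f) :=
  GradedTensorProduct.lift (extGrading k E.S) (polyGrading k) (incl rA rf H)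
    -- The universal property of the graded tensor product asks that the two images commute up to
    -- the Koszul sign.
    (Polynomial.aeval (hatVar rf)) (by
      rintro i j ⟨_, c, rfl⟩ ⟨_, r, rfl⟩
      obtain ⟨g, rfl⟩ := (clsEquiv k rA i).surjective c
      obtain ⟨L⟩ := H g
      refine Eq.trans ?_ (neg_one_uzpow_smul _ _).symm
      have h₁ := incl_of rA rf H i g
      have h₂ := hatOf_mul_hatVar_pow_comm rf L j
      change incl rA rf H (DirectSum.of (ExtPiece E.S) i (clsEquiv k rA i g)) *
        Polynomial.aeval (hatVar rf) (Polynomial.monomial j r) = _ •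
        (Polynomial.aeval (hatVar rf) (Polynomial.monomial j r) *
        incl rA rf H (DirectSum.of (ExtPiece E.S) i (clsEquiv k rA i g)))
      rw [h₁, Polynomial.aeval_monomial, ← Algebra.smul_def, mul_smul_comm, smul_mul_assoc, h₂,
        smul_comm])

lemma comparison_tensorX (H : ∀ {s : ℕ} (g : Q.X s →ₗ[A] E.SimpleSum),
    Nonempty (DeformedLifting Q f C g)) (i a : ℕ) (g : Q.X i →ₗ[A] E.SimpleSum) :
    comparison rA rf H (tensorX k (clsEquiv k rA i g) a) = hatOf rf (i + a) i (by omega) g := by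
  refine (GradedTensorProduct.lift_tmul _ _ _ _ _ _ _).trans ?_
  rw [incl_of, map_pow, Polynomial.aeval_X, hatOf_mul_hatVar_pow]

/-- The component of degree `p` of the inverse of the comparison morphism. -/
noncomputable def comparisonInvPiece (p : ℕ) : Ext (E.Sf f) (E.Sf f) p →ₗ[k]
    GradedTensorProduct k (extGrading k E.S) (polyGrading k) :=
  (∑ j : Fin (p + 1), tensorXLin k E.S j (p - j) ∘ₗ (clsEquiv k rA j).toLinearMap ∘ₗ
    LinearMap.proj (φ := fun j : Fin (p + 1) => Q.X j →ₗ[A] E.SimpleSum) j) ∘ₗ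
    (hatEquiv rf p).symm.toLinearMap

lemma comparisonInvPiece_hatEquiv (p : ℕ) (g : ∀ j : Fin (p + 1), Q.X j →ₗ[A] E.SimpleSum) :
    comparisonInvPiece rA rf p (hatEquiv rf p g) =
      ∑ j : Fin (p + 1), tensorX k (clsEquiv k rA j (g j)) (p - j) := by
  rw [comparisonInvPiece, LinearMap.comp_apply, LinearEquiv.coe_coe, LinearEquiv.symm_apply_apply,
    LinearMap.sum_apply]
  rfl

lemma comparisonInvPiece_hatCls (p : ℕ) (j : ℕ) (hj : j < p + 1) (g : Q.X j →ₗ[A] E.SimpleSum) :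
    comparisonInvPiece rA rf p (hatCls rf p j hj g) = tensorX k (clsEquiv k rA j g) (p - j) := by
  rw [comparisonInvPiece, LinearMap.comp_apply, LinearEquiv.coe_coe,
    hatEquiv_symm_hatCls rf p ⟨j, hj⟩ g, LinearMap.sum_apply, Finset.sum_eq_single ⟨j, hj⟩]
  · change tensorXLin k E.S j (p - j) (clsEquiv k rA j
      (Pi.single (M := fun j : Fin (p + 1) => Q.X j →ₗ[A] E.SimpleSum) ⟨j, hj⟩ g ⟨j, hj⟩)) = _
    rw [Pi.single_eq_same]
    rfl
  · intro i _ hi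
    change tensorXLin k E.S i (p - i) (clsEquiv k rA i
      (Pi.single (M := fun j : Fin (p + 1) => Q.X j →ₗ[A] E.SimpleSum) ⟨j, hj⟩ g i)) = 0
    rw [Pi.single_eq_of_ne hi, map_zero, map_zero]
  · simp

/-- The inverse of the comparison morphism. -/
noncomputable def comparisonInv : ExtAlgebra (E.Sf f) →ₗ[k]
    GradedTensorProduct k (extGrading k E.S) (polyGrading k) :=
  DirectSum.toModule k ℕ _ fun p => (comparisonInvPiece rA rf p : ExtPiece (E.Sf f) p →ₗ[k] _)

lemma comparisonInv_of (p : ℕ) (c : Ext (E.Sf f) (E.Sf f) p) :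
    comparisonInv rA rf (DirectSum.of (ExtPiece (E.Sf f)) p c) = comparisonInvPiece rA rf p c :=
  DirectSum.toModule_lof k (M := ExtPiece (E.Sf f)) p c

variable (H : ∀ {s : ℕ} (g : Q.X s →ₗ[A] E.SimpleSum), Nonempty (DeformedLifting Q f C g))

lemma comparison_sum (p : ℕ) (g : ∀ j : Fin (p + 1), Q.X j →ₗ[A] E.SimpleSum) :
    comparison rA rf H (∑ j : Fin (p + 1), tensorX k (clsEquiv k rA j (g j)) (p - j)) =
      DirectSum.of (ExtPiece (E.Sf f)) p (hatEquiv rf p g) := by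
  rw [hatEquiv_apply, map_sum]
  refine Eq.trans ?_ (map_sum (DirectSum.of (ExtPiece (E.Sf f)) p) _ _).symm
  refine Finset.sum_congr rfl fun j _ => ?_
  rw [comparison_tensorX]
  exact hatOf_congr rf (by omega) _ _ _

lemma comparison_comparisonInv (x : ExtAlgebra (E.Sf f)) :
    comparison rA rf H (comparisonInv rA rf x) = x := by
  induction x using DirectSum.induction_on with
  | zero => rw [map_zero, map_zero]
  | add x y hx hy => rw [map_add, map_add, hx, hy]
  | of p c =>
    obtain ⟨g, rfl⟩ := (hatEquiv rf p).surjective c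
    rw [comparisonInv_of, comparisonInvPiece_hatEquiv, comparison_sum]

lemma comparisonInv_comparison (x : GradedTensorProduct k (extGrading k E.S) (polyGrading k)) :
    comparisonInv rA rf (comparison rA rf H x) = x := by
  induction span_tensorX k x using Submodule.span_induction with
  | mem x hx =>
    obtain ⟨i, a, c, rfl⟩ := hx
    obtain ⟨g, rfl⟩ := (clsEquiv k rA i).surjective c
    rw [comparison_tensorX, hatOf, comparisonInv_of, comparisonInvPiece_hatCls,
      Nat.add_sub_cancel_left]
  | zero => rw [map_zero, map_zero]
  | add x y _ _ hx hy => rw [map_add, map_add, hx, hy]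
  | smul r x _ hx => rw [map_smul, map_smul, hx]

/-- The isomorphism of `Ext_A(S, S) ⊗ k[x]` with `Ext_{A_f}(S, S)`. -/
noncomputable def comparisonEquiv :
    GradedTensorProduct k (extGrading k E.S) (polyGrading k) ≃ₐ[k] ExtAlgebra (E.Sf f) :=
  AlgEquiv.ofBijective (comparison rA rf H)
    ⟨Function.LeftInverse.injective (comparisonInv_comparison rA rf H),
      Function.RightInverse.surjective (comparison_comparisonInv rA rf H)⟩

lemma map_tensorGrading (p : ℕ) :
    (tensorGrading k E.S p).map (comparison rA rf H).toLinearMap = extGrading k (E.Sf f) p := by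
  apply le_antisymm
  · rw [tensorGrading, Submodule.map_span, Submodule.span_le]
    rintro _ ⟨_, ⟨i, a, c, rfl, rfl⟩, rfl⟩
    obtain ⟨g, rfl⟩ := (clsEquiv k rA i).surjective c
    exact ⟨_, (comparison_tensorX rA rf H i a g).symm⟩
  · rintro _ ⟨c, rfl⟩
    obtain ⟨g, rfl⟩ := (hatEquiv rf p).surjective c
    refine ⟨∑ j : Fin (p + 1), tensorX k (clsEquiv k rA j (g j)) (p - j),
      Submodule.sum_mem _ fun j _ => Submodule.subset_span ⟨j, p - j, _, ?_, rfl⟩,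
      comparison_sum rA rf H p g⟩
    omega

/-- The coefficients g_j correspond to the components under `hatEquiv`, through Hom_A(Q_j, S) ≅
Ext^j_A(S, S). -/
lemma existsUnique_eq_comparison_sum (p : ℕ) (c : Ext (E.Sf f) (E.Sf f) p) :
    ∃! g : ∀ i : Fin (p + 1), Ext E.S E.S (i : ℕ),
      DirectSum.of (ExtPiece (E.Sf f)) p c =
        comparison rA rf H (∑ i, tensorX k (g i) (p - i)) := by
  obtain ⟨g, rfl⟩ := (hatEquiv rf p).surjective c
  refine ⟨fun j => clsEquiv k rA j (g j), (comparison_sum rA rf H p g).symm, fun g' hg' => ?_⟩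
  obtain ⟨h, rfl⟩ : ∃ h : ∀ j : Fin (p + 1), Q.X j →ₗ[A] E.SimpleSum,
      (fun j : Fin (p + 1) => clsEquiv k rA j (h j)) = g' :=
    ⟨fun j => (clsEquiv k rA j).symm (g' j), funext fun j => LinearEquiv.apply_symm_apply _ _⟩
  have h₁ := hg'.trans (comparison_sum rA rf H p h)
  have h₂ := (hatEquiv rf p).injective (DirectSum.of_injective (β := ExtPiece (E.Sf f)) p h₁)
  rw [h₂]

/-- Multiplicativity of the comparison reduces the formula to the Koszul sign of moving x^(m-i) past
g_s. -/
lemma of_yoneda_eq_comparison (m p : ℕ) (ĥ : Ext (E.Sf f) (E.Sf f) m)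
    (ĝ : Ext (E.Sf f) (E.Sf f) p) (h : ∀ i : Fin (m + 1), Ext E.S E.S (i : ℕ))
    (g : ∀ s : Fin (p + 1), Ext E.S E.S (s : ℕ))
    (hh : DirectSum.of (ExtPiece (E.Sf f)) m ĥ =
      comparison rA rf H (∑ i, tensorX k (h i) (m - i)))
    (hg : DirectSum.of (ExtPiece (E.Sf f)) p ĝ =
      comparison rA rf H (∑ s, tensorX k (g s) (p - s))) :
    DirectSum.of (ExtPiece (E.Sf f)) (m + p) (yoneda ĥ ĝ rfl) =
      comparison rA rf H (∑ i : Fin (m + 1), ∑ s : Fin (p + 1),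
        (-1 : k) ^ ((s : ℕ) * (m - (i : ℕ))) •
          tensorX k (yoneda (h i) (g s) rfl) (m + p - i - s)) := by
  rw [of_yoneda, hh, hg, ← map_mul, Finset.sum_mul_sum]
  congr 1
  refine Finset.sum_congr rfl fun i _ => Finset.sum_congr rfl fun s _ => ?_
  rw [tensorX_mul_tensorX k _ _ _ _ rfl, mul_comm (m - (i : ℕ)),
    show m - (i : ℕ) + (p - s) = m + p - i - s by omega]

end MinimalResolution

end InfDef

theorem mainTheorem2 {k : Type u} [Field k] [IsAlgClosed k] {A : Type u} [Ring A] [Algebra k A]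
    [FiniteDimensional k A] {n : ℕ} (E : BasicDecomposition A n) (f : HochschildCocycle k A)
    (Q : MinimalResolution E E.SimpleSum) (hQ : Q.Star f)
    (C : ∀ i, E.Corner (Q.idx (i + 1)) (Q.idx i)) (hC : Q.IsCorrection f C)
    (hα : ∀ i x, Q.α f C i x ∈ Module.jacobson A (Q.X i)) :
    ∃ (rA : ResolutionModel A E.SimpleSum Q.X (fun i => Q.δ i) Q.δ₀)
      (rf : ResolutionModel (Deformation f) (embed f E.SimpleSum).Carrier (Q.HatX f)
        (Q.hatδ f C) (Q.hatδ₀ f))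
      -- an isomorphism of `k`-algebras `Ext_A(S, S) ⊗ k[x] ≃ Ext_{A_f}(S, S)`
      (Ψ : GradedTensorProduct k (extGrading k E.S) (polyGrading k) ≃ₐ[k] ExtAlgebra (E.Sf f)),
      -- which preserves the gradings
      (∀ p : ℕ, (tensorGrading k E.S p).map Ψ.toLinearMap = extGrading k (E.Sf f) p) ∧
      -- it sends `[g] ⊗ x^a`, for `g : Q_i → S`, to the class of `(0, g, 0) : ⨁_{j ≤ i+a} Q̂_j → S`
      (∀ (i a : ℕ) (g : Q.X i →ₗ[A] E.SimpleSum),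
        ∃ (hg : ∀ x, g (Q.δ i x) = 0)
          (hg' : ∀ x, Q.hatHom f i a g (Q.hatδ f C (i + a) x) = 0),
          Ψ (tensorX k (rA.cls i g hg) a) =
            DirectSum.of (ExtPiece (E.Sf f)) (i + a) (rf.cls (i + a) (Q.hatHom f i a g) hg')) ∧
      -- every `ĝ ∈ Ext^p_{A_f}(S, S)` is uniquely of the form `∑ g_i x^(p-i)`
      (∀ (p : ℕ) (ĝ : CategoryTheory.Abelian.Ext (E.Sf f) (E.Sf f) p),
        ∃! g : ∀ i : Fin (p + 1), CategoryTheory.Abelian.Ext E.S E.S (i : ℕ),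
          DirectSum.of (ExtPiece (E.Sf f)) p ĝ = Ψ (∑ i, tensorX k (g i) (p - i))) ∧
      -- the Yoneda product of `∑ h_i x^(m-i)` and `∑ g_s x^(p-s)`
      (∀ (m p : ℕ) (ĥ : CategoryTheory.Abelian.Ext (E.Sf f) (E.Sf f) m)
        (ĝ : CategoryTheory.Abelian.Ext (E.Sf f) (E.Sf f) p)
        (h : ∀ i : Fin (m + 1), CategoryTheory.Abelian.Ext E.S E.S (i : ℕ))
        (g : ∀ s : Fin (p + 1), CategoryTheory.Abelian.Ext E.S E.S (s : ℕ)),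
        DirectSum.of (ExtPiece (E.Sf f)) m ĥ = Ψ (∑ i, tensorX k (h i) (m - i)) →
        DirectSum.of (ExtPiece (E.Sf f)) p ĝ = Ψ (∑ s, tensorX k (g s) (p - s)) →
        DirectSum.of (ExtPiece (E.Sf f)) (m + p) (yoneda ĥ ĝ rfl) =
          Ψ (∑ i : Fin (m + 1), ∑ s : Fin (p + 1), (-1 : k) ^ ((s : ℕ) * (m - (i : ℕ))) •
            tensorX k (yoneda (h i) (g s) rfl) (m + p - i - s))) := by
  -- The only consequence of Im α ⊂ rad that exactness of the resolution needs; the liftings use the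
  -- full condition.
  have hα₀ (x) : Q.δ₀ (Q.α f C 0 x) = 0 := E.hom_eq_zero_of_mem_jacobson _ (hα 0 x)
  have H {s : ℕ} (g : Q.X s →ₗ[A] E.SimpleSum) :
      Nonempty (MinimalResolution.DeformedLifting Q f C g) :=
    MinimalResolution.exists_deformedLifting hC hα g
  refine ⟨Q.model, MinimalResolution.hatModel hC hα₀,
    MinimalResolution.comparisonEquiv _ _ H, MinimalResolution.map_tensorGrading _ _ H,
    fun i a g => ⟨MinimalResolution.hom_δ i g, MinimalResolution.hom_hatδ (i + a) _,
      MinimalResolution.comparison_tensorX _ _ H i a g⟩,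
    MinimalResolution.existsUnique_eq_comparison_sum _ _ H,
    MinimalResolution.of_yoneda_eq_comparison _ _ H⟩
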